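/- **Setting.** Let $X$ be a totally disconnected compact metric space and let $\sigma\colon X\to X$ be a surjective local homeomorphism. A partition of $X$ is a finite family of nonempty, pairwise disjoint clopen subsets covering $X$; write $\mathcal P\precsim\mathcal Q$ if every member of $\mathcal Q$ is contained in a member of $\mathcal P$, and $\mathcal P\vee\mathcal Q$ for the family of all nonempty intersections $Y\cap Z$, $Y\in\mathcal P$, $Z\in\mathcal Q$. Let $N(\sigma)=\sup_x|\sigma^{-1}(x)|$, $\mathcal U_{\ge k}=\{x:|\sigma^{-1}(x)|\ge k\}$, and, for a family $\mathcal P$ of subsets of $X$, $$\mathcal P^\sigma=\bigcup_{k=1}^{N(\sigma)}\{\sigma(Z_1)\cap\dots\cap\sigma(Z_k)\setminus\mathcal U_{\ge k+1}\neq\emptyset : Z_1,\dots,Z_k\in\mathcal P\text{ distinct}\},\qquad \sigma^{-1}(\mathcal P)=\{\sigma^{-1}(Z):Z\in\mathcal P\}.$$ Let $(\mathcal P_n)_{n\ge0}$ be a $\sigma$-refined sequence of partitions: $\sigma|_Z$ is a homeomorphism onto its image for $Z\in\mathcal P_0$; $\mathcal P_n\precsim\mathcal P_{n+1}$; $\bigcup_n\mathcal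 P_n$ generates the topology; $\max_{Z\in\mathcal P_n}\operatorname{diam}Z\to0$; and $\mathcal P_{2j}\vee\mathcal P_{2j}^\sigma\precsim\mathcal P_{2j+1}$, $\mathcal P_{2j+1}\vee\sigma^{-1}(\mathcal P_{2j+1})\precsim\mathcal P_{2j+2}$ for all $j\ge0$. **Separated graphs.** A separated graph $(E,C)$ is a directed graph with source and range maps $s,r$ together with, for each vertex $v$, a partition $C_v$ of $r^{-1}(v)$ into nonempty sets. Its Leavitt path algebra $L_{\mathbb C}(E,C)$ is the universal (not necessarily unital) complex $*$-algebra generated by vertices and edges with the relations $vw=\delta_{v,w}v$, $v^*=v$; $r(e)e=e\,s(e)=e$; $e^*f=\delta_{e,f}s(e)$ for $e,f\in Y\in C_v$; $v=\sum_{e\in Y}ee^*$ for $Y\in C_v$ finite. Its graph $C^*$-algebra $C^*(E,C)$ is the enveloping $C^*$-algebra of $L_{\mathbb C}(E,C)$. **The layers.** For $n\ge0$ let $(F_n,D^n)$ be the separated graph with vertex set $\mathcal P_n\sqcup\mathcal P_{n+1}$ and the following edges, all with range in $\mathcal P_n$ and source in $\mathcal P_{n+1}$: a blue edge with range $Z$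 and source $Z'$ whenever $Z'\subseteq Z$; a red edge with range $Z$ and source $Z'$ whenever $Z'\subseteq\sigma(Z)$ (for $n$ even), respectively $Z'\subseteq\sigma^{-1}(Z)$ (for $n$ odd). Write $B_Z$, $R_Z$ for the sets of blue and red edges with range $Z$. For a red edge $f$ of $F_{n-1}$, with $n$ odd, let $R(f)=\{g\in R_{s(f)}: s(g)\subseteq r(f)\}$. For $Z\in\mathcal P_n$ the separation is $\{B_Z,R_Z\}$ if $n$ is even, and $\{B_Z\}\cup\{R(f): f\text{ a red edge of }F_{n-1},\ s(f)=Z\}$ if $n$ is odd. Put $L_n=L_{\mathbb C}(F_n,D^n)$, $C_n=C^*(F_n,D^n)$ and $p_n=\sum_{Z\in\mathcal P_n}Z\in L_n$; the image of $p_n$ in $C_n$ is denoted in the same way. Let $\tilde\phi_n\colon L_n\to L_{n+1}$ be the $*$-homomorphism with $$W\mapsto W\ (W\in\mathcal P_{n+1}),\qquad Z\mapsto\sum_{W\in\mathcal P_{n+2},\,W\subseteq Z}W\ (Z\in\mathcal P_n),\qquad e\mapsto\sum_{\bar e\in B_{s(e)}}\bar e^{\,*}\ (e\text{ blue}),$$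 and, for $f$ red, $f\mapsto\sum_{g\in R(f)}g^*$ if $n$ is even and $f\mapsto\sum_{g\in R_{s(f)}}g^*$ if $n$ is odd. It extends to a $*$-homomorphism $\tilde\phi_n\colon C_n\to C_{n+1}$. One has $\tilde\phi_{n+1}\tilde\phi_n(p_n)=p_{n+2}$. Let $\mathcal A_{2n}=p_{2n}L_{2n}p_{2n}$ and $\mathcal B_{2n}=p_{2n}C_{2n}p_{2n}$, with connecting maps $\phi_n$ the restrictions of $\tilde\phi_{2n+1}\tilde\phi_{2n}$. Let $\mathcal A_\infty$ be the colimit of the $\mathcal A_{2n}$ as $*$-algebras and $\mathcal B_\infty$ the colimit of the $\mathcal B_{2n}$ in the category of $C^*$-algebras; the canonical maps $L_{2n}\to C_{2n}$ induce a $*$-homomorphism $\iota\colon\mathcal A_\infty\to\mathcal B_\infty$. **The groupoid.** Let $\mathcal G(X,\sigma)=\{(x,m-n,y): m,n\in\mathbb N,\ \sigma^m(x)=\sigma^n(y)\}$ be the Deaconu–Renault groupoid, with $(x,k,y)(y,l,z)=(x,k+l,z)$ and $(x,k,y)^{-1}=(y,-k,x)$, and with the topology generated by the sets $Z(U,m,n,V)=\{(x,m-n,y):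 x\in U,\ y\in V,\ \sigma^m(x)=\sigma^n(y)\}$, $U,V\subseteq X$ open. Its Steinberg algebra $A_{\mathbb C}(\mathcal G(X,\sigma))$ is the $*$-algebra of locally constant, compactly supported functions $f\colon\mathcal G(X,\sigma)\to\mathbb C$ with $(f*g)(\gamma)=\sum_{s(\alpha)=s(\gamma)}f(\gamma\alpha^{-1})g(\alpha)$ and $f^*(\gamma)=\overline{f(\gamma^{-1})}$, and $C^*(\mathcal G(X,\sigma))$ is its enveloping $C^*$-algebra. **Theorem.** (1) There is a unique $*$-isomorphism $\varphi\colon\mathcal A_\infty\to A_{\mathbb C}(\mathcal G(X,\sigma))$ with the following values, for all $n\ge0$. The class of a vertex $U\in\mathcal P_{2n}$ is mapped to $\mathbf 1_{Z(U,0,0,U)}$. The class of $ef^*$, for edges $e,f$ of $F_{2n}$ with $s(e)=s(f)$, is mapped to $\mathbf 1_{Z(Y_e,d_e,d_f,Y_f)}$, where $Y_e=s(e)$, $d_e=0$ if $e$ is blue, and $Y_e=(\sigma|_{r(e)})^{-1}(s(e))$, $d_e=1$ if $e$ is red. (2) For this $\varphi$ there is a unique $*$-isomorphism $\overline\varphi\colon\mathcal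 B_\infty\to C^*(\mathcal G(X,\sigma))$ such that $\overline\varphi\circ\iota=\kappa\circ\varphi$, where $\kappa\colon A_{\mathbb C}(\mathcal G(X,\sigma))\to C^*(\mathcal G(X,\sigma))$ is the canonical map. -/

import Mathlib

noncomputable section

namespace DRAlg

universe u v w

set_option linter.unusedSectionVars false
set_option linter.unusedVariables false

/-! ## `*`-algebras given by generators and relations -/

/-- Formal `*`-algebra expressions over `ℂ` in a set `X` of generators. -/
inductive StarTerm (X : Type u) : Type u
  | of : X → StarTerm X
  | zero : StarTerm X
  | add : StarTerm X → StarTerm X → StarTerm X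
  | mul : StarTerm X → StarTerm X → StarTerm X
  | smul : ℂ → StarTerm X → StarTerm X
  | adj : StarTerm X → StarTerm X

/-- The formal sum of a list of expressions. -/
def StarTerm.sum {X : Type u} : List (StarTerm X) → StarTerm X
  | [] => StarTerm.zero
  | t :: l => StarTerm.add t (StarTerm.sum l)

/-- The congruence on expressions generated by the axioms of (not necessarily unital)
associative complex `*`-algebras and by the relations `R`. -/
inductive TermRel {X : Type u} (R : StarTerm X → StarTerm X → Prop) : StarTerm X → StarTerm X → Prop
  | base {a b : StarTerm X} : R a b → TermRel R a b
  | refl (a : StarTerm X) : TermRel R a a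
  | symm {a b : StarTerm X} : TermRel R a b → TermRel R b a
  | trans {a b c : StarTerm X} : TermRel R a b → TermRel R b c → TermRel R a c
  | add_congr {a a' b b' : StarTerm X} : TermRel R a a' → TermRel R b b' → TermRel R (a.add b) (a'.add b')
  | mul_congr {a a' b b' : StarTerm X} : TermRel R a a' → TermRel R b b' → TermRel R (a.mul b) (a'.mul b')
  | smul_congr (c : ℂ) {a a' : StarTerm X} : TermRel R a a' → TermRel R (a.smul c) (a'.smul c)
  | adj_congr {a a' : StarTerm X} : TermRel R a a' → TermRel R a.adj a'.adj
  | add_assoc (a b c : StarTerm X) : TermRel R ((a.add b).add c) (a.add (b.add c))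
  | add_comm (a b : StarTerm X) : TermRel R (a.add b) (b.add a)
  | zero_add (a : StarTerm X) : TermRel R (StarTerm.zero.add a) a
  | neg_add (a : StarTerm X) : TermRel R ((a.smul (-1)).add a) StarTerm.zero
  | mul_assoc (a b c : StarTerm X) : TermRel R ((a.mul b).mul c) (a.mul (b.mul c))
  | mul_add (a b c : StarTerm X) : TermRel R (a.mul (b.add c)) ((a.mul b).add (a.mul c))
  | add_mul (a b c : StarTerm X) : TermRel R ((a.add b).mul c) ((a.mul c).add (b.mul c))
  | one_smul (a : StarTerm X) : TermRel R (a.smul 1) a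
  | smul_smul (c d : ℂ) (a : StarTerm X) : TermRel R (a.smul (c * d)) ((a.smul d).smul c)
  | smul_add (c : ℂ) (a b : StarTerm X) : TermRel R ((a.add b).smul c) ((a.smul c).add (b.smul c))
  | add_smul (c d : ℂ) (a : StarTerm X) : TermRel R (a.smul (c + d)) ((a.smul c).add (a.smul d))
  | smul_mul (c : ℂ) (a b : StarTerm X) : TermRel R ((a.smul c).mul b) ((a.mul b).smul c)
  | mul_smul (c : ℂ) (a b : StarTerm X) : TermRel R (a.mul (b.smul c)) ((a.mul b).smul c)
  | adj_adj (a : StarTerm X) : TermRel R a.adj.adj a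
  | adj_add (a b : StarTerm X) : TermRel R (a.add b).adj (a.adj.add b.adj)
  | adj_mul (a b : StarTerm X) : TermRel R (a.mul b).adj (b.adj.mul a.adj)
  | adj_smul (c : ℂ) (a : StarTerm X) : TermRel R (a.smul c).adj (a.adj.smul (star c))

/-- The congruence, as an equivalence relation. -/
def termSetoid {X : Type u} (R : StarTerm X → StarTerm X → Prop) : Setoid (StarTerm X) :=
  ⟨TermRel R, ⟨TermRel.refl, TermRel.symm, TermRel.trans⟩⟩

/-- The universal complex `*`-algebra with generators `X` and relations `R`. -/
def StarPres {X : Type u} (R : StarTerm X → StarTerm X → Prop) : Type u := Quotient (termSetoid R)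

namespace StarPres

variable {X : Type u} {R : StarTerm X → StarTerm X → Prop}

/-- The class of an expression. -/
def mk (R : StarTerm X → StarTerm X → Prop) (t : StarTerm X) : StarPres R := Quotient.mk (termSetoid R) t

/-- The class of a generator. -/
def of (R : StarTerm X → StarTerm X → Prop) (x : X) : StarPres R := mk R (.of x)

theorem sound {a b : StarTerm X} (h : TermRel R a b) : mk R a = mk R b := Quotient.sound h

@[elab_as_elim] theorem ind {P : StarPres R → Prop} (a : StarPres R) (h : ∀ t, P (mk R t)) : P a :=
  Quotient.ind (motive := P) h a

@[elab_as_elim] theorem ind₂ {P : StarPres R → StarPres R → Prop} (a b : StarPres R)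
    (h : ∀ s t, P (mk R s) (mk R t)) : P a b := ind a fun s => ind b fun t => h s t

@[elab_as_elim] theorem ind₃ {P : StarPres R → StarPres R → StarPres R → Prop}
    (a b c : StarPres R) (h : ∀ s t r, P (mk R s) (mk R t) (mk R r)) : P a b c :=
  ind₂ a b fun s t => ind c fun r => h s t r

instance : Zero (StarPres R) := ⟨mk R .zero⟩
instance : Add (StarPres R) :=
  ⟨Quotient.map₂ StarTerm.add fun _ _ h _ _ h' => TermRel.add_congr h h'⟩
instance : Mul (StarPres R) :=
  ⟨Quotient.map₂ StarTerm.mul fun _ _ h _ _ h' => TermRel.mul_congr h h'⟩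
instance : SMul ℂ (StarPres R) :=
  ⟨fun c => Quotient.map (StarTerm.smul c) fun _ _ h => TermRel.smul_congr c h⟩
instance : Neg (StarPres R) := ⟨fun a => (-1 : ℂ) • a⟩
instance : Star (StarPres R) := ⟨Quotient.map StarTerm.adj fun _ _ h => TermRel.adj_congr h⟩

theorem zero_add' (a : StarPres R) : 0 + a = a := ind a fun a => sound (.zero_add a)
theorem add_comm' (a b : StarPres R) : a + b = b + a :=
  ind₂ a b fun a b => sound (.add_comm a b)
theorem add_assoc' (a b c : StarPres R) : a + b + c = a + (b + c) :=
  ind₃ a b c fun a b c => sound (.add_assoc a b c)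
theorem neg_add' (a : StarPres R) : -a + a = 0 := ind a fun a => sound (.neg_add a)

instance : AddCommGroup (StarPres R) where
  add_assoc := add_assoc'
  zero_add := zero_add'
  add_zero a := by rw [add_comm', zero_add']
  add_comm := add_comm'
  neg_add_cancel := neg_add'
  nsmul := nsmulRec
  zsmul := zsmulRec

theorem mul_add' (a b c : StarPres R) : a * (b + c) = a * b + a * c :=
  ind₃ a b c fun a b c => sound (.mul_add a b c)
theorem add_mul' (a b c : StarPres R) : (a + b) * c = a * c + b * c :=
  ind₃ a b c fun a b c => sound (.add_mul a b c)

instance : NonUnitalRing (StarPres R) where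
  left_distrib := mul_add'
  right_distrib := add_mul'
  zero_mul a := by
    have h := add_mul' (0 : StarPres R) 0 a
    rw [add_zero] at h
    exact left_eq_add.mp h
  mul_zero a := by
    have h := mul_add' a (0 : StarPres R) 0
    rw [add_zero] at h
    exact left_eq_add.mp h
  mul_assoc a b c :=
    ind₃ a b c fun a b c => sound (.mul_assoc a b c)

theorem smul_add' (c : ℂ) (a b : StarPres R) : c • (a + b) = c • a + c • b :=
  ind₂ a b fun a b => sound (.smul_add c a b)
theorem add_smul' (c d : ℂ) (a : StarPres R) : (c + d) • a = c • a + d • a :=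
  ind a fun a => sound (.add_smul c d a)

instance : Module ℂ (StarPres R) where
  one_smul a := ind a fun a => sound (.one_smul a)
  mul_smul c d a := ind a fun a => sound (.smul_smul c d a)
  smul_add := smul_add'
  smul_zero c := by
    have h := smul_add' c (0 : StarPres R) 0
    rw [add_zero] at h
    exact left_eq_add.mp h
  add_smul := add_smul'
  zero_smul a := by
    have h := add_smul' 0 0 a
    rw [add_zero] at h
    exact left_eq_add.mp h

instance : IsScalarTower ℂ (StarPres R) (StarPres R) where
  smul_assoc c a b := ind₂ a b fun a b => sound (.smul_mul c a b)

instance : SMulCommClass ℂ (StarPres R) (StarPres R) where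
  smul_comm c a b := ind₂ a b fun a b => sound (.symm (.mul_smul c a b))

instance : StarRing (StarPres R) where
  star_involutive a := ind a fun a => sound (.adj_adj a)
  star_mul a b := ind₂ a b fun a b => sound (.adj_mul a b)
  star_add a b := ind₂ a b fun a b => sound (.adj_add a b)

instance : StarModule ℂ (StarPres R) where
  star_smul c a := ind a fun a => sound (.adj_smul c a)

section lift

variable {A : Type v} [NonUnitalRing A] [StarRing A] [Module ℂ A] [IsScalarTower ℂ A A]
  [SMulCommClass ℂ A A] [StarModule ℂ A]

/-- Evaluation of an expression in a `*`-algebra. -/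
def eval (f : X → A) : StarTerm X → A
  | .of x => f x
  | .zero => 0
  | .add a b => eval f a + eval f b
  | .mul a b => eval f a * eval f b
  | .smul c a => c • eval f a
  | .adj a => star (eval f a)

theorem eval_sum (f : X → A) (l : List (StarTerm X)) : eval f (StarTerm.sum l) = (l.map (eval f)).sum := by
  induction l with
  | nil => rfl
  | cons t l ih => simp [StarTerm.sum, eval, ih]

theorem eval_rel (f : X → A) (hf : ∀ a b, R a b → eval f a = eval f b) {a b : StarTerm X}
    (h : TermRel R a b) : eval f a = eval f b := by
  induction h with
  | base h => exact hf _ _ h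
  | refl => rfl
  | symm _ ih => exact ih.symm
  | trans _ _ ih ih' => exact ih.trans ih'
  | add_congr _ _ ih ih' => simp [eval, ih, ih']
  | mul_congr _ _ ih ih' => simp [eval, ih, ih']
  | smul_congr _ _ ih => simp [eval, ih]
  | adj_congr _ ih => simp [eval, ih]
  | add_assoc => simp [eval, add_assoc]
  | add_comm => simp [eval, add_comm]
  | zero_add => simp [eval]
  | neg_add => simp [eval]
  | mul_assoc => simp [eval, mul_assoc]
  | mul_add => simp [eval, mul_add]
  | add_mul => simp [eval, add_mul]
  | one_smul => simp [eval]
  | smul_smul => simp [eval, SemigroupAction.mul_smul]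
  | smul_add => simp [eval]
  | add_smul => simp [eval, Module.add_smul]
  | smul_mul => simp [eval, smul_mul_assoc]
  | mul_smul => simp [eval, mul_smul_comm]
  | adj_adj => simp [eval]
  | adj_add => simp [eval]
  | adj_mul => simp [eval]
  | adj_smul => simp [eval]

/-- The universal property of the presented `*`-algebra. -/
def lift (f : X → A) (hf : ∀ a b, R a b → eval f a = eval f b) : StarPres R →⋆ₙₐ[ℂ] A where
  toFun := Quotient.lift (eval f) fun _ _ h => eval_rel f hf h
  map_smul' c a := ind a fun _ => rfl
  map_zero' := rfl
  map_add' a b := ind₂ a b fun _ _ => rfl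
  map_mul' a b := ind₂ a b fun _ _ => rfl
  map_star' a := ind a fun _ => rfl

@[simp] theorem lift_of (f : X → A) (hf : ∀ a b, R a b → eval f a = eval f b) (x : X) :
    lift f hf (of R x) = f x := rfl

theorem eval_of (t : StarTerm X) : eval (of R) t = mk R t := by
  induction t with
  | of x => rfl
  | zero => rfl
  | add a b ha hb => simp only [eval, ha, hb]; rfl
  | mul a b ha hb => simp only [eval, ha, hb]; rfl
  | smul c a ha => simp only [eval, ha]; rfl
  | adj a ha => simp only [eval, ha]; rfl

theorem eval_eq_of_rel {a b : StarTerm X} (h : R a b) : eval (of R) a = eval (of R) b := by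
  rw [eval_of, eval_of]; exact sound (.base h)

end lift

end StarPres

/-! ## Completion of a `*`-algebra with a submultiplicative `C*`-seminorm -/

section Completion

open UniformSpace

variable {R : Type u} [NonUnitalSeminormedRing R]

/-- Multiplication on the completion, extended by continuity. -/
instance complMul : Mul (Completion R) :=
  ⟨Function.curry <| ((Completion.isDenseInducing_coe (α := R)).prodMap
    (Completion.isDenseInducing_coe (α := R))).extend
      ((fun a : R => (a : Completion R)) ∘ Function.uncurry (· * ·))⟩

theorem compl_coe_mul (a b : R) : ((a * b : R) : Completion R) = a * b :=
  (((Completion.isDenseInducing_coe (α := R)).prodMap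
    (Completion.isDenseInducing_coe (α := R))).extend_eq
      ((Completion.continuous_coe R).comp continuous_mul) (a, b)).symm

instance complContinuousMul : ContinuousMul (Completion R) where
  continuous_mul := by
    let m := (AddMonoidHom.mul : R →+ R →+ R).compr₂ Completion.toCompl
    have : Continuous fun p : R × R => m p.1 p.2 :=
      (Completion.continuous_coe R).comp continuous_mul
    have di : IsDenseInducing (Completion.toCompl : R → Completion R) :=
      Completion.isDenseInducing_coe
    exact (di.extend_Z_bilin di this :)

instance complNonUnitalRing : NonUnitalRing (Completion R) where
  __ := (inferInstance : AddCommGroup (Completion R))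
  left_distrib a b c := Completion.induction_on₃ a b c (isClosed_eq (by fun_prop) (by fun_prop))
    fun a b c => by simp only [← Completion.coe_add, ← compl_coe_mul, mul_add]
  right_distrib a b c := Completion.induction_on₃ a b c (isClosed_eq (by fun_prop) (by fun_prop))
    fun a b c => by simp only [← Completion.coe_add, ← compl_coe_mul, add_mul]
  zero_mul a := Completion.induction_on a (isClosed_eq (by fun_prop) (by fun_prop))
    fun a => by rw [← Completion.coe_zero, ← compl_coe_mul, zero_mul]
  mul_zero a := Completion.induction_on a (isClosed_eq (by fun_prop) (by fun_prop))
    fun a => by rw [← Completion.coe_zero, ← compl_coe_mul, mul_zero]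
  mul_assoc a b c := Completion.induction_on₃ a b c (isClosed_eq (by fun_prop) (by fun_prop))
    fun a b c => by simp only [← compl_coe_mul, mul_assoc]

instance complNonUnitalNormedRing : NonUnitalNormedRing (Completion R) where
  __ := (inferInstance : NormedAddCommGroup (Completion R))
  __ := (inferInstance : NonUnitalRing (Completion R))
  norm_mul_le a b := Completion.induction_on₂ a b (isClosed_le (by fun_prop) (by fun_prop))
    fun a b => by simpa only [← compl_coe_mul, Completion.norm_coe] using norm_mul_le a b

section smul

variable [NormedSpace ℂ R]

theorem compl_smul_mul [IsScalarTower ℂ R R] (c : ℂ) (a b : Completion R) :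
    (c • a) * b = c • (a * b) := by
  induction a, b using Completion.induction_on₂ with
  | hp =>
    exact isClosed_eq ((continuous_fst.const_smul c).mul continuous_snd)
      ((continuous_fst.mul continuous_snd).const_smul c)
  | ih a b =>
    rw [← Completion.coe_smul, ← compl_coe_mul, ← compl_coe_mul, ← Completion.coe_smul,
      smul_mul_assoc]

theorem compl_mul_smul [SMulCommClass ℂ R R] (c : ℂ) (a b : Completion R) :
    a * (c • b) = c • (a * b) := by
  induction a, b using Completion.induction_on₂ with
  | hp =>
    exact isClosed_eq (continuous_fst.mul (continuous_snd.const_smul c))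
      ((continuous_fst.mul continuous_snd).const_smul c)
  | ih a b =>
    rw [← Completion.coe_smul, ← compl_coe_mul, ← compl_coe_mul, ← Completion.coe_smul,
      mul_smul_comm]

instance complIsScalarTower [IsScalarTower ℂ R R] :
    IsScalarTower ℂ (Completion R) (Completion R) := ⟨compl_smul_mul⟩

instance complSMulCommClass [SMulCommClass ℂ R R] :
    SMulCommClass ℂ (Completion R) (Completion R) := ⟨fun c a b => (compl_mul_smul c a b).symm⟩

end smul

variable [StarRing R] [NormedStarGroup R]

/-- Involution on the completion, extended by continuity. -/
instance complStar : Star (Completion R) := ⟨Completion.map (fun a : R => star a)⟩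

theorem compl_coe_star (a : R) : ((star a : R) : Completion R) = star (a : Completion R) :=
  (Completion.map_coe (star_isometry (E := R)).uniformContinuous a).symm

instance complContinuousStar : ContinuousStar (Completion R) where
  continuous_star := Completion.continuous_map

instance complStarRing : StarRing (Completion R) where
  star_involutive a := by
    induction a using Completion.induction_on with
    | hp => exact isClosed_eq continuous_id.star.star continuous_id
    | ih a => rw [← compl_coe_star, ← compl_coe_star, star_star]
  star_mul a b := by
    induction a, b using Completion.induction_on₂ with
    | hp =>
      exact isClosed_eq (continuous_fst.mul continuous_snd).star
        (continuous_snd.star.mul continuous_fst.star)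
    | ih a b => rw [← compl_coe_mul, ← compl_coe_star, ← compl_coe_star, ← compl_coe_star,
        ← compl_coe_mul, star_mul]
  star_add a b := by
    induction a, b using Completion.induction_on₂ with
    | hp =>
      exact isClosed_eq (continuous_fst.add continuous_snd).star
        (continuous_fst.star.add continuous_snd.star)
    | ih a b => rw [← Completion.coe_add, ← compl_coe_star, ← compl_coe_star, ← compl_coe_star,
        ← Completion.coe_add, star_add]

instance complStarModule [NormedSpace ℂ R] [StarModule ℂ R] : StarModule ℂ (Completion R) where
  star_smul c a := by
    induction a using Completion.induction_on with
    | hp =>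
      exact isClosed_eq (continuous_id.const_smul c).star (continuous_id.star.const_smul (star c))
    | ih a => rw [← Completion.coe_smul, ← compl_coe_star, ← compl_coe_star,
        ← Completion.coe_smul, star_smul]

theorem compl_cstarRing (h : ∀ a : R, ‖a‖ * ‖a‖ ≤ ‖star a * a‖) : CStarRing (Completion R) where
  norm_mul_self_le a := by
    induction a using Completion.induction_on with
    | hp =>
      exact isClosed_le (continuous_id.norm.mul continuous_id.norm)
        (continuous_id.star.mul continuous_id).norm
    | ih a =>
      rw [← compl_coe_star, ← compl_coe_mul, Completion.norm_coe, Completion.norm_coe]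
      exact h a

/-- The completion map as a `*`-homomorphism. -/
def complι [NormedSpace ℂ R] : R →⋆ₙₐ[ℂ] Completion R where
  toFun a := a
  map_smul' c a := Completion.coe_smul c a
  map_zero' := Completion.coe_zero
  map_add' := Completion.coe_add
  map_mul' := compl_coe_mul
  map_star' := compl_coe_star

/-- The extension to the completions of a contractive `*`-homomorphism. -/
def complMap [NormedSpace ℂ R] {S : Type v} [NonUnitalSeminormedRing S] [NormedSpace ℂ S]
    [StarRing S] [NormedStarGroup S] (f : R →⋆ₙₐ[ℂ] S) (hf : UniformContinuous f) :
    Completion R →⋆ₙₐ[ℂ] Completion S where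
  toFun := Completion.map f
  map_smul' c a := by
    induction a using Completion.induction_on with
    | hp =>
      have hc : Continuous fun x : Completion R => Completion.map f x := Completion.continuous_map
      exact isClosed_eq (hc.comp (continuous_id.const_smul c)) (hc.const_smul c)
    | ih a =>
      rw [← Completion.coe_smul, Completion.map_coe hf, Completion.map_coe hf, map_smul,
        Completion.coe_smul]
      rfl
  map_zero' := by rw [← Completion.coe_zero, Completion.map_coe hf, map_zero, Completion.coe_zero]
  map_add' a b := by
    induction a, b using Completion.induction_on₂ with
    | hp =>
      have h1 : Continuous fun x : Completion R × Completion R => Completion.map f x.1 :=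
        Completion.continuous_map.comp continuous_fst
      have h2 : Continuous fun x : Completion R × Completion R => Completion.map f x.2 :=
        Completion.continuous_map.comp continuous_snd
      exact isClosed_eq (Completion.continuous_map.comp (continuous_fst.add continuous_snd))
        (h1.add h2)
    | ih a b =>
      rw [← Completion.coe_add, Completion.map_coe hf, Completion.map_coe hf,
        Completion.map_coe hf, map_add, Completion.coe_add]
  map_mul' a b := by
    induction a, b using Completion.induction_on₂ with
    | hp =>
      have h1 : Continuous fun x : Completion R × Completion R => Completion.map f x.1 :=
        Completion.continuous_map.comp continuous_fst
      have h2 : Continuous fun x : Completion R × Completion R => Completion.map f x.2 :=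
        Completion.continuous_map.comp continuous_snd
      exact isClosed_eq (Completion.continuous_map.comp (continuous_fst.mul continuous_snd))
        (h1.mul h2)
    | ih a b =>
      rw [← compl_coe_mul, Completion.map_coe hf, Completion.map_coe hf,
        Completion.map_coe hf, map_mul, compl_coe_mul]
  map_star' a := by
    induction a using Completion.induction_on with
    | hp =>
      exact isClosed_eq (Completion.continuous_map.comp continuous_id.star)
        Completion.continuous_map.star
    | ih a =>
      rw [← compl_coe_star, Completion.map_coe hf, Completion.map_coe hf, map_star,
        compl_coe_star]

theorem complMap_complι [NormedSpace ℂ R] {S : Type v} [NonUnitalSeminormedRing S]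
    [NormedSpace ℂ S] [StarRing S] [NormedStarGroup S] (f : R →⋆ₙₐ[ℂ] S)
    (hf : UniformContinuous f) (a : R) : complMap f hf (complι a) = complι (f a) :=
  Completion.map_coe hf a

end Completion

/-! ## Enveloping `C*`-algebras -/

section Envelope

variable (A : Type u) [NonUnitalRing A] [StarRing A] [Module ℂ A] [IsScalarTower ℂ A A]
  [SMulCommClass ℂ A A] [StarModule ℂ A]
variable {B : Type v} [NonUnitalRing B] [StarRing B] [Module ℂ B] [IsScalarTower ℂ B B]
  [SMulCommClass ℂ B B] [StarModule ℂ B]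

variable {A} in
/-- `C*`-seminorms on a `*`-algebra. -/
structure IsCStarSeminorm (p : Seminorm ℂ A) : Prop where
  mul_le : ∀ a b, p (a * b) ≤ p a * p b
  star_mul_self : ∀ a, p (star a * a) = p a ^ 2

/-- The `C*`-seminorms on `A` are pointwise bounded; equivalently, `A` has an enveloping
`C*`-algebra. -/
class CStarBounded : Prop where
  bdd : ∀ a : A, ∃ C : ℝ, ∀ p : Seminorm ℂ A, IsCStarSeminorm p → p a ≤ C

variable {A} in
theorem IsCStarSeminorm.map_star {p : Seminorm ℂ A} (hp : IsCStarSeminorm p) (a : A) :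
    p (star a) = p a := by
  have key : ∀ a : A, p a ≤ p (star a) := by
    intro a
    rcases (apply_nonneg p a).eq_or_lt with h | h
    · rw [← h]; exact apply_nonneg p _
    · have h1 := hp.mul_le (star a) a
      rw [hp.star_mul_self, pow_two] at h1
      exact le_of_mul_le_mul_right h1 h
  refine le_antisymm ?_ (key a)
  simpa using key (star a)

theorem isCStarSeminorm_zero : IsCStarSeminorm (0 : Seminorm ℂ A) :=
  ⟨fun _ _ => by simp, fun _ => by simp⟩

variable {A} in
theorem IsCStarSeminorm.comp {p : Seminorm ℂ B} (hp : IsCStarSeminorm p) (f : A →⋆ₙₐ[ℂ] B) :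
    IsCStarSeminorm (p.comp (f : A →ₗ[ℂ] B)) :=
  ⟨fun a b => by simpa using hp.mul_le (f a) (f b),
   fun a => by simpa [StarHomClass.map_star] using hp.star_mul_self (f a)⟩

variable {A}

section completion

variable (p : Seminorm ℂ A) (hp : IsCStarSeminorm p)

/-- `A`, seminormed by the `C*`-seminorm `p`. -/
def WithSeminorm (_hp : IsCStarSeminorm p) : Type u := A

variable {p}

instance : NonUnitalSeminormedRing (WithSeminorm p hp) where
  __ := (inferInstance : NonUnitalRing A)
  __ := AddGroupSeminorm.toSeminormedAddCommGroup p.toAddGroupSeminorm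
  norm_mul_le := hp.mul_le

instance : StarRing (WithSeminorm p hp) := inferInstanceAs (StarRing A)

instance : NormedSpace ℂ (WithSeminorm p hp) where
  __ := (inferInstance : Module ℂ A)
  norm_smul_le c a := (map_smul_eq_mul p c a).le

instance : IsScalarTower ℂ (WithSeminorm p hp) (WithSeminorm p hp) :=
  inferInstanceAs (IsScalarTower ℂ A A)
instance : SMulCommClass ℂ (WithSeminorm p hp) (WithSeminorm p hp) :=
  inferInstanceAs (SMulCommClass ℂ A A)
instance : StarModule ℂ (WithSeminorm p hp) := inferInstanceAs (StarModule ℂ A)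

instance : NormedStarGroup (WithSeminorm p hp) := ⟨fun a => (hp.map_star a).le⟩

instance : CStarRing (UniformSpace.Completion (WithSeminorm p hp)) :=
  compl_cstarRing fun a => by
    have h := hp.star_mul_self a
    rw [pow_two] at h
    exact h.ge

/-- The Hausdorff completion of `A` with respect to a `C*`-seminorm. -/
def CStarCompletion : Type u := UniformSpace.Completion (WithSeminorm p hp)

namespace CStarCompletion

/-- The completion with respect to a `C*`-seminorm is a `C*`-algebra. -/
instance : NonUnitalCStarAlgebra (CStarCompletion hp) :=
  { (inferInstance : NonUnitalNormedRing (UniformSpace.Completion (WithSeminorm p hp))),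
    (inferInstance : StarRing (UniformSpace.Completion (WithSeminorm p hp))),
    (inferInstance : CompleteSpace (UniformSpace.Completion (WithSeminorm p hp))),
    (inferInstance : CStarRing (UniformSpace.Completion (WithSeminorm p hp))),
    (inferInstance : NormedSpace ℂ (UniformSpace.Completion (WithSeminorm p hp))),
    (inferInstance : IsScalarTower ℂ (UniformSpace.Completion (WithSeminorm p hp))
      (UniformSpace.Completion (WithSeminorm p hp))),
    (inferInstance : SMulCommClass ℂ (UniformSpace.Completion (WithSeminorm p hp))
      (UniformSpace.Completion (WithSeminorm p hp))),
    (inferInstance : StarModule ℂ (UniformSpace.Completion (WithSeminorm p hp))) with }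

/-- The identity map of `A`, as a `*`-homomorphism to the seminormed algebra. -/
def preι : A →⋆ₙₐ[ℂ] WithSeminorm p hp where
  toFun a := a
  map_smul' _ _ := rfl
  map_zero' := rfl
  map_add' _ _ := rfl
  map_mul' _ _ := rfl
  map_star' _ := rfl

/-- The canonical `*`-homomorphism of `A` into its completion. -/
def ι : A →⋆ₙₐ[ℂ] CStarCompletion hp := (complι (R := WithSeminorm p hp)).comp (preι hp)

theorem norm_ι (a : A) : ‖ι hp a‖ = p a :=
  UniformSpace.Completion.norm_coe (E := WithSeminorm p hp) a

theorem denseRange_ι : DenseRange (ι hp) :=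
  UniformSpace.Completion.denseRange_coe (α := WithSeminorm p hp)

theorem uniformContinuous_pre {q : Seminorm ℂ B} (hq : IsCStarSeminorm q) (f : A →⋆ₙₐ[ℂ] B)
    (hf : ∀ a, q (f a) ≤ p a) :
    UniformContinuous (show WithSeminorm p hp →⋆ₙₐ[ℂ] WithSeminorm q hq from f) :=
  AddMonoidHomClass.uniformContinuous_of_bound
    (show WithSeminorm p hp →⋆ₙₐ[ℂ] WithSeminorm q hq from f) 1
    fun a => by rw [one_mul]; exact hf a

/-- The extension of a contractive `*`-homomorphism to the completions. -/
def map {q : Seminorm ℂ B} (hq : IsCStarSeminorm q) (f : A →⋆ₙₐ[ℂ] B)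
    (hf : ∀ a, q (f a) ≤ p a) : CStarCompletion hp →⋆ₙₐ[ℂ] CStarCompletion hq :=
  complMap (R := WithSeminorm p hp) (S := WithSeminorm q hq) f (uniformContinuous_pre hp hq f hf)

theorem map_ι {q : Seminorm ℂ B} (hq : IsCStarSeminorm q) (f : A →⋆ₙₐ[ℂ] B)
    (hf : ∀ a, q (f a) ≤ p a) (a : A) : map hp hq f hf (ι hp a) = ι hq (f a) :=
  complMap_complι (R := WithSeminorm p hp) (S := WithSeminorm q hq) f
    (uniformContinuous_pre hp hq f hf) a

end CStarCompletion

end completion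

/-- On a `C*`-algebra every `C*`-seminorm is dominated by the norm. -/
instance cstarBounded_of_cstarAlgebra (B : Type u) [NonUnitalCStarAlgebra B] : CStarBounded B where
  bdd b := ⟨‖b‖, fun p hp => by
    rw [← CStarCompletion.norm_ι hp b]
    exact NonUnitalStarAlgHom.norm_apply_le (CStarCompletion.ι hp) b⟩

variable [CStarBounded A]

variable (A) in
/-- The universal `C*`-seminorm: the supremum of all `C*`-seminorms. -/
def univSeminorm : Seminorm ℂ A := sSup {p : Seminorm ℂ A | IsCStarSeminorm p}

variable (A) in
theorem bddAbove_cstarSeminorms : BddAbove {p : Seminorm ℂ A | IsCStarSeminorm p} := by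
  rw [Seminorm.bddAbove_iff]
  choose C hC using CStarBounded.bdd (A := A)
  refine ⟨C, ?_⟩
  rintro _ ⟨p, hp, rfl⟩ a
  exact hC a p hp

theorem le_univSeminorm {p : Seminorm ℂ A} (hp : IsCStarSeminorm p) (a : A) :
    p a ≤ univSeminorm A a :=
  le_csSup (bddAbove_cstarSeminorms A) hp a

theorem univSeminorm_le {a : A} {C : ℝ} (h : ∀ p : Seminorm ℂ A, IsCStarSeminorm p → p a ≤ C) :
    univSeminorm A a ≤ C := by
  rw [univSeminorm, Seminorm.sSup_apply (bddAbove_cstarSeminorms A)]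
  have : Nonempty {p : Seminorm ℂ A | IsCStarSeminorm p} := ⟨⟨0, isCStarSeminorm_zero A⟩⟩
  exact ciSup_le fun p => h p.1 p.2

theorem isCStarSeminorm_univSeminorm : IsCStarSeminorm (univSeminorm A) := by
  refine ⟨fun a b => univSeminorm_le fun p hp => (hp.mul_le a b).trans ?_, fun a => ?_⟩
  · exact mul_le_mul (le_univSeminorm hp a) (le_univSeminorm hp b) (apply_nonneg _ _)
      (apply_nonneg _ _)
  · refine le_antisymm (univSeminorm_le fun p hp => ?_) ?_
    · rw [hp.star_mul_self]
      exact pow_le_pow_left₀ (apply_nonneg _ _) (le_univSeminorm hp a) 2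
    · refine Real.le_sqrt (apply_nonneg _ _) (apply_nonneg _ _) |>.mp ?_
      refine univSeminorm_le fun p hp => Real.le_sqrt (apply_nonneg _ _) (apply_nonneg _ _) |>.mpr ?_
      rw [← hp.star_mul_self]
      exact le_univSeminorm hp _

theorem univSeminorm_map_le [CStarBounded B] (f : A →⋆ₙₐ[ℂ] B) (a : A) :
    univSeminorm B (f a) ≤ univSeminorm A a :=
  univSeminorm_le fun _ hp => le_univSeminorm (hp.comp f) a

variable (A) in
/-- The enveloping `C*`-algebra of `A`: the Hausdorff completion of `A` with respect to its
universal `C*`-seminorm. -/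
abbrev Env : Type u := CStarCompletion (isCStarSeminorm_univSeminorm (A := A))

namespace Env

/-- The canonical `*`-homomorphism of `A` into its enveloping `C*`-algebra. -/
def ι : A →⋆ₙₐ[ℂ] Env A := CStarCompletion.ι isCStarSeminorm_univSeminorm

theorem norm_ι (a : A) : ‖(ι a : Env A)‖ = univSeminorm A a := CStarCompletion.norm_ι _ a

theorem denseRange_ι : DenseRange (ι : A → Env A) := CStarCompletion.denseRange_ι _

/-- A `*`-homomorphism extends to the enveloping `C*`-algebras. -/
def map [CStarBounded B] (f : A →⋆ₙₐ[ℂ] B) : Env A →⋆ₙₐ[ℂ] Env B :=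
  CStarCompletion.map isCStarSeminorm_univSeminorm isCStarSeminorm_univSeminorm f
    (univSeminorm_map_le f)

theorem map_ι [CStarBounded B] (f : A →⋆ₙₐ[ℂ] B) (a : A) : map f (ι a) = ι (f a) :=
  CStarCompletion.map_ι _ _ f (univSeminorm_map_le f) a

end Env

end Envelope

/-! ## Corners -/

section Corner

variable {A : Type u} [NonUnitalRing A] [StarRing A] [Module ℂ A] [IsScalarTower ℂ A A]
  [SMulCommClass ℂ A A] [StarModule ℂ A]
variable {B : Type v} [NonUnitalRing B] [StarRing B] [Module ℂ B] [IsScalarTower ℂ B B]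
  [SMulCommClass ℂ B B] [StarModule ℂ B]

/-- The corner `p A p` of a `*`-algebra at a projection `p`. -/
def corner (p : A) (hp : IsStarProjection p) : NonUnitalStarSubalgebra ℂ A where
  carrier := {x | ∃ a, x = p * a * p}
  add_mem' := by
    rintro _ _ ⟨a, rfl⟩ ⟨b, rfl⟩
    exact ⟨a + b, by rw [mul_add, add_mul]⟩
  zero_mem' := ⟨0, by simp⟩
  mul_mem' := by
    rintro _ _ ⟨a, rfl⟩ ⟨b, rfl⟩
    exact ⟨a * p * p * b, by simp only [mul_assoc]⟩
  smul_mem' := by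
    rintro c _ ⟨a, rfl⟩
    exact ⟨c • a, by rw [mul_smul_comm, smul_mul_assoc]⟩
  star_mem' := by
    rintro _ ⟨a, rfl⟩
    have h : star p = p := hp.2
    exact ⟨star a, by simp only [star_mul, h, mul_assoc]⟩

theorem mem_corner_iff {p : A} {hp : IsStarProjection p} {x : A} :
    x ∈ corner p hp ↔ p * x * p = x := by
  have h : p * p = p := hp.1
  constructor
  · rintro ⟨a, rfl⟩
    have : p * (p * a * p) * p = (p * p) * a * (p * p) := by simp only [mul_assoc]
    rw [this, h]
  · intro hx
    exact ⟨x, hx.symm⟩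

/-- The restriction of a `*`-homomorphism to corners. -/
def cornerMap (f : A →⋆ₙₐ[ℂ] B) {p : A} {q : B} (hp : IsStarProjection p)
    (hq : IsStarProjection q) (h : f p = q) : corner p hp →⋆ₙₐ[ℂ] corner q hq where
  toFun x := ⟨f x, by
    obtain ⟨a, ha⟩ := x.2
    exact ⟨f a, by rw [ha, map_mul, map_mul, h]⟩⟩
  map_smul' c x := Subtype.ext (map_smul f c (x : A))
  map_zero' := Subtype.ext (map_zero f)
  map_add' x y := Subtype.ext (map_add f (x : A) y)
  map_mul' x y := Subtype.ext (map_mul f (x : A) y)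
  map_star' x := Subtype.ext (map_star f (x : A))

instance isClosed_corner {A : Type u} [NonUnitalCStarAlgebra A] (p : A) (hp : IsStarProjection p) :
    IsClosed (corner p hp : Set A) := by
  have : (corner p hp : Set A) = {x | p * x * p = x} := by
    ext x; exact mem_corner_iff
  rw [this]
  exact isClosed_eq ((continuous_const.mul continuous_id).mul continuous_const) continuous_id

theorem isStarProjection_map {p : A} (hp : IsStarProjection p) (f : A →⋆ₙₐ[ℂ] B) :
    IsStarProjection (f p) :=
  ⟨by have h : p * p = p := hp.1
      show f p * f p = f p
      rw [← map_mul, h],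
   by have h : star p = p := hp.2
      show star (f p) = f p
      rw [← map_star, h]⟩

end Corner

/-! ## Colimits of sequences of `*`-algebras -/

section SeqLim

variable {A : ℕ → Type u} [∀ n, NonUnitalRing (A n)] [∀ n, StarRing (A n)] [∀ n, Module ℂ (A n)]
  [∀ n, IsScalarTower ℂ (A n) (A n)] [∀ n, SMulCommClass ℂ (A n) (A n)]
  [∀ n, StarModule ℂ (A n)]
variable {B : ℕ → Type v} [∀ n, NonUnitalRing (B n)] [∀ n, StarRing (B n)] [∀ n, Module ℂ (B n)]
  [∀ n, IsScalarTower ℂ (B n) (B n)] [∀ n, SMulCommClass ℂ (B n) (B n)]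
  [∀ n, StarModule ℂ (B n)]
variable {P : Type w} [NonUnitalRing P] [StarRing P] [Module ℂ P] [IsScalarTower ℂ P P]
  [SMulCommClass ℂ P P] [StarModule ℂ P]
variable (φ : ∀ n, A n →⋆ₙₐ[ℂ] A (n + 1))

/-- The composites of the maps of a sequence. -/
def seqMap ⦃m n : ℕ⦄ (h : m ≤ n) : A m →⋆ₙₐ[ℂ] A n :=
  Nat.leRec (motive := fun n _ => A m →⋆ₙₐ[ℂ] A n) (NonUnitalStarAlgHom.id ℂ (A m))
    (fun n _ f => (φ n).comp f) h

theorem seqMap_self (n : ℕ) : seqMap φ (le_refl n) = NonUnitalStarAlgHom.id ℂ (A n) :=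
  Nat.leRec_self _ _

theorem seqMap_succ {m n : ℕ} (h : m ≤ n) (h' : m ≤ n + 1) :
    seqMap φ h' = (φ n).comp (seqMap φ h) := Nat.leRec_succ _ _ h

instance seqMap_directed : DirectedSystem A (fun _ _ h => seqMap φ h) where
  map_self n x := by rw [seqMap_self]; rfl
  map_map k j i hij hjk x := by
    induction hjk with
    | refl => rw [seqMap_self]; rfl
    | step h ih =>
      rw [seqMap_succ φ h, seqMap_succ φ (hij.trans h), NonUnitalStarAlgHom.comp_apply, ih]
      rfl

/-- The colimit of a sequence of `*`-algebras and `*`-homomorphisms. -/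
def SeqLim : Type u := DirectLimit A (seqMap φ)

instance : NonUnitalRing (SeqLim φ) := inferInstanceAs (NonUnitalRing (DirectLimit A (seqMap φ)))
instance : StarRing (SeqLim φ) := inferInstanceAs (StarRing (DirectLimit A (seqMap φ)))
instance : Module ℂ (SeqLim φ) := inferInstanceAs (Module ℂ (DirectLimit A (seqMap φ)))
instance : IsScalarTower ℂ (SeqLim φ) (SeqLim φ) := inferInstanceAs
  (IsScalarTower ℂ (DirectLimit A (seqMap φ)) (DirectLimit A (seqMap φ)))
instance : SMulCommClass ℂ (SeqLim φ) (SeqLim φ) := inferInstanceAs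
  (SMulCommClass ℂ (DirectLimit A (seqMap φ)) (DirectLimit A (seqMap φ)))
instance : StarModule ℂ (SeqLim φ) := inferInstanceAs (StarModule ℂ (DirectLimit A (seqMap φ)))

namespace SeqLim

/-- The canonical map of a stage into the colimit. -/
def of (n : ℕ) : A n →⋆ₙₐ[ℂ] SeqLim φ where
  __ := DirectLimit.NonUnitalStarRing.of A (seqMap φ) n
  map_smul' c x := (DirectLimit.Module.of ℂ ℕ A (seqMap φ) n).map_smul c x

theorem of_seqMap {m n : ℕ} (h : m ≤ n) (x : A m) : of φ n (seqMap φ h x) = of φ m x :=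
  DirectLimit.NonUnitalStarRing.of_f h x

theorem of_succ (n : ℕ) (x : A n) : of φ (n + 1) (φ n x) = of φ n x := by
  have := of_seqMap φ (Nat.le_succ n) x
  rwa [seqMap_succ φ (le_refl n), seqMap_self] at this

variable {φ}

theorem exists_of (x : SeqLim φ) : ∃ n a, of φ n a = x := by
  induction x using DirectLimit.induction with | _ n a
  exact ⟨n, a, rfl⟩

/-- The universal property of the colimit. -/
def lift (g : ∀ n, A n →⋆ₙₐ[ℂ] P) (hg : ∀ n x, g (n + 1) (φ n x) = g n x) : SeqLim φ →⋆ₙₐ[ℂ] P :=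
  have h : ∀ i j hij x, g j (seqMap φ hij x) = g i x := fun i j hij x => by
    induction hij with
    | refl => rw [seqMap_self]; rfl
    | step h ih => rw [seqMap_succ φ h, NonUnitalStarAlgHom.comp_apply, hg, ih]
  { DirectLimit.NonUnitalRing.lift A (seqMap φ) P (fun n => (g n : A n →ₙ+* P)) h with
    map_star' := DirectLimit.lift_star (f := seqMap φ) g (fun i j hij x => (h i j hij x).symm)
    map_smul' := fun c => DirectLimit.lift_smul (f := seqMap φ) g
      (fun i j hij x => (h i j hij x).symm) c }

theorem lift_of (g : ∀ n, A n →⋆ₙₐ[ℂ] P) (hg : ∀ n x, g (n + 1) (φ n x) = g n x) (n : ℕ)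
    (x : A n) : lift g hg (of φ n x) = g n x := rfl

/-- The map of colimits induced by a map of sequences. -/
def map (ψ : ∀ n, B n →⋆ₙₐ[ℂ] B (n + 1)) (g : ∀ n, A n →⋆ₙₐ[ℂ] B n)
    (hg : ∀ n x, g (n + 1) (φ n x) = ψ n (g n x)) : SeqLim φ →⋆ₙₐ[ℂ] SeqLim ψ :=
  lift (fun n => (of ψ n).comp (g n)) fun n x => by
    rw [NonUnitalStarAlgHom.comp_apply, hg, of_succ]; rfl

instance [∀ n, CStarBounded (A n)] : CStarBounded (SeqLim φ) where
  bdd x := by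
    obtain ⟨n, a, rfl⟩ := exists_of x
    obtain ⟨C, hC⟩ := CStarBounded.bdd a
    exact ⟨C, fun p hp => hC _ (hp.comp (of φ n))⟩

end SeqLim

end SeqLim

/-- The colimit, in the category of `C*`-algebras, of a sequence of `C*`-algebras: the enveloping
`C*`-algebra of the colimit as `*`-algebras. -/
abbrev CStarSeqLim {A : ℕ → Type u} [∀ n, NonUnitalCStarAlgebra (A n)]
    (φ : ∀ n, A n →⋆ₙₐ[ℂ] A (n + 1)) : Type u := Env (SeqLim φ)

/-! ## Separated graphs and their algebras -/

/-- A separated graph: a directed graph with source and range maps `s`, `r`, and for each vertex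
`v` a partition `C v` of `r⁻¹(v)` into nonempty subsets. -/
structure SeparatedGraph (V E : Type u) where
  s : E → V
  r : E → V
  C : V → Set (Set E)
  nonempty : ∀ v, ∀ Y ∈ C v, Y.Nonempty
  disjoint : ∀ v, ∀ Y ∈ C v, ∀ Y' ∈ C v, Y ≠ Y' → Disjoint Y Y'
  sUnion : ∀ v, ⋃₀ C v = {e | r e = v}

namespace SeparatedGraph

variable {V E : Type u} (G : SeparatedGraph V E)

/-- A vertex as a generator. -/
def vt (v : V) : StarTerm (V ⊕ E) := .of (.inl v)
/-- An edge as a generator. -/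
def et (e : E) : StarTerm (V ⊕ E) := .of (.inr e)

/-- The defining relations of the Leavitt path algebra of a separated graph. -/
inductive Rel : StarTerm (V ⊕ E) → StarTerm (V ⊕ E) → Prop
  | vertex_mul_self (v : V) : Rel ((vt v).mul (vt v)) (vt v)
  | vertex_mul_ne (v w : V) : v ≠ w → Rel ((vt v).mul (vt w)) .zero
  | vertex_adj (v : V) : Rel (vt v).adj (vt v)
  | range_mul (e : E) : Rel ((vt (G.r e)).mul (et e)) (et e)
  | mul_source (e : E) : Rel ((et e).mul (vt (G.s e))) (et e)
  | sck1_self (v : V) (Y : Set E) (hY : Y ∈ G.C v) (e : E) (he : e ∈ Y) :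
      Rel ((et e).adj.mul (et e)) (vt (G.s e))
  | sck1_ne (v : V) (Y : Set E) (hY : Y ∈ G.C v) (e f : E) (he : e ∈ Y) (hf : f ∈ Y) :
      e ≠ f → Rel ((et e).adj.mul (et f)) .zero
  | sck2 (v : V) (l : List E) (hl : l.Nodup) (hY : {e | e ∈ l} ∈ G.C v) :
      Rel (vt v) (StarTerm.sum (l.map fun e => (et e).mul (et e).adj))

/-- The complex Leavitt path algebra of a separated graph. -/
abbrev Leavitt : Type u := StarPres G.Rel

/-- A vertex, as an element of the Leavitt path algebra. -/
def v (x : V) : G.Leavitt := StarPres.of G.Rel (.inl x)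
/-- An edge, as an element of the Leavitt path algebra. -/
def e (x : E) : G.Leavitt := StarPres.of G.Rel (.inr x)

theorem v_mul_self (x : V) : G.v x * G.v x = G.v x :=
  StarPres.eval_eq_of_rel (R := G.Rel) (Rel.vertex_mul_self x)
theorem v_mul_ne {x y : V} (h : x ≠ y) : G.v x * G.v y = 0 :=
  StarPres.eval_eq_of_rel (R := G.Rel) (Rel.vertex_mul_ne x y h)
theorem star_v (x : V) : star (G.v x) = G.v x :=
  StarPres.eval_eq_of_rel (R := G.Rel) (Rel.vertex_adj x)
theorem v_mul_e (x : E) : G.v (G.r x) * G.e x = G.e x :=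
  StarPres.eval_eq_of_rel (R := G.Rel) (Rel.range_mul x)
theorem e_mul_v (x : E) : G.e x * G.v (G.s x) = G.e x :=
  StarPres.eval_eq_of_rel (R := G.Rel) (Rel.mul_source x)
theorem star_e_mul_self (x : E) : star (G.e x) * G.e x = G.v (G.s x) := by
  have h : x ∈ ⋃₀ G.C (G.r x) := by rw [G.sUnion]; rfl
  obtain ⟨Y, hY, hx⟩ := h
  exact StarPres.eval_eq_of_rel (R := G.Rel) (Rel.sck1_self _ Y hY x hx)
theorem star_e_mul_ne {z : V} {Y : Set E} (hY : Y ∈ G.C z) {x y : E} (hx : x ∈ Y) (hy : y ∈ Y)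
    (h : x ≠ y) : star (G.e x) * G.e y = 0 :=
  StarPres.eval_eq_of_rel (R := G.Rel) (Rel.sck1_ne z Y hY x y hx hy h)
theorem sck2 {z : V} (l : List E) (hl : l.Nodup) (hY : {x | x ∈ l} ∈ G.C z) :
    G.v z = (l.map fun x => G.e x * star (G.e x)).sum := by
  have := StarPres.eval_eq_of_rel (R := G.Rel) (Rel.sck2 z l hl hY)
  rw [StarPres.eval_sum, List.map_map] at this
  exact this

theorem isStarProjection_v (x : V) : IsStarProjection (G.v x) := ⟨G.v_mul_self x, G.star_v x⟩

theorem isStarProjection_sum {ι : Type*} (s : Finset ι) (f : ι → V) (hf : Set.InjOn f s) :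
    IsStarProjection (∑ i ∈ s, G.v (f i)) := by
  classical
  constructor
  · show (∑ i ∈ s, G.v (f i)) * (∑ i ∈ s, G.v (f i)) = _
    rw [Finset.sum_mul_sum]
    refine Finset.sum_congr rfl fun i hi => ?_
    rw [Finset.sum_eq_single_of_mem i hi]
    · exact G.v_mul_self _
    · intro j hj hji
      exact G.v_mul_ne fun h => hji (hf hj hi h.symm)
  · show star (∑ i ∈ s, G.v (f i)) = _
    rw [star_sum]
    exact Finset.sum_congr rfl fun i _ => G.star_v _

instance : CStarBounded G.Leavitt where
  bdd a := by
    have key : ∀ t : StarTerm (V ⊕ E), ∃ C : ℝ, 0 ≤ C ∧ ∀ p : Seminorm ℂ G.Leavitt,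
        IsCStarSeminorm p → p (StarPres.mk G.Rel t) ≤ C := by
      have hv : ∀ x (p : Seminorm ℂ G.Leavitt), IsCStarSeminorm p → p (G.v x) ≤ 1 := by
        intro x p hp
        have h := hp.star_mul_self (G.v x)
        rw [G.star_v, G.v_mul_self] at h
        have h0 : 0 ≤ p (G.v x) := apply_nonneg p _
        by_contra hc
        nlinarith
      intro t
      induction t with
      | of x =>
        refine ⟨1, zero_le_one, fun p hp => ?_⟩
        rcases x with x | x
        · exact hv x p hp
        · have h := hp.star_mul_self (G.e x)
          rw [G.star_e_mul_self] at h
          have h1 := hv (G.s x) p hp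
          have h0 : 0 ≤ p (G.e x) := apply_nonneg p _
          show p (G.e x) ≤ 1
          by_contra hc
          nlinarith
      | zero => exact ⟨0, le_rfl, fun p hp => (map_zero p).le⟩
      | add a b ha hb =>
        obtain ⟨C, hC, h⟩ := ha
        obtain ⟨D, hD, h'⟩ := hb
        exact ⟨C + D, add_nonneg hC hD, fun p hp =>
          (map_add_le_add p (StarPres.mk G.Rel a) (StarPres.mk G.Rel b)).trans
            (add_le_add (h p hp) (h' p hp))⟩
      | mul a b ha hb =>
        obtain ⟨C, hC, h⟩ := ha
        obtain ⟨D, hD, h'⟩ := hb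
        exact ⟨C * D, mul_nonneg hC hD, fun p hp =>
          (hp.mul_le (StarPres.mk G.Rel a) (StarPres.mk G.Rel b)).trans
            (mul_le_mul (h p hp) (h' p hp) (apply_nonneg _ _) hC)⟩
      | smul c a ha =>
        obtain ⟨C, hC, h⟩ := ha
        exact ⟨‖c‖ * C, mul_nonneg (norm_nonneg _) hC, fun p hp =>
          (map_smul_eq_mul p c (StarPres.mk G.Rel a)).le.trans
            (mul_le_mul_of_nonneg_left (h p hp) (norm_nonneg _))⟩
      | adj a ha =>
        obtain ⟨C, hC, h⟩ := ha
        exact ⟨C, hC, fun p hp => (hp.map_star (StarPres.mk G.Rel a)).le.trans (h p hp)⟩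
    refine StarPres.ind a fun t => ?_
    obtain ⟨C, -, h⟩ := key t
    exact ⟨C, h⟩

/-- The graph `C*`-algebra of a separated graph. -/
abbrev CStar : Type u := Env G.Leavitt

end SeparatedGraph

/-! ## A construction of homomorphisms of Leavitt path algebras -/

section SumMap

variable {V E V' E' : Type u}

/-- Combinatorial data giving rise to a `*`-homomorphism which maps a vertex `v` to the sum of
the vertices in `vm v`, and an edge `e` to the sum of the `x*` with `x ∈ em e`. -/
structure SumMap (G : SeparatedGraph V E) (H : SeparatedGraph V' E') where
  vm : V → Finset V'
  em : E → Finset E'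
  base : E → V'
  vm_disjoint : ∀ v w, v ≠ w → Disjoint (vm v) (vm w)
  source_mem : ∀ e, ∀ x ∈ em e, H.s x ∈ vm (G.r e)
  vm_source : ∀ e, vm (G.s e) = {base e}
  em_mem : ∀ e, (em e : Set E') ∈ H.C (base e)
  eq_of_source : ∀ v, ∀ Y ∈ G.C v, ∀ e ∈ Y, ∀ f ∈ Y, ∀ x ∈ em e, ∀ y ∈ em f,
    H.s x = H.s y → e = f ∧ x = y
  exists_source : ∀ v, ∀ Y ∈ G.C v, ∀ w ∈ vm v, ∃ e ∈ Y, ∃ x ∈ em e, H.s x = w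

namespace SumMap

variable {G : SeparatedGraph V E} {H : SeparatedGraph V' E'} (F : SumMap G H)

theorem range_eq {e : E} {x : E'} (hx : x ∈ F.em e) : H.r x = F.base e := by
  have : x ∈ ⋃₀ H.C (F.base e) := ⟨_, F.em_mem e, hx⟩
  rwa [H.sUnion] at this

/-- Values on generators. -/
def gen : V ⊕ E → H.Leavitt
  | .inl v => ∑ w ∈ F.vm v, H.v w
  | .inr e => ∑ x ∈ F.em e, star (H.e x)

theorem star_e_mul_v (x : E') : star (H.e x) * H.v (H.r x) = star (H.e x) := by
  rw [← H.star_v, ← star_mul, H.v_mul_e]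

theorem v_mul_star_e (x : E') : H.v (H.s x) * star (H.e x) = star (H.e x) := by
  rw [← H.star_v, ← star_mul, H.e_mul_v]

theorem e_mul_star_e_of_ne {x y : E'} (h : H.s x ≠ H.s y) : H.e x * star (H.e y) = 0 := by
  rw [← H.e_mul_v x, ← v_mul_star_e y, mul_assoc, ← mul_assoc (H.v (H.s x)), H.v_mul_ne h]
  simp

theorem gen_vertex_mul (v : V) (y : H.Leavitt) (w : V') (hw : w ∈ F.vm v)
    (hy : H.v w * y = y) : (∑ w ∈ F.vm v, H.v w) * y = y := by
  rw [Finset.sum_mul, Finset.sum_eq_single_of_mem w hw, hy]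
  intro z _ hz
  rw [← hy, ← mul_assoc, H.v_mul_ne hz, zero_mul]

theorem gen_rel (a b : StarTerm (V ⊕ E)) (h : G.Rel a b) :
    StarPres.eval F.gen a = StarPres.eval F.gen b := by
  classical
  have hproj := fun v => H.isStarProjection_sum (F.vm v) id Function.injective_id.injOn
  have hsq : ∀ (e f : E), StarPres.eval F.gen ((SeparatedGraph.et e).adj.mul (SeparatedGraph.et f))
      = ∑ x ∈ F.em e, ∑ y ∈ F.em f, H.e x * star (H.e y) := by
    intro e f
    show star (∑ x ∈ F.em e, star (H.e x)) * (∑ y ∈ F.em f, star (H.e y)) = _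
    rw [star_sum, Finset.sum_mul_sum]
    simp only [star_star]
  cases h with
  | vertex_mul_self v => exact (hproj v).1
  | vertex_mul_ne v w hvw =>
    show (∑ x ∈ F.vm v, H.v x) * (∑ x ∈ F.vm w, H.v x) = 0
    rw [Finset.sum_mul_sum]
    refine Finset.sum_eq_zero fun x hx => Finset.sum_eq_zero fun y hy => H.v_mul_ne ?_
    rintro rfl
    exact Finset.disjoint_left.mp (F.vm_disjoint v w hvw) hx hy
  | vertex_adj v => exact (hproj v).2
  | range_mul e =>
    show (∑ w ∈ F.vm (G.r e), H.v w) * (∑ x ∈ F.em e, star (H.e x)) = _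
    rw [Finset.mul_sum]
    exact Finset.sum_congr rfl fun x hx =>
      F.gen_vertex_mul _ _ _ (F.source_mem e x hx) (v_mul_star_e x)
  | mul_source e =>
    show (∑ x ∈ F.em e, star (H.e x)) * (∑ w ∈ F.vm (G.s e), H.v w) = _
    rw [F.vm_source e, Finset.sum_singleton, Finset.sum_mul]
    refine Finset.sum_congr rfl fun x hx => ?_
    rw [← F.range_eq hx, star_e_mul_v]
  | sck1_self v Y hY e he =>
    rw [hsq]
    show _ = ∑ w ∈ F.vm (G.s e), H.v w
    rw [F.vm_source e, Finset.sum_singleton]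
    have hl : {x | x ∈ (F.em e).toList} ∈ H.C (F.base e) := by
      have := F.em_mem e
      convert this using 1
      ext x; simp
    rw [H.sck2 _ (Finset.nodup_toList _) hl, Finset.sum_map_toList]
    refine Finset.sum_congr rfl fun x hx => Finset.sum_eq_single_of_mem x hx ?_
    intro y hy hyx
    refine e_mul_star_e_of_ne fun h => hyx ?_
    exact (F.eq_of_source v Y hY e he e he x hx y hy h).2.symm
  | sck1_ne v Y hY e f he hf hef =>
    rw [hsq]
    refine Finset.sum_eq_zero fun x hx => Finset.sum_eq_zero fun y hy => ?_
    refine e_mul_star_e_of_ne fun h => hef ?_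
    exact (F.eq_of_source v Y hY e he f hf x hx y hy h).1
  | sck2 v l hl hY =>
    rw [StarPres.eval_sum, List.map_map]
    have h1 : ∀ e, (StarPres.eval F.gen ∘ fun e => (SeparatedGraph.et e).mul
        (SeparatedGraph.et e).adj) e = ∑ x ∈ F.em e, H.v (H.s x) := by
      intro e
      show (∑ x ∈ F.em e, star (H.e x)) * star (∑ x ∈ F.em e, star (H.e x)) = _
      rw [star_sum, Finset.sum_mul_sum]
      refine Finset.sum_congr rfl fun x hx => ?_
      rw [Finset.sum_eq_single_of_mem x hx]
      · rw [star_star, H.star_e_mul_self]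
      · intro y hy hyx
        rw [star_star]
        exact H.star_e_mul_ne (F.em_mem e) hx hy hyx.symm
    rw [List.map_congr_left (fun e _ => h1 e), ← List.sum_toFinset _ hl, Finset.sum_sigma']
    show ∑ w ∈ F.vm v, H.v w = _
    symm
    have hmem : ∀ e, e ∈ l.toFinset → e ∈ {e | e ∈ l} := fun e he => List.mem_toFinset.mp he
    refine Finset.sum_bij (fun p _ => H.s p.2) ?_ ?_ ?_ ?_
    · rintro ⟨e, x⟩ hp
      rw [Finset.mem_sigma] at hp
      have hr : e ∈ ⋃₀ G.C v := ⟨_, hY, hmem e hp.1⟩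
      rw [G.sUnion] at hr
      have := F.source_mem e x hp.2
      rwa [show G.r e = v from hr] at this
    · rintro ⟨e, x⟩ hp ⟨f, y⟩ hq h
      rw [Finset.mem_sigma] at hp hq
      obtain ⟨h1, h2⟩ := F.eq_of_source v _ hY e (hmem e hp.1) f (hmem f hq.1) x hp.2 y hq.2 h
      rw [h1, h2]
    · intro w hw
      obtain ⟨e, he, x, hx, h⟩ := F.exists_source v _ hY w hw
      exact ⟨⟨e, x⟩, Finset.mem_sigma.mpr ⟨List.mem_toFinset.mpr he, hx⟩, h⟩
    · intro _ _; rfl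

/-- The `*`-homomorphism given by the data. -/
def hom : G.Leavitt →⋆ₙₐ[ℂ] H.Leavitt := StarPres.lift F.gen F.gen_rel

theorem hom_v (v : V) : F.hom (G.v v) = ∑ w ∈ F.vm v, H.v w := rfl
theorem hom_e (e : E) : F.hom (G.e e) = ∑ x ∈ F.em e, star (H.e x) := rfl

end SumMap

end SumMap

/-! ## Dynamical systems and refined sequences of partitions -/

section Dynamics

variable {X : Type u} [MetricSpace X]

/-- Surjective local homeomorphisms of `X` onto itself. -/
structure LHomeo (X : Type u) [TopologicalSpace X] where
  toFun : X → X
  isLocalHomeomorph : IsLocalHomeomorph toFun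
  surjective : Function.Surjective toFun

instance : CoeFun (LHomeo X) (fun _ => X → X) := ⟨LHomeo.toFun⟩

/-- Finite partitions of `X` into nonempty clopen sets. -/
structure ClopenPartition (X : Type u) [TopologicalSpace X] where
  parts : Set (Set X)
  finite : parts.Finite
  nonempty : ∀ Z ∈ parts, Z.Nonempty
  isClopen : ∀ Z ∈ parts, IsClopen Z
  disjoint : ∀ Z ∈ parts, ∀ W ∈ parts, Z ≠ W → Disjoint Z W
  cover : ⋃₀ parts = Set.univ

/-- The family `Q` is finer than the family `P`. -/
def Finer (P Q : Set (Set X)) : Prop := ∀ W ∈ Q, ∃ Z ∈ P, W ⊆ Z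

/-- The join of two families: all nonempty intersections. -/
def join (P Q : Set (Set X)) : Set (Set X) :=
  {W | W.Nonempty ∧ ∃ Y ∈ P, ∃ Z ∈ Q, W = Y ∩ Z}

/-- The set of points with at least `k` preimages under `σ`. -/
def manyPreimages (σ : X → X) (k : ℕ) : Set X := {x | (k : ℕ∞) ≤ (σ ⁻¹' {x}).encard}

/-- The maximal number of preimages of a point under `σ`. -/
def maxPreimages (σ : X → X) : ℕ∞ := ⨆ x, (σ ⁻¹' {x}).encard

/-- The family of all nonempty sets of the form `σ(Z₁) ∩ ⋯ ∩ σ(Z_k) \ U`, with `Z₁, …, Z_k`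
distinct members of `P`, `1 ≤ k ≤ maxPreimages σ`, and `U` the set of points with at least `k + 1`
preimages. -/
def imageFamily (σ : X → X) (P : Set (Set X)) : Set (Set X) :=
  {W | W.Nonempty ∧ ∃ S : Finset (Set X), ↑S ⊆ P ∧ 1 ≤ S.card ∧ (S.card : ℕ∞) ≤ maxPreimages σ ∧
    W = (⋂ Z ∈ S, σ '' Z) \ manyPreimages σ (S.card + 1)}

/-- The family of the preimages under `σ` of the members of `P`. -/
def preimageFamily (σ : X → X) (P : Set (Set X)) : Set (Set X) := {W | ∃ Z ∈ P, W = σ ⁻¹' Z}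

/-- `σ`-refined sequences of partitions of `X`. -/
structure RefinedSeq (σ : LHomeo X) where
  part : ℕ → ClopenPartition X
  homeo : ∀ Z ∈ (part 0).parts, Topology.IsEmbedding (Z.domRestrict σ)
  finer : ∀ n, Finer (part n).parts (part (n + 1)).parts
  generates : (inferInstance : TopologicalSpace X) =
    TopologicalSpace.generateFrom (⋃ n, (part n).parts)
  diam : Filter.Tendsto (fun n => ⨆ Z : (part n).parts, Metric.diam (Z : Set X)) Filter.atTop
    (nhds 0)
  finer_even : ∀ j, Finer (join (part (2 * j)).parts (imageFamily σ (part (2 * j)).parts))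
    (part (2 * j + 1)).parts
  finer_odd : ∀ j, Finer (join (part (2 * j + 1)).parts (preimageFamily σ (part (2 * j + 1)).parts))
    (part (2 * j + 2)).parts

namespace RefinedSeq

variable {σ : LHomeo X} (S : RefinedSeq σ)

/-- The members of the `n`-th partition. -/
abbrev P (n : ℕ) : Set (Set X) := (S.part n).parts

instance (n : ℕ) : Finite (S.P n) := (S.part n).finite.to_subtype
instance (n : ℕ) : Fintype (S.P n) := Fintype.ofFinite _

theorem exists_mem (n : ℕ) (x : X) : ∃ Z ∈ S.P n, x ∈ Z := by
  have : x ∈ ⋃₀ S.P n := by rw [(S.part n).cover]; trivial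
  exact this

theorem eq_of_mem {n : ℕ} {Z W : Set X} (hZ : Z ∈ S.P n) (hW : W ∈ S.P n) {x : X} (hx : x ∈ Z)
    (hx' : x ∈ W) : Z = W := by
  by_contra h
  exact Set.disjoint_left.mp ((S.part n).disjoint Z hZ W hW h) hx hx'

theorem subset_of_mem {n : ℕ} {Z W : Set X} (hZ : Z ∈ S.P n) (hW : W ∈ S.P (n + 1)) {x : X}
    (hx : x ∈ Z) (hx' : x ∈ W) : W ⊆ Z := by
  obtain ⟨Z', hZ', h⟩ := S.finer n W hW
  rwa [S.eq_of_mem hZ hZ' hx (h hx')]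

theorem subset_of_mem₂ {n : ℕ} {Z W : Set X} (hZ : Z ∈ S.P n) (hW : W ∈ S.P (n + 2)) {x : X}
    (hx : x ∈ Z) (hx' : x ∈ W) : W ⊆ Z := by
  obtain ⟨Y, hY, h⟩ := S.finer (n + 1) W hW
  exact h.trans (S.subset_of_mem hZ hY hx (h hx'))

theorem injOn (n : ℕ) : ∀ Z ∈ S.P n, Set.InjOn σ Z := by
  induction n with
  | zero => exact fun Z hZ => Set.injOn_iff_injective.mpr (S.homeo Z hZ).injective
  | succ n ih =>
    intro W hW
    obtain ⟨Z, hZ, h⟩ := S.finer n W hW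
    exact (ih Z hZ).mono h

theorem subset_image {n : ℕ} (hn : Even n) {Z W : Set X} (hZ : Z ∈ S.P n) (hW : W ∈ S.P (n + 1))
    {x : X} (hx : x ∈ Z) (hx' : σ x ∈ W) : W ⊆ σ '' Z := by
  classical
  obtain ⟨j, rfl⟩ : ∃ j, n = 2 * j := hn.exists_two_nsmul n |>.imp fun j h => by simpa using h
  obtain ⟨_, ⟨-, Y, hY, U, ⟨-, T, hT, hT1, -, rfl⟩, rfl⟩, hWU⟩ := S.finer_even j W hW
  have hWU' := hWU.trans Set.inter_subset_right
  by_cases hZT : Z ∈ T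
  · intro w hw
    exact Set.mem_iInter₂.mp (hWU' hw).1 Z hZT
  · exfalso
    obtain ⟨h1, h2⟩ := hWU' hx'
    apply h2
    have h3 : ∀ Z' ∈ insert Z T, ∃ y ∈ Z', σ y = σ x := by
      intro Z' hZ'
      rcases Finset.mem_insert.mp hZ' with rfl | hZ'
      · exact ⟨x, hx, rfl⟩
      · exact Set.mem_iInter₂.mp h1 Z' hZ'
    have hX : Nonempty X := ⟨x⟩
    choose! g hg hg' using h3
    have hP : ∀ Z' ∈ insert Z T, Z' ∈ S.P (2 * j) := by
      intro Z' hZ'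
      rcases Finset.mem_insert.mp hZ' with rfl | hZ'
      · exact hZ
      · exact hT hZ'
    have hinj : Set.InjOn g ((insert Z T : Finset (Set X)) : Set (Set X)) := by
      intro A hA B hB hAB
      exact S.eq_of_mem (hP A hA) (hP B hB) (hg A hA) (hAB ▸ hg B hB)
    show ((T.card + 1 : ℕ) : ℕ∞) ≤ _
    rw [← Finset.card_insert_of_notMem hZT, ← Finset.card_image_of_injOn hinj,
      ← Set.encard_coe_eq_coe_finsetCard]
    refine Set.encard_le_encard ?_
    intro y hy
    rw [Finset.coe_image] at hy
    obtain ⟨A, hA, rfl⟩ := hy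
    exact hg' A hA

theorem subset_preimage {n : ℕ} (hn : ¬Even n) {Z W : Set X} (hZ : Z ∈ S.P n)
    (hW : W ∈ S.P (n + 1)) {x : X} (hx : x ∈ W) (hx' : σ x ∈ Z) : W ⊆ σ ⁻¹' Z := by
  obtain ⟨j, rfl⟩ := Nat.not_even_iff_odd.mp hn
  obtain ⟨_, ⟨-, Y, hY, _, ⟨U, hU, rfl⟩, rfl⟩, hWU⟩ := S.finer_odd j W hW
  have hWU' := hWU.trans Set.inter_subset_right
  have : Z = U := S.eq_of_mem hZ hU hx' (hWU' hx)
  rwa [this]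

/-! ### The layers of the associated diagram -/

/-- Vertices of the `n`-th layer: the members of the `n`-th and of the `(n+1)`-st partition. -/
abbrev Vertex (n : ℕ) : Type u := S.P n ⊕ S.P (n + 1)

/-- Blue edges of the `n`-th layer, written as pairs (range, source). -/
def Blue (n : ℕ) : Type u := {p : S.P n × S.P (n + 1) // (p.2 : Set X) ⊆ p.1}

/-- The condition for a red edge of the `n`-th layer from `W` to `Z`. -/
def RedRel (σ : X → X) (n : ℕ) (Z W : Set X) : Prop :=
  (Even n ∧ W ⊆ σ '' Z) ∨ (¬Even n ∧ W ⊆ σ ⁻¹' Z)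

/-- Red edges of the `n`-th layer, written as pairs (range, source). -/
def Red (n : ℕ) : Type u := {p : S.P n × S.P (n + 1) // RedRel σ n p.1 p.2}

/-- Edges of the `n`-th layer. -/
abbrev Edge (n : ℕ) : Type u := S.Blue n ⊕ S.Red n

/-- The pair (range, source) of an edge. -/
def ends {n : ℕ} : S.Edge n → S.P n × S.P (n + 1)
  | .inl e => e.1
  | .inr f => f.1

instance (n : ℕ) : Finite (S.Blue n) := inferInstanceAs (Finite (Subtype _))
instance (n : ℕ) : Finite (S.Red n) := inferInstanceAs (Finite (Subtype _))
instance (n : ℕ) : Fintype (S.Edge n) := Fintype.ofFinite _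

/-- The set `B_Z` of blue edges with range `Z`. -/
def blueSet (n : ℕ) (Z : S.P n) : Set (S.Edge n) := {e | e.isLeft ∧ (S.ends e).1 = Z}

/-- The set `R_Z` of red edges with range `Z`. -/
def redSet (n : ℕ) (Z : S.P n) : Set (S.Edge n) := {e | e.isRight ∧ (S.ends e).1 = Z}

/-- The set of red edges with range `Z` and source contained in `U`; this is `R(f)` for a red
edge `f` from `Z` to `U` in the layer above. -/
def redSetBelow (n : ℕ) (Z : S.P n) (U : Set X) : Set (S.Edge n) :=
  {e | e ∈ S.redSet n Z ∧ ((S.ends e).2 : Set X) ⊆ U}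

/-- The separation `D_Z` at `Z` in the `n`-th layer: it is `{B_Z, R_Z}` for even `n`, and
consists of `B_Z` and the sets `R(f)`, `f` a red edge of the layer `n - 1` with source `Z`, for odd
`n`. -/
def sep (n : ℕ) (Z : S.P n) : Set (Set (S.Edge n)) :=
  {Y | Y = S.blueSet n Z ∨ (Even n ∧ Y = S.redSet n Z) ∨
    (¬Even n ∧ ∃ U ∈ S.P (n - 1), RedRel σ (n - 1) U Z ∧ Y = S.redSetBelow n Z U)}

theorem redRel_even {n : ℕ} (hn : Even n) {Z W : Set X} : RedRel σ n Z W ↔ W ⊆ σ '' Z := by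
  simp [RedRel, hn]

theorem redRel_odd {n : ℕ} (hn : ¬Even n) {Z W : Set X} : RedRel σ n Z W ↔ W ⊆ σ ⁻¹' Z := by
  simp [RedRel, hn]

theorem not_even_cases {n : ℕ} (hn : ¬Even n) : ∃ m, n = m + 1 ∧ Even m := by
  obtain ⟨j, rfl⟩ := Nat.not_even_iff_odd.mp hn
  exact ⟨2 * j, rfl, even_two_mul j⟩

theorem blueSet_nonempty (n : ℕ) (Z : S.P n) : (S.blueSet n Z).Nonempty := by
  obtain ⟨x, hx⟩ := (S.part n).nonempty Z Z.2
  obtain ⟨W, hW, hxW⟩ := S.exists_mem (n + 1) x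
  exact ⟨.inl ⟨(Z, ⟨W, hW⟩), S.subset_of_mem Z.2 hW hx hxW⟩, rfl, rfl⟩

theorem sep_nonempty (n : ℕ) (Z : S.P n) : ∀ Y ∈ S.sep n Z, Y.Nonempty := by
  rintro Y (rfl | ⟨hn, rfl⟩ | ⟨hn, U, hU, h, rfl⟩)
  · exact S.blueSet_nonempty n Z
  · obtain ⟨x, hx⟩ := (S.part n).nonempty Z Z.2
    obtain ⟨W, hW, hxW⟩ := S.exists_mem (n + 1) (σ x)
    exact ⟨.inr ⟨(Z, ⟨W, hW⟩), (redRel_even hn).mpr (S.subset_image hn Z.2 hW hx hxW)⟩, rfl, rfl⟩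
  · obtain ⟨m, rfl, hm⟩ := not_even_cases hn
    obtain ⟨x, hx⟩ := (S.part (m + 1)).nonempty Z Z.2
    obtain ⟨y, hy, rfl⟩ := (redRel_even (by simpa using hm)).mp h hx
    obtain ⟨W, hW, hyW⟩ := S.exists_mem (m + 1 + 1) y
    exact ⟨.inr ⟨(Z, ⟨W, hW⟩), (redRel_odd hn).mpr (S.subset_preimage hn Z.2 hW hyW hx)⟩,
      ⟨rfl, rfl⟩, S.subset_of_mem₂ hU hW hy hyW⟩

theorem sep_disjoint (n : ℕ) (Z : S.P n) : ∀ Y ∈ S.sep n Z, ∀ Y' ∈ S.sep n Z, Y ≠ Y' →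
    Disjoint Y Y' := by
  have hbr : ∀ (e : S.Edge n), e ∈ S.blueSet n Z → e ∈ S.redSet n Z → False := by
    rintro (e | e) ⟨h, -⟩ ⟨h', -⟩
    · exact Bool.false_ne_true h'
    · exact Bool.false_ne_true h
  intro Y hY Y' hY' hne
  rw [Set.disjoint_left]
  intro e he he'
  rcases hY with rfl | ⟨hn, rfl⟩ | ⟨hn, U, hU, h, rfl⟩ <;>
    rcases hY' with rfl | ⟨hn', rfl⟩ | ⟨hn', U', hU', h', rfl⟩
  · exact hne rfl
  · exact hbr e he he'
  · exact hbr e he he'.1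
  · exact hbr e he' he
  · exact hne rfl
  · exact hn' hn
  · exact hbr e he' he.1
  · exact hn hn'
  · obtain ⟨m, rfl, hm⟩ := not_even_cases hn
    obtain ⟨x, hx⟩ := (S.part (m + 1 + 1)).nonempty _ (S.ends e).2.2
    exact hne (by rw [S.eq_of_mem hU hU' (he.2 hx) (he'.2 hx)])

theorem sep_sUnion (n : ℕ) (Z : S.P n) : ⋃₀ S.sep n Z = {e | (S.ends e).1 = Z} := by
  ext e
  constructor
  · rintro ⟨Y, rfl | ⟨hn, rfl⟩ | ⟨hn, U, hU, h, rfl⟩, he⟩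
    · exact he.2
    · exact he.2
    · exact he.1.2
  · intro he
    rcases e with e | e
    · exact ⟨_, .inl rfl, rfl, he⟩
    · by_cases hn : Even n
      · exact ⟨_, .inr (.inl ⟨hn, rfl⟩), rfl, he⟩
      · have hrel := (redRel_odd hn).mp e.2
        obtain ⟨m, rfl, hm⟩ := not_even_cases hn
        obtain ⟨x, hx⟩ := (S.part (m + 1 + 1)).nonempty _ e.1.2.2
        obtain ⟨U, hU, hxU⟩ := S.exists_mem m x
        have h1 : (e.1.1 : Set X) ⊆ σ '' U := S.subset_image hm hU e.1.1.2 hxU (hrel hx)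
        have h2 : e.1.1 = Z := he
        refine ⟨_, .inr (.inr ⟨hn, U, hU, (redRel_even (by simpa using hm)).mpr (h2 ▸ h1), rfl⟩),
          ⟨rfl, he⟩, S.subset_of_mem₂ hU e.1.2.2 hxU hx⟩

/-- The `n`-th layer of the diagram, as a separated graph. -/
def layer (n : ℕ) : SeparatedGraph (S.Vertex n) (S.Edge n) where
  s e := .inr (S.ends e).2
  r e := .inl (S.ends e).1
  C := Sum.elim (S.sep n) (fun _ => ∅)
  nonempty := by
    rintro (Z | Z)
    · exact S.sep_nonempty n Z
    · rintro _ ⟨⟩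
  disjoint := by
    rintro (Z | Z)
    · exact S.sep_disjoint n Z
    · rintro _ ⟨⟩
  sUnion := by
    rintro (Z | Z)
    · rw [Sum.elim_inl, S.sep_sUnion]
      ext e
      exact ⟨fun h => congrArg Sum.inl h, fun h => Sum.inl_injective h⟩
    · ext e
      simp

/-! ### The connecting maps -/

open Classical in
/-- The set of edges of the layer `n + 1` which describes the image of an edge `e` of the
layer `n`: it is `B_{s(e)}` if `e` is blue; if `e` is red it is `R(e)` for even `n` and `R_{s(e)}`
for odd `n`. -/
def nextEdges (n : ℕ) : S.Edge n → Finset (S.Edge (n + 1))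
  | .inl e => {x | x ∈ S.blueSet (n + 1) e.1.2}
  | .inr f => {x | (Even n ∧ x ∈ S.redSetBelow (n + 1) f.1.2 f.1.1) ∨
      (¬Even n ∧ x ∈ S.redSet (n + 1) f.1.2)}

open Classical in
/-- The set of vertices of the layer `n + 1` which describes the image of a vertex of the
layer `n`: a vertex `W` in the `(n+1)`-st partition goes to itself, and a vertex `Z` in the `n`-th
partition goes to the sum of the sources of the blue paths of length two with range `Z`, that is, of
the members of the `(n+2)`-nd partition that are contained in `Z`. -/
def nextVertices (n : ℕ) : S.Vertex n → Finset (S.Vertex (n + 1))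
  | .inl Z => ({W : S.P (n + 2) | (W : Set X) ⊆ Z} : Finset _).map Function.Embedding.inr
  | .inr W => {.inl W}

open Classical in
theorem nextEdges_range {n : ℕ} {e : S.Edge n} {x : S.Edge (n + 1)} (h : x ∈ S.nextEdges n e) :
    (S.ends x).1 = (S.ends e).2 := by
  rcases e with e | f
  · exact ((Finset.mem_filter.mp h).2).2
  · rcases (Finset.mem_filter.mp h).2 with h | h
    · exact h.2.1.2
    · exact h.2.2

open Classical in
theorem nextEdges_sub {n : ℕ} {e : S.Edge n} {x : S.Edge (n + 1)} (h : x ∈ S.nextEdges n e) :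
    ((S.ends x).2 : Set X) ⊆ (S.ends e).1 := by
  have hr := S.nextEdges_range h
  rcases e with e | f
  · obtain ⟨h1, h2⟩ := (Finset.mem_filter.mp h).2
    rcases x with x | x
    · refine Set.Subset.trans ?_ e.2
      rw [← h2]
      exact x.2
    · cases h1
  · rcases (Finset.mem_filter.mp h).2 with h | ⟨hn, h1, h2⟩
    · exact h.2.2
    · rcases x with x | x
      · cases h1
      · have h3 := (redRel_even (Nat.even_add_one.mpr hn)).mp x.2
        have h4 := (redRel_odd hn).mp f.2
        have h5 : x.1.1 = f.1.2 := h2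
        intro z hz
        obtain ⟨y, hy, rfl⟩ := h3 hz
        rw [h5] at hy
        exact h4 hy

theorem sum_isLeft_eq {n : ℕ} {x y : S.Edge n} (h : x.isLeft = y.isLeft) (h' : S.ends x = S.ends y) :
    x = y := by
  rcases x with x | x <;> rcases y with y | y
  · exact congrArg Sum.inl (Subtype.ext h')
  · cases h
  · cases h
  · exact congrArg Sum.inr (Subtype.ext h')

theorem sep_color {n : ℕ} {Z : S.P n} {Y : Set (S.Edge n)} (hY : Y ∈ S.sep n Z) {e f : S.Edge n}
    (he : e ∈ Y) (hf : f ∈ Y) : e.isLeft = f.isLeft ∧ (S.ends e).1 = Z ∧ (S.ends f).1 = Z := by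
  have hr : ∀ {e : S.Edge n}, e.isRight = true → e.isLeft = false := by
    rintro (e | e) h
    · cases h
    · rfl
  rcases hY with rfl | ⟨hn, rfl⟩ | ⟨hn, U, hU, h, rfl⟩
  · exact ⟨he.1.trans hf.1.symm, he.2, hf.2⟩
  · exact ⟨(hr he.1).trans (hr hf.1).symm, he.2, hf.2⟩
  · exact ⟨(hr he.1.1).trans (hr hf.1.1).symm, he.1.2, hf.1.2⟩

open Classical in
theorem nextEdges_color {n : ℕ} {e : S.Edge n} {x : S.Edge (n + 1)} (h : x ∈ S.nextEdges n e) :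
    x.isLeft = e.isLeft := by
  rcases e with e | f
  · obtain ⟨h1, h2⟩ := (Finset.mem_filter.mp h).2
    exact h1
  · have : x.isRight = true := by
      rcases (Finset.mem_filter.mp h).2 with h | h
      · exact h.2.1.1
      · exact h.2.1
    rcases x with x | x
    · cases this
    · rfl

theorem nextEdges_mem_sep {n : ℕ} (e : S.Edge n) :
    (S.nextEdges n e : Set (S.Edge (n + 1))) ∈ S.sep (n + 1) (S.ends e).2 := by
  rcases e with e | f
  · left
    ext x
    simp [nextEdges, ends]
  · right
    by_cases hn : Even n
    · right
      have hn' : ¬Even (n + 1) := by rw [Nat.even_add_one, not_not]; exact hn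
      refine ⟨hn', f.1.1, f.1.1.2, f.2, ?_⟩
      ext x
      simp [nextEdges, ends, hn]
    · left
      refine ⟨Nat.even_add_one.mpr hn, ?_⟩
      ext x
      simp [nextEdges, ends, hn]

theorem mem_nextEdges_blue {n : ℕ} {e : S.Blue n} {x : S.Edge (n + 1)} :
    x ∈ S.nextEdges n (.inl e) ↔ x ∈ S.blueSet (n + 1) e.1.2 := by simp [nextEdges]

theorem mem_nextEdges_red_even {n : ℕ} (hn : Even n) {f : S.Red n} {x : S.Edge (n + 1)} :
    x ∈ S.nextEdges n (.inr f) ↔ x ∈ S.redSetBelow (n + 1) f.1.2 f.1.1 := by simp [nextEdges, hn]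

theorem mem_nextEdges_red_odd {n : ℕ} (hn : ¬Even n) {f : S.Red n} {x : S.Edge (n + 1)} :
    x ∈ S.nextEdges n (.inr f) ↔ x ∈ S.redSet (n + 1) f.1.2 := by simp [nextEdges, hn]

theorem next_source_unique {n : ℕ} {Z : S.P n} {Y : Set (S.Edge n)} (hY : Y ∈ S.sep n Z)
    {e f : S.Edge n} (he : e ∈ Y) (hf : f ∈ Y) {x y : S.Edge (n + 1)} (hx : x ∈ S.nextEdges n e)
    (hy : y ∈ S.nextEdges n f) (h : (S.ends x).2 = (S.ends y).2) : e = f ∧ x = y := by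
  obtain ⟨hc, heZ, hfZ⟩ := S.sep_color hY he hf
  have key : (S.ends e).2 = (S.ends f).2 := by
    apply Subtype.ext
    obtain ⟨z, hz⟩ := (S.part (n + 2)).nonempty _ (S.ends x).2.2
    have hz' : z ∈ ((S.ends y).2 : Set X) := h ▸ hz
    have hxr := S.nextEdges_range hx
    have hyr := S.nextEdges_range hy
    have hxc := S.nextEdges_color hx
    have hyc := S.nextEdges_color hy
    rw [← hxr, ← hyr]
    rcases e with e | e
    · rcases f with f | f
      · rcases x with x | x
        · rcases y with y | y
          · exact S.eq_of_mem x.1.1.2 y.1.1.2 (x.2 hz) (y.2 hz')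
          · cases hyc
        · cases hxc
      · cases hc
    · rcases f with f | f
      · cases hc
      · rcases x with x | x
        · cases hxc
        · rcases y with y | y
          · cases hyc
          · by_cases hn : Even n
            · have hn' : ¬Even (n + 1) := by rw [Nat.even_add_one, not_not]; exact hn
              exact S.eq_of_mem x.1.1.2 y.1.1.2 ((redRel_odd hn').mp x.2 hz)
                ((redRel_odd hn').mp y.2 hz')
            · have hn' : Even (n + 1) := Nat.even_add_one.mpr hn
              obtain ⟨a, ha, haz⟩ := (redRel_even hn').mp x.2 hz
              obtain ⟨b, hb, hbz⟩ := (redRel_even hn').mp y.2 hz'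
              have hae : a ∈ (e.1.2 : Set X) := by
                have : x.1.1 = e.1.2 := hxr
                rw [← this]; exact ha
              have hbf : b ∈ (f.1.2 : Set X) := by
                have : y.1.1 = f.1.2 := hyr
                rw [← this]; exact hb
              rcases hY with rfl | ⟨hn'', -⟩ | ⟨-, U, hU, -, rfl⟩
              · exact absurd he.1 (by simp)
              · exact absurd hn'' hn
              · have hab : a = b := S.injOn _ U hU (he.2 hae) (hf.2 hbf) (haz.trans hbz.symm)
                exact S.eq_of_mem x.1.1.2 y.1.1.2 ha (hab ▸ hb)
  have hef : e = f := S.sum_isLeft_eq hc (Prod.ext (heZ.trans hfZ.symm) key)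
  refine ⟨hef, S.sum_isLeft_eq ?_ (Prod.ext ?_ h)⟩
  · rw [S.nextEdges_color hx, S.nextEdges_color hy, hc]
  · rw [S.nextEdges_range hx, S.nextEdges_range hy, key]

theorem next_source_exists {n : ℕ} {Z : S.P n} {Y : Set (S.Edge n)} (hY : Y ∈ S.sep n Z)
    (W : S.P (n + 2)) (hW : (W : Set X) ⊆ Z) :
    ∃ e ∈ Y, ∃ x ∈ S.nextEdges n e, (S.ends x).2 = W := by
  obtain ⟨z, hz⟩ := (S.part (n + 2)).nonempty W W.2
  rcases hY with rfl | ⟨hn, rfl⟩ | ⟨hn, U, hU, h, rfl⟩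
  · obtain ⟨Z', hZ', hzZ'⟩ := S.exists_mem (n + 1) z
    exact ⟨.inl ⟨(Z, ⟨Z', hZ'⟩), S.subset_of_mem Z.2 hZ' (hW hz) hzZ'⟩, ⟨rfl, rfl⟩,
      .inl ⟨(⟨Z', hZ'⟩, W), S.subset_of_mem hZ' W.2 hzZ' hz⟩,
      S.mem_nextEdges_blue.mpr ⟨rfl, rfl⟩, rfl⟩
  · have hn' : ¬Even (n + 1) := by rw [Nat.even_add_one, not_not]; exact hn
    obtain ⟨Z', hZ', hzZ'⟩ := S.exists_mem (n + 1) (σ z)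
    exact ⟨.inr ⟨(Z, ⟨Z', hZ'⟩), (redRel_even hn).mpr (S.subset_image hn Z.2 hZ' (hW hz) hzZ')⟩,
      ⟨rfl, rfl⟩,
      .inr ⟨(⟨Z', hZ'⟩, W), (redRel_odd hn').mpr (S.subset_preimage hn' hZ' W.2 hz hzZ')⟩,
      (S.mem_nextEdges_red_even hn).mpr ⟨⟨rfl, rfl⟩, hW⟩, rfl⟩
  · have hn' : Even (n + 1) := Nat.even_add_one.mpr hn
    obtain ⟨m, rfl, hm⟩ := not_even_cases hn
    obtain ⟨y, hy, rfl⟩ := (redRel_even (by simpa using hm)).mp h (hW hz)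
    obtain ⟨Z', hZ', hyZ'⟩ := S.exists_mem (m + 1 + 1) y
    exact ⟨.inr ⟨(Z, ⟨Z', hZ'⟩), (redRel_odd hn).mpr (S.subset_preimage hn Z.2 hZ' hyZ' (hW hz))⟩,
      ⟨⟨rfl, rfl⟩, S.subset_of_mem₂ hU hZ' hy hyZ'⟩,
      .inr ⟨(⟨Z', hZ'⟩, W), (redRel_even hn').mpr (S.subset_image hn' hZ' W.2 hyZ' hz)⟩,
      (S.mem_nextEdges_red_odd hn).mpr ⟨rfl, rfl⟩, rfl⟩

open Classical in
/-- The data of the connecting map between the `n`-th and the `(n+1)`-st layer. -/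
def connectData (n : ℕ) : SumMap (S.layer n) (S.layer (n + 1)) where
  vm := S.nextVertices n
  em := S.nextEdges n
  base e := .inl (S.ends e).2
  vm_disjoint := by
    rintro (Z | Z) (W | W) h <;> rw [Finset.disjoint_left] <;> intro x hx hx'
    · obtain ⟨a, ha, rfl⟩ := Finset.mem_map.mp hx
      obtain ⟨b, hb, hab⟩ := Finset.mem_map.mp hx'
      obtain rfl : b = a := Sum.inr_injective hab
      obtain ⟨z, hz⟩ := (S.part (n + 2)).nonempty b b.2
      have ha' := (Finset.mem_filter.mp ha).2
      have hb' := (Finset.mem_filter.mp hb).2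
      exact h (congrArg Sum.inl (Subtype.ext (S.eq_of_mem Z.2 W.2 (ha' hz) (hb' hz))))
    · obtain ⟨a, ha, rfl⟩ := Finset.mem_map.mp hx
      cases Finset.mem_singleton.mp hx'
    · obtain ⟨a, ha, rfl⟩ := Finset.mem_map.mp hx'
      cases Finset.mem_singleton.mp hx
    · have h1 := Finset.mem_singleton.mp hx
      have h2 := Finset.mem_singleton.mp hx'
      exact h (congrArg Sum.inr (Sum.inl_injective (h1.symm.trans h2)))
  source_mem e x hx := Finset.mem_map.mpr
    ⟨(S.ends x).2, Finset.mem_filter.mpr ⟨Finset.mem_univ _, S.nextEdges_sub hx⟩, rfl⟩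
  vm_source e := rfl
  em_mem e := S.nextEdges_mem_sep e
  eq_of_source := by
    rintro (Z | Z) Y hY e he f hf x hx y hy h
    · exact S.next_source_unique hY he hf hx hy (Sum.inr_injective h)
    · cases hY
  exists_source := by
    rintro (Z | Z) Y hY w hw
    · obtain ⟨a, ha, rfl⟩ := Finset.mem_map.mp hw
      obtain ⟨e, he, x, hx, h⟩ := S.next_source_exists hY a (Finset.mem_filter.mp ha).2
      exact ⟨e, he, x, hx, congrArg Sum.inr h⟩
    · cases hY

/-- The Leavitt path algebra of the `n`-th layer. -/
abbrev L (n : ℕ) : Type u := (S.layer n).Leavitt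

/-- The graph `C*`-algebra of the `n`-th layer. -/
abbrev CS (n : ℕ) : Type u := (S.layer n).CStar

/-- The connecting map between the Leavitt path algebras of consecutive layers. -/
def connect (n : ℕ) : S.L n →⋆ₙₐ[ℂ] S.L (n + 1) := (S.connectData n).hom

/-- The connecting map between the graph `C*`-algebras of consecutive layers. -/
def connectC (n : ℕ) : S.CS n →⋆ₙₐ[ℂ] S.CS (n + 1) := Env.map (S.connect n)

/-- The sum of the vertices of the `n`-th layer that belong to the `n`-th partition. -/
def p (n : ℕ) : S.L n := ∑ Z : S.P n, (S.layer n).v (.inl Z)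

/-- The sum of the vertices of the `n`-th layer that belong to the `(n+1)`-st partition. -/
def q (n : ℕ) : S.L n := ∑ W : S.P (n + 1), (S.layer n).v (.inr W)

theorem isStarProjection_p (n : ℕ) : IsStarProjection (S.p n) :=
  (S.layer n).isStarProjection_sum _ _ Sum.inl_injective.injOn

theorem connect_inl (n : ℕ) (Z : S.P n) : S.connect n ((S.layer n).v (.inl Z)) =
    ∑ w ∈ S.nextVertices n (.inl Z), (S.layer (n + 1)).v w := rfl

theorem connect_inr (n : ℕ) (W : S.P (n + 1)) : S.connect n ((S.layer n).v (.inr W)) =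
    (S.layer (n + 1)).v (.inl W) :=
  Finset.sum_singleton (fun w => (S.layer (n + 1)).v w) (Sum.inl W)

theorem connect_q (n : ℕ) : S.connect n (S.q n) = S.p (n + 1) := by
  rw [q, map_sum]
  exact Finset.sum_congr rfl fun W _ => S.connect_inr n W

theorem connect_p (n : ℕ) : S.connect n (S.p n) = S.q (n + 1) := by
  classical
  rw [p, map_sum]
  simp only [connect_inl, nextVertices, Finset.sum_map]
  rw [Finset.sum_sigma', q]
  refine Finset.sum_bij (fun a _ => a.2) ?_ ?_ ?_ ?_
  · intro _ _; exact Finset.mem_univ _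
  · rintro ⟨Z, W⟩ h ⟨Z', W'⟩ h' hW
    obtain rfl : W = W' := hW
    have h1 := (Finset.mem_filter.mp (Finset.mem_sigma.mp h).2).2
    have h2 := (Finset.mem_filter.mp (Finset.mem_sigma.mp h').2).2
    obtain ⟨z, hz⟩ := (S.part (n + 2)).nonempty W W.2
    obtain rfl : Z = Z' := Subtype.ext (S.eq_of_mem Z.2 Z'.2 (h1 hz) (h2 hz))
    rfl
  · intro W _
    obtain ⟨z, hz⟩ := (S.part (n + 2)).nonempty W W.2
    obtain ⟨Z, hZ, hzZ⟩ := S.exists_mem n z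
    refine ⟨⟨⟨Z, hZ⟩, W⟩, Finset.mem_sigma.mpr ⟨Finset.mem_univ _, Finset.mem_filter.mpr
      ⟨Finset.mem_univ _, S.subset_of_mem₂ hZ W.2 hzZ hz⟩⟩, rfl⟩
  · intro _ _; rfl

/-- The corner of the Leavitt path algebra of the layer `2n`. -/
abbrev A (n : ℕ) : NonUnitalStarSubalgebra ℂ (S.L (2 * n)) :=
  corner (S.p (2 * n)) (S.isStarProjection_p _)

theorem isStarProjection_pC (n : ℕ) : IsStarProjection (Env.ι (S.p n) : S.CS n) :=
  isStarProjection_map (S.isStarProjection_p n) Env.ι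

/-- The corner of the graph `C*`-algebra of the layer `2n`. -/
abbrev B (n : ℕ) : NonUnitalStarSubalgebra ℂ (S.CS (2 * n)) :=
  corner (Env.ι (S.p (2 * n))) (S.isStarProjection_pC _)

/-- The map `A n → A (n + 1)` obtained by restricting two consecutive connecting maps. -/
def φA (n : ℕ) : S.A n →⋆ₙₐ[ℂ] S.A (n + 1) :=
  cornerMap ((S.connect (2 * n + 1)).comp (S.connect (2 * n))) (S.isStarProjection_p _)
    (S.isStarProjection_p _) <| by
      rw [NonUnitalStarAlgHom.comp_apply, connect_p, connect_q]

/-- The map `B n → B (n + 1)` obtained by restricting two consecutive connecting maps. -/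
def φB (n : ℕ) : S.B n →⋆ₙₐ[ℂ] S.B (n + 1) :=
  cornerMap ((S.connectC (2 * n + 1)).comp (S.connectC (2 * n))) (S.isStarProjection_pC _)
    (S.isStarProjection_pC _) <| by
      rw [NonUnitalStarAlgHom.comp_apply, connectC, connectC, Env.map_ι, Env.map_ι, connect_p,
        connect_q]

/-- The algebraic colimit of the corners of the Leavitt path algebras. -/
abbrev AInf : Type u := SeqLim S.φA

/-- The colimit, in the category of `C*`-algebras, of the corners of the graph `C*`-algebras. -/
abbrev BInf : Type u := CStarSeqLim S.φB

/-- The canonical map between the corners. -/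
def cornerι (n : ℕ) : S.A n →⋆ₙₐ[ℂ] S.B n :=
  cornerMap Env.ι (S.isStarProjection_p _) (S.isStarProjection_pC _) rfl

/-- The canonical map between the colimits of the corners. -/
def canonical : S.AInf →⋆ₙₐ[ℂ] S.BInf :=
  Env.ι.comp (SeqLim.map S.φB S.cornerι fun n x => Subtype.ext (by
    show Env.ι (S.connect (2 * n + 1) (S.connect (2 * n) (x : S.L (2 * n)))) =
      S.connectC (2 * n + 1) (S.connectC (2 * n) (Env.ι (x : S.L (2 * n))))
    rw [connectC, connectC, Env.map_ι, Env.map_ι]))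

theorem p_mul_v (n : ℕ) (Z : S.P n) : S.p n * (S.layer n).v (.inl Z) = (S.layer n).v (.inl Z) := by
  rw [p, Finset.sum_mul, Finset.sum_eq_single_of_mem Z (Finset.mem_univ _)]
  · exact (S.layer n).v_mul_self _
  · intro W _ h
    exact (S.layer n).v_mul_ne (fun h' => h (Sum.inl_injective h'))

theorem p_mul_e (n : ℕ) (e : S.Edge n) : S.p n * (S.layer n).e e = (S.layer n).e e := by
  conv_lhs => rw [← (S.layer n).v_mul_e e]
  rw [← mul_assoc]
  show S.p n * (S.layer n).v (.inl (S.ends e).1) * _ = _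
  rw [p_mul_v]
  exact (S.layer n).v_mul_e e

theorem star_p (n : ℕ) : star (S.p n) = S.p n := (S.isStarProjection_p n).2

/-- A vertex `Z`, as an element of the corner. -/
def vertexElt (n : ℕ) (Z : S.P (2 * n)) : S.A n :=
  ⟨(S.layer (2 * n)).v (.inl Z), mem_corner_iff.mpr <| by
    rw [p_mul_v]
    have := congrArg star (S.p_mul_v (2 * n) Z)
    rwa [star_mul, star_p, (S.layer (2 * n)).star_v] at this⟩

/-- The element `e f*` of the corner. -/
def edgeElt (n : ℕ) (e f : S.Edge (2 * n)) : S.A n :=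
  ⟨(S.layer (2 * n)).e e * star ((S.layer (2 * n)).e f), mem_corner_iff.mpr <| by
    have := congrArg star (S.p_mul_e (2 * n) f)
    rw [star_mul, star_p] at this
    rw [← mul_assoc, p_mul_e, mul_assoc, this]⟩

/-- The degree of an edge: `0` if it is blue, `1` if it is red. -/
def edgeDeg {n : ℕ} : S.Edge n → ℕ
  | .inl _ => 0
  | .inr _ => 1

/-- The set attached to an edge `e` of an even layer with range `U` and source `W`: it is `W` if `e`
is blue, and the preimage of `W` under the restriction of `σ` to `U` if `e` is red. -/
def edgeSet {n : ℕ} : S.Edge n → Set X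
  | .inl e => e.1.2
  | .inr f => f.1.1 ∩ σ ⁻¹' f.1.2

end RefinedSeq

end Dynamics

/-! ## The Deaconu-Renault groupoid -/

section DR

variable {X : Type u} [MetricSpace X]

/-- The Deaconu-Renault groupoid of `σ`: all triples `(x, m - n, y)` with `σ^m x = σ^n y`. -/
def DR (σ : LHomeo X) : Type u :=
  {γ : X × ℤ × X // ∃ m n : ℕ, γ.2.1 = (m : ℤ) - n ∧ σ^[m] γ.1 = σ^[n] γ.2.2}

namespace DR

variable {σ : LHomeo X}

/-- The range `x` of `(x, k, y)`. -/
def rng (γ : DR σ) : X := γ.1.1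
/-- The degree `k` of `(x, k, y)`. -/
def deg (γ : DR σ) : ℤ := γ.1.2.1
/-- The source `y` of `(x, k, y)`. -/
def src (γ : DR σ) : X := γ.1.2.2

theorem ext' {β γ : DR σ} (h1 : rng β = rng γ) (h2 : deg β = deg γ) (h3 : src β = src γ) : β = γ :=
  Subtype.ext (Prod.ext h1 (Prod.ext h2 h3))

/-- The inverse `(y, -k, x)` of `(x, k, y)`. -/
def inv (γ : DR σ) : DR σ :=
  ⟨(src γ, -deg γ, rng γ), by
    obtain ⟨m, n, h, h'⟩ := γ.2
    refine ⟨n, m, ?_, h'.symm⟩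
    show -γ.1.2.1 = _
    rw [h]; ring⟩

/-- The product `(x, k, y) (y, l, z) = (x, k + l, z)`. -/
def mul (β α : DR σ) (hs : src β = rng α) : DR σ :=
  ⟨(rng β, deg β + deg α, src α), by
    obtain ⟨m, n, h, h'⟩ := β.2
    obtain ⟨m', n', k, k'⟩ := α.2
    refine ⟨m' + m, n + n', ?_, ?_⟩
    · show β.1.2.1 + α.1.2.1 = _
      rw [h, k]; push_cast; ring
    · show σ^[m' + m] β.1.1 = σ^[n + n'] α.1.2.2
      rw [Function.iterate_add_apply, h', Function.iterate_add_apply, ← k',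
        ← Function.iterate_add_apply, ← Function.iterate_add_apply, add_comm]
      exact congrArg _ hs⟩

variable (σ) in
/-- The set `Z(U, m, n, V)` of all `(x, m - n, y)` with `x ∈ U`, `y ∈ V` and `σ^m x = σ^n y`. -/
def cyl (U : Set X) (m n : ℕ) (V : Set X) : Set (DR σ) :=
  {γ | rng γ ∈ U ∧ src γ ∈ V ∧ deg γ = (m : ℤ) - n ∧ σ^[m] (rng γ) = σ^[n] (src γ)}

/-- The topology generated by the sets `Z(U, m, n, V)` with `U` and `V` open. -/
instance : TopologicalSpace (DR σ) :=
  TopologicalSpace.generateFrom {W | ∃ U m n V, IsOpen U ∧ IsOpen V ∧ W = cyl σ U m n V}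

theorem isOpen_cyl {U V : Set X} (hU : IsOpen U) (hV : IsOpen V) (m n : ℕ) :
    IsOpen (cyl σ U m n V) := TopologicalSpace.isOpen_generateFrom_of_mem ⟨U, m, n, V, hU, hV, rfl⟩

theorem exists_mem_cyl (γ : DR σ) : ∃ m n, γ ∈ cyl σ Set.univ m n Set.univ := by
  obtain ⟨m, n, h, h'⟩ := γ.2
  exact ⟨m, n, trivial, trivial, h, h'⟩

theorem cyl_univ_add {γ : DR σ} {m n : ℕ} (h : γ ∈ cyl σ Set.univ m n Set.univ) (k : ℕ) :
    γ ∈ cyl σ Set.univ (k + m) (k + n) Set.univ := by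
  refine ⟨trivial, trivial, ?_, ?_⟩
  · rw [h.2.2.1]; push_cast; ring
  · rw [Function.iterate_add_apply, Function.iterate_add_apply, h.2.2.2]

theorem continuous_rng : Continuous (rng : DR σ → X) := by
  rw [continuous_iff_continuousAt]
  intro γ
  obtain ⟨m, n, h⟩ := exists_mem_cyl γ
  intro U hU
  obtain ⟨U', hU', hUo, hγ⟩ := mem_nhds_iff.mp hU
  refine Filter.mem_map.mpr (Filter.mem_of_superset
    ((isOpen_cyl hUo isOpen_univ m n).mem_nhds ⟨hγ, trivial, h.2.2⟩) fun β hβ => hU' hβ.1)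

theorem continuous_src : Continuous (src : DR σ → X) := by
  rw [continuous_iff_continuousAt]
  intro γ
  obtain ⟨m, n, h⟩ := exists_mem_cyl γ
  intro U hU
  obtain ⟨U', hU', hUo, hγ⟩ := mem_nhds_iff.mp hU
  refine Filter.mem_map.mpr (Filter.mem_of_superset
    ((isOpen_cyl isOpen_univ hUo m n).mem_nhds ⟨trivial, hγ, h.2.2⟩) fun β hβ => hU' hβ.2.1)

theorem continuous_deg : Continuous (deg : DR σ → ℤ) := by
  rw [continuous_iff_continuousAt]
  intro γ
  obtain ⟨m, n, h⟩ := exists_mem_cyl γ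
  refine Filter.Tendsto.congr' (f₁ := fun _ => deg γ) ?_ tendsto_const_nhds
  filter_upwards [(isOpen_cyl isOpen_univ isOpen_univ m n).mem_nhds h] with β hβ
  rw [h.2.2.1, hβ.2.2.1]

instance : T2Space (DR σ) :=
  T2Space.of_injective_continuous (f := fun γ : DR σ => (rng γ, deg γ, src γ))
    (fun _ _ h => Subtype.ext h)
    (continuous_rng.prodMk (continuous_deg.prodMk continuous_src))

variable (σ) in
theorem isLocalHomeomorph_iterate (n : ℕ) : IsLocalHomeomorph (σ^[n]) := by
  induction n with
  | zero => exact (Homeomorph.refl X).isLocalHomeomorph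
  | succ n ih => exact ih.comp σ.isLocalHomeomorph

variable (σ) in
theorem continuous_iterate (n : ℕ) : Continuous (σ^[n]) := (isLocalHomeomorph_iterate σ n).continuous

variable (σ) in
theorem exists_injOn (n : ℕ) (x : X) : ∃ U ∈ nhds x, Set.InjOn (σ^[n]) U := by
  obtain ⟨e, hx, he⟩ := isLocalHomeomorph_iterate σ n x
  refine ⟨e.source, e.open_source.mem_nhds hx, ?_⟩
  rw [he]
  exact e.injOn

theorem tendsto_of {T : Type v} {l : Filter T} {h : T → DR σ} {γ : DR σ} {m n : ℕ}
    (hγ : γ ∈ cyl σ Set.univ m n Set.univ) (h1 : Filter.Tendsto (fun t => rng (h t)) l (nhds (rng γ)))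
    (h2 : Filter.Tendsto (fun t => src (h t)) l (nhds (src γ)))
    (h3 : ∀ᶠ t in l, h t ∈ cyl σ Set.univ m n Set.univ) : Filter.Tendsto h l (nhds γ) := by
  rw [TopologicalSpace.tendsto_nhds_generateFrom_iff]
  rintro _ ⟨U, m', n', V, hU, hV, rfl⟩ hγ'
  have e1 := h1 (hU.mem_nhds hγ'.1)
  have e2 := h2 (hV.mem_nhds hγ'.2.1)
  have hdeg : (m' : ℤ) - n' = m - n := hγ'.2.2.1.symm.trans hγ.2.2.1
  rcases le_total m m' with hle | hle
  · obtain ⟨k, rfl⟩ := Nat.exists_eq_add_of_le' hle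
    obtain rfl : n' = k + n := by push_cast at hdeg; omega
    filter_upwards [e1, e2, h3] with t t1 t2 t3
    exact ⟨t1, t2, (cyl_univ_add t3 k).2.2⟩
  · obtain ⟨k, rfl⟩ := Nat.exists_eq_add_of_le' hle
    obtain rfl : n = k + n' := by push_cast at hdeg; omega
    obtain ⟨N, hN, hinj⟩ := exists_injOn σ k (σ^[m'] (rng γ))
    have e3 := ((continuous_iterate σ m').continuousAt.tendsto.comp h1) hN
    rw [hγ'.2.2.2] at hN
    have e4 := ((continuous_iterate σ n').continuousAt.tendsto.comp h2) hN
    filter_upwards [e1, e2, h3, e3, e4] with t t1 t2 t3 t4 t5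
    refine ⟨t1, t2, ?_, hinj t4 t5 ?_⟩
    · rw [t3.2.2.1, hdeg]
    · have := t3.2.2.2
      rwa [Function.iterate_add_apply, Function.iterate_add_apply] at this

theorem exists_nhds {γ : DR σ} {m n : ℕ} (hγ : γ ∈ cyl σ Set.univ m n Set.univ) {O : Set (DR σ)}
    (hO : O ∈ nhds γ) : ∃ U ∈ nhds (rng γ), ∃ V ∈ nhds (src γ), cyl σ U m n V ⊆ O := by
  have h : Filter.Tendsto id (Filter.comap (fun β : DR σ => (rng β, src β))
      (nhds (rng γ) ×ˢ nhds (src γ)) ⊓ Filter.principal (cyl σ Set.univ m n Set.univ)) (nhds γ) := by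
    have hc : Filter.Tendsto (fun β : DR σ => (rng β, src β)) (Filter.comap (fun β : DR σ =>
      (rng β, src β)) (nhds (rng γ) ×ˢ nhds (src γ))) (nhds (rng γ) ×ˢ nhds (src γ)) :=
      Filter.tendsto_comap
    refine tendsto_of hγ ?_ ?_ ?_
    · exact (Filter.tendsto_fst.comp hc).mono_left inf_le_left
    · exact (Filter.tendsto_snd.comp hc).mono_left inf_le_left
    · exact Filter.mem_inf_of_right (Filter.mem_principal_self _)
  have h' := h hO
  rw [Filter.mem_map, Filter.mem_inf_principal, Filter.mem_comap] at h'
  obtain ⟨W, hW, hW'⟩ := h'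
  obtain ⟨U, hU, V, hV, hUV⟩ := Filter.mem_prod_iff.mp hW
  exact ⟨U, hU, V, hV, fun β hβ => hW' (hUV ⟨hβ.1, hβ.2.1⟩) ⟨trivial, trivial, hβ.2.2⟩⟩

@[simp] theorem rng_inv (γ : DR σ) : rng (inv γ) = src γ := rfl
@[simp] theorem src_inv (γ : DR σ) : src (inv γ) = rng γ := rfl
@[simp] theorem deg_inv (γ : DR σ) : deg (inv γ) = -deg γ := rfl
@[simp] theorem rng_mul (β α : DR σ) (h : src β = rng α) : rng (mul β α h) = rng β := rfl
@[simp] theorem src_mul (β α : DR σ) (h : src β = rng α) : src (mul β α h) = src α := rfl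
@[simp] theorem deg_mul (β α : DR σ) (h : src β = rng α) : deg (mul β α h) = deg β + deg α := rfl
@[simp] theorem inv_inv (γ : DR σ) : inv (inv γ) = γ := ext' rfl (neg_neg _) rfl

theorem cont_inv : Continuous (inv : DR σ → DR σ) := by
  rw [continuous_iff_continuousAt]
  intro γ
  obtain ⟨m, n, h⟩ := exists_mem_cyl γ
  have key : ∀ β ∈ cyl σ Set.univ m n Set.univ, inv β ∈ cyl σ Set.univ n m Set.univ := by
    intro β hβ
    refine ⟨trivial, trivial, ?_, hβ.2.2.2.symm⟩
    rw [deg_inv, hβ.2.2.1]; ring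
  refine tendsto_of (key γ h) continuous_src.continuousAt continuous_rng.continuousAt ?_
  filter_upwards [(isOpen_cyl isOpen_univ isOpen_univ m n).mem_nhds h] with β hβ
  exact key β hβ

theorem cont_mul :
    Continuous fun p : {p : DR σ × DR σ // src p.1 = rng p.2} => mul p.1.1 p.1.2 p.2 := by
  rw [continuous_iff_continuousAt]
  rintro ⟨⟨β, α⟩, hs⟩
  obtain ⟨m, n, h⟩ := exists_mem_cyl β
  obtain ⟨m', n', h'⟩ := exists_mem_cyl α
  have key : ∀ β' α' (hs' : src β' = rng α'), β' ∈ cyl σ Set.univ m n Set.univ →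
      α' ∈ cyl σ Set.univ m' n' Set.univ →
      mul β' α' hs' ∈ cyl σ Set.univ (m' + m) (n + n') Set.univ := by
    intro β' α' hs' k k'
    refine ⟨trivial, trivial, ?_, ?_⟩
    · rw [deg_mul, k.2.2.1, k'.2.2.1]; push_cast; ring
    · rw [Function.iterate_add_apply, rng_mul, k.2.2.2, src_mul, Function.iterate_add_apply,
        ← k'.2.2.2, hs', ← Function.iterate_add_apply, ← Function.iterate_add_apply, add_comm]
  refine tendsto_of (key β α hs h h') ?_ ?_ ?_
  · exact (continuous_rng.comp (continuous_fst.comp continuous_subtype_val)).continuousAt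
  · exact (continuous_src.comp (continuous_snd.comp continuous_subtype_val)).continuousAt
  · have c1 : ContinuousAt (fun p : {p : DR σ × DR σ // src p.1 = rng p.2} => p.1.1) ⟨(β, α), hs⟩ :=
      (continuous_fst.comp continuous_subtype_val).continuousAt
    have c2 : ContinuousAt (fun p : {p : DR σ × DR σ // src p.1 = rng p.2} => p.1.2) ⟨(β, α), hs⟩ :=
      (continuous_snd.comp continuous_subtype_val).continuousAt
    filter_upwards [c1 ((isOpen_cyl isOpen_univ isOpen_univ m n).mem_nhds h),
      c2 ((isOpen_cyl isOpen_univ isOpen_univ m' n').mem_nhds h')] with p hp hp'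
    exact key _ _ p.2 hp hp'

theorem eventually_rng {γ : DR σ} {O : Set (DR σ)} (hO : O ∈ nhds γ) :
    ∀ᶠ x in nhds (rng γ), ∃ β ∈ O, rng β = x := by
  obtain ⟨m, n, h⟩ := exists_mem_cyl γ
  obtain ⟨U, hU, V, hV, hUV⟩ := exists_nhds h hO
  obtain ⟨e, hy, he⟩ := isLocalHomeomorph_iterate σ n (src γ)
  have hm : e (src γ) = σ^[m] (rng γ) := by rw [h.2.2.2, he]
  have c1 : Filter.Tendsto (σ^[m]) (nhds (rng γ)) (nhds (e (src γ))) := by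
    rw [hm]; exact (continuous_iterate σ m).continuousAt
  have c2 := (e.tendsto_symm hy).comp c1
  filter_upwards [hU, c2 hV, c1 (e.open_target.mem_nhds (e.map_source hy))] with x hx hxV hxt
  have hx' : σ^[m] x = σ^[n] (e.symm (σ^[m] x)) := by
    rw [he]; exact (e.right_inv hxt).symm
  exact ⟨⟨(x, (m : ℤ) - n, e.symm (σ^[m] x)), m, n, rfl, hx'⟩, hUV ⟨hx, hxV, rfl, hx'⟩, rfl⟩

section compact

variable [CompactSpace X]

theorem isCompact_cyl {U V : Set X} (hU : IsClosed U) (hV : IsClosed V) (m n : ℕ) :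
    IsCompact (cyl σ U m n V) := by
  let T : Set (X × X) := {p | p.1 ∈ U ∧ p.2 ∈ V ∧ σ^[m] p.1 = σ^[n] p.2}
  have hT : IsClosed T := by
    refine (hU.preimage continuous_fst).inter ((hV.preimage continuous_snd).inter ?_)
    exact isClosed_eq ((continuous_iterate σ m).comp continuous_fst)
      ((continuous_iterate σ n).comp continuous_snd)
  have : CompactSpace T := isCompact_iff_compactSpace.mp hT.isCompact
  let h : T → DR σ := fun p => ⟨(p.1.1, (m : ℤ) - n, p.1.2), m, n, rfl, p.2.2.2⟩
  have hc : Continuous h := by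
    rw [continuous_iff_continuousAt]
    intro p
    refine tendsto_of (m := m) (n := n) ⟨trivial, trivial, rfl, p.2.2.2⟩ ?_ ?_ ?_
    · exact (continuous_fst.comp continuous_subtype_val).continuousAt
    · exact (continuous_snd.comp continuous_subtype_val).continuousAt
    · exact Filter.Eventually.of_forall fun q => ⟨trivial, trivial, rfl, q.2.2.2⟩
  convert isCompact_range hc using 1
  ext γ
  constructor
  · intro hγ
    exact ⟨⟨(rng γ, src γ), hγ.1, hγ.2.1, hγ.2.2.2⟩, ext' rfl hγ.2.2.1.symm rfl⟩
  · rintro ⟨p, rfl⟩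
    exact ⟨p.2.1, p.2.2.1, rfl, p.2.2.2⟩

/-- Compact open subsets on which the range and the source map are injective. -/
structure IsBisection (B : Set (DR σ)) : Prop where
  isCompact : IsCompact B
  isOpen : IsOpen B
  rng_inj : Set.InjOn rng B
  src_inj : Set.InjOn src B

theorem IsBisection.inter {B C : Set (DR σ)} (hB : IsBisection B) (hC : IsClopen C) :
    IsBisection (C ∩ B) where
  isCompact := hB.isCompact.inter_left hC.1
  isOpen := hC.2.inter hB.isOpen
  rng_inj := hB.rng_inj.mono Set.inter_subset_right
  src_inj := hB.src_inj.mono Set.inter_subset_right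

theorem IsBisection.inv {B : Set (DR σ)} (hB : IsBisection B) : IsBisection (DR.inv ⁻¹' B) where
  isCompact := by
    have : DR.inv ⁻¹' B = DR.inv '' B := by
      ext γ
      exact ⟨fun h => ⟨DR.inv γ, h, inv_inv γ⟩, by rintro ⟨β, h, rfl⟩; simpa using h⟩
    rw [this]
    exact hB.isCompact.image cont_inv
  isOpen := hB.isOpen.preimage cont_inv
  rng_inj := by
    intro β hβ γ hγ h
    have := hB.src_inj hβ hγ h
    rw [← inv_inv β, this, inv_inv]
  src_inj := by
    intro β hβ γ hγ h
    have := hB.rng_inj hβ hγ h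
    rw [← inv_inv β, this, inv_inv]

variable [TotallyDisconnectedSpace X]

theorem exists_bisection {γ : DR σ} {O : Set (DR σ)} (hO : O ∈ nhds γ) :
    ∃ B, IsBisection B ∧ γ ∈ B ∧ B ⊆ O := by
  obtain ⟨m, n, h⟩ := exists_mem_cyl γ
  obtain ⟨U, hU, V, hV, hUV⟩ := exists_nhds h hO
  obtain ⟨U₁, hU₁, hi⟩ := exists_injOn σ m (rng γ)
  obtain ⟨V₁, hV₁, hj⟩ := exists_injOn σ n (src γ)
  obtain ⟨U₂, hU₂, hU₂'⟩ := (nhds_basis_clopen (rng γ)).mem_iff.mp (Filter.inter_mem hU hU₁)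
  obtain ⟨V₂, hV₂, hV₂'⟩ := (nhds_basis_clopen (src γ)).mem_iff.mp (Filter.inter_mem hV hV₁)
  refine ⟨cyl σ U₂ m n V₂, ⟨isCompact_cyl hU₂.2.1 hV₂.2.1 m n, isOpen_cyl hU₂.2.2 hV₂.2.2 m n, ?_, ?_⟩,
    ⟨hU₂.1, hV₂.1, h.2.2⟩, fun β hβ => hUV ⟨(hU₂' hβ.1).1, (hV₂' hβ.2.1).1, hβ.2.2⟩⟩
  · intro α hα β hβ hr
    refine ext' hr (hα.2.2.1.trans hβ.2.2.1.symm) (hj (hV₂' hα.2.1).2 (hV₂' hβ.2.1).2 ?_)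
    rw [← hα.2.2.2, ← hβ.2.2.2, hr]
  · intro α hα β hβ hr
    refine ext' (hi (hU₂' hα.1).2 (hU₂' hβ.1).2 ?_) (hα.2.2.1.trans hβ.2.2.1.symm) hr
    rw [hα.2.2.2, hβ.2.2.2, hr]

theorem IsBisection.isClopen {B : Set (DR σ)} (hB : IsBisection B) : IsClopen B :=
  ⟨hB.isCompact.isClosed, hB.isOpen⟩

open Classical in
theorem induction_bisection {P : (DR σ → ℂ) → Prop} (h0 : P 0)
    (hadd : ∀ f g, IsLocallyConstant f → HasCompactSupport f → IsLocallyConstant g →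
      HasCompactSupport g → P f → P g → P (f + g))
    (hB : ∀ (c : ℂ) (B : Set (DR σ)), IsBisection B → P (B.indicator fun _ => c))
    (f : DR σ → ℂ) (hf : IsLocallyConstant f) (hf' : HasCompactSupport f) : P f := by
  have lc_ind : ∀ C : Set (DR σ), IsClopen C → IsLocallyConstant (C.indicator f) := by
    intro C hC
    rw [IsLocallyConstant.iff_eventually_eq]
    intro γ
    by_cases hγ : γ ∈ C
    · filter_upwards [hC.2.mem_nhds hγ, hf.eventually_eq γ] with β hβ hβ'
      rw [Set.indicator_of_mem hβ, Set.indicator_of_mem hγ, hβ']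
    · filter_upwards [hC.compl.2.mem_nhds hγ] with β hβ
      rw [Set.indicator_of_notMem hβ, Set.indicator_of_notMem hγ]
  have cs_ind : ∀ C : Set (DR σ), HasCompactSupport (C.indicator f) := by
    intro C
    refine HasCompactSupport.intro hf' fun γ hγ => ?_
    have : f γ = 0 := image_eq_zero_of_notMem_tsupport hγ
    by_cases h : γ ∈ C
    · rw [Set.indicator_of_mem h, this]
    · rw [Set.indicator_of_notMem h]
  choose B hBis hBγ hBf using fun γ : DR σ => exists_bisection (hf.eventually_eq γ)
  obtain ⟨T, hT⟩ := IsCompact.elim_finite_subcover (s := tsupport f) hf' B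
    (fun γ => (hBis γ).isOpen) (fun γ _ => Set.mem_iUnion.mpr ⟨γ, hBγ γ⟩)
  have key : ∀ (T : Finset (DR σ)) (C : Set (DR σ)), IsClopen C → C ⊆ ⋃ γ ∈ T, B γ →
      P (C.indicator f) := by
    intro T
    induction T using Finset.induction_on with
    | empty =>
      intro C hC hCT
      have : C = ∅ := by simpa using hCT
      rw [this, Set.indicator_empty]
      exact h0
    | insert γ T hγ ih =>
      intro C hC hCT
      have hsplit : C.indicator f = (C ∩ B γ).indicator f + (C \ B γ).indicator f := by
        funext β
        rw [Pi.add_apply]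
        by_cases h1 : β ∈ C <;> by_cases h2 : β ∈ B γ <;> simp [Set.indicator, h1, h2]
      have c1 : IsClopen (C ∩ B γ) := hC.inter (hBis γ).isClopen
      have c2 : IsClopen (C \ B γ) := hC.diff (hBis γ).isClopen
      rw [hsplit]
      refine hadd _ _ (lc_ind _ c1) (cs_ind _) (lc_ind _ c2) (cs_ind _) ?_ (ih _ c2 ?_)
      · have : (C ∩ B γ).indicator f = (C ∩ B γ).indicator fun _ => f γ := by
          funext β
          by_cases h1 : β ∈ C ∩ B γ
          · rw [Set.indicator_of_mem h1, Set.indicator_of_mem h1]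
            exact hBf γ h1.2
          · rw [Set.indicator_of_notMem h1, Set.indicator_of_notMem h1]
        rw [this]
        exact hB _ _ ((hBis γ).inter hC)
      · intro β hβ
        have := hCT hβ.1
        rw [Finset.set_biUnion_insert] at this
        exact this.resolve_left hβ.2
  have hsupp : IsClopen (Function.support f) := by
    have := hf.isClopen_fiber 0
    have h' : Function.support f = {x | f x = 0}ᶜ := rfl
    rw [h']
    exact this.compl
  have := key T _ hsupp ((subset_tsupport f).trans hT)
  rwa [Set.indicator_support] at this

theorem finite_fiber {f : DR σ → ℂ} (hf : IsLocallyConstant f) (hf' : HasCompactSupport f) (y : X) :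
    {α : DR σ | src α = y ∧ f α ≠ 0}.Finite := by
  refine induction_bisection (P := fun f => {α : DR σ | src α = y ∧ f α ≠ 0}.Finite) ?_ ?_ ?_ f hf hf'
  · simp
  · intro f g _ _ _ _ h1 h2
    refine (h1.union h2).subset ?_
    rintro α ⟨h, h'⟩
    by_cases hfα : f α = 0
    · right
      refine ⟨h, fun hg => h' ?_⟩
      rw [Pi.add_apply, hfα, hg, add_zero]
    · exact .inl ⟨h, hfα⟩
  · intro c B hB
    refine Set.Subsingleton.finite ?_
    rintro α ⟨h, h'⟩ β ⟨k, k'⟩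
    exact hB.src_inj (Set.mem_of_indicator_ne_zero h') (Set.mem_of_indicator_ne_zero k')
      (h.trans k.symm)

end compact

end DR

/-! ## The Steinberg algebra -/

section Steinberg

open DR

/-- The convolution product: `(f * g)(γ) = ∑ f(γ α⁻¹) g(α)`, the sum over all `α` with the same
source as `γ`. -/
def conv {σ : LHomeo X} (f g : DR σ → ℂ) (γ : DR σ) : ℂ :=
  ∑ᶠ α : {α : DR σ // src α = src γ}, f (mul γ (inv α.1) α.2.symm) * g α.1

variable (σ : LHomeo X)

/-- The space of locally constant functions with compact support on the Deaconu-Renault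
groupoid. -/
def steinbergSpace : Submodule ℂ (DR σ → ℂ) where
  carrier := {f | IsLocallyConstant f ∧ HasCompactSupport f}
  add_mem' {f g} h h' := ⟨IsLocallyConstant.add h.1 h'.1, HasCompactSupport.add h.2 h'.2⟩
  zero_mem' := ⟨IsLocallyConstant.const 0, HasCompactSupport.zero⟩
  smul_mem' c f h := ⟨IsLocallyConstant.comp h.1 (fun z : ℂ => c • z),
    HasCompactSupport.comp_left (g := fun z : ℂ => c • z) h.2 (smul_zero c)⟩

/-- The Steinberg algebra with complex coefficients of the Deaconu-Renault groupoid: locally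
constant functions with compact support, with the convolution product and the involution
`f*(γ) = conj f(γ⁻¹)`. -/
def Steinberg : Type u := steinbergSpace σ

variable {σ}

namespace Steinberg

instance : AddCommGroup (Steinberg σ) := inferInstanceAs (AddCommGroup (steinbergSpace σ))
instance : Module ℂ (Steinberg σ) := inferInstanceAs (Module ℂ (steinbergSpace σ))
instance : CoeFun (Steinberg σ) (fun _ => DR σ → ℂ) := ⟨fun f => f.1⟩

theorem ext {f g : Steinberg σ} (h : ∀ γ, f γ = g γ) : f = g := Subtype.ext (funext h)
theorem add_apply (f g : Steinberg σ) (γ : DR σ) : (f + g) γ = f γ + g γ := rfl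
theorem smul_apply (c : ℂ) (f : Steinberg σ) (γ : DR σ) : (c • f) γ = c * f γ := rfl
theorem zero_apply (γ : DR σ) : (0 : Steinberg σ) γ = 0 := rfl

variable [CompactSpace X] [TotallyDisconnectedSpace X]

theorem finite_support {f g : DR σ → ℂ} (hg : IsLocallyConstant g) (hg' : HasCompactSupport g)
    (γ : DR σ) : (Function.support fun α : {α : DR σ // src α = src γ} =>
      f (mul γ (inv α.1) α.2.symm) * g α.1).Finite := by
  refine Set.Finite.of_finite_image ((finite_fiber hg hg' (src γ)).subset ?_)
    Subtype.val_injective.injOn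
  rintro _ ⟨α, hα, rfl⟩
  exact ⟨α.2, right_ne_zero_of_mul hα⟩

theorem conv_add_left (f f' : DR σ → ℂ) {g : DR σ → ℂ} (hg : IsLocallyConstant g)
    (hg' : HasCompactSupport g) : conv (f + f') g = conv f g + conv f' g := by
  funext γ
  rw [Pi.add_apply, conv, conv, conv,
    ← finsum_add_distrib (finite_support hg hg' γ) (finite_support hg hg' γ)]
  exact finsum_congr fun α => add_mul _ _ _

theorem conv_add_right (f : DR σ → ℂ) {g g' : DR σ → ℂ} (hg : IsLocallyConstant g)
    (hg' : HasCompactSupport g) (hh : IsLocallyConstant g') (hh' : HasCompactSupport g') :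
    conv f (g + g') = conv f g + conv f g' := by
  funext γ
  rw [Pi.add_apply, conv, conv, conv,
    ← finsum_add_distrib (finite_support hg hg' γ) (finite_support hh hh' γ)]
  exact finsum_congr fun α => mul_add _ _ _

theorem conv_smul_left (c : ℂ) (f g : DR σ → ℂ) : conv (c • f) g = c • conv f g := by
  funext γ
  rw [Pi.smul_apply, conv, conv, smul_finsum]
  exact finsum_congr fun α => smul_mul_assoc c _ _

theorem conv_smul_right (c : ℂ) (f g : DR σ → ℂ) : conv f (c • g) = c • conv f g := by
  funext γ
  rw [Pi.smul_apply, conv, conv, smul_finsum]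
  exact finsum_congr fun α => mul_smul_comm c _ _

theorem conv_zero_left (g : DR σ → ℂ) : conv 0 g = 0 := by
  funext γ
  simp [conv]

/-- Convolution with the indicator function of a bisection: the main case. -/
theorem conv_indicator {B : Set (DR σ)} (hB : IsBisection B) (c : ℂ) (g : DR σ → ℂ) (γ β : DR σ)
    (hβ : β ∈ B) (h : rng β = rng γ) :
    conv (B.indicator fun _ => c) g γ = c * g (mul (inv β) γ h) := by
  rw [conv, finsum_eq_single _ ⟨mul (inv β) γ h, rfl⟩]
  · have : mul γ (inv (mul (inv β) γ h)) rfl = β := by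
      refine ext' h.symm ?_ rfl
      show deg γ + -(-deg β + deg γ) = deg β
      ring
    show B.indicator _ (mul γ (inv (mul (inv β) γ h)) _) * _ = _
    rw [this, Set.indicator_of_mem hβ]
  · rintro ⟨α, hα⟩ hne
    rw [Set.indicator_of_notMem, zero_mul]
    intro hmem
    apply hne
    have := hB.rng_inj hmem hβ h.symm
    apply Subtype.ext
    show α = mul (inv β) γ h
    subst this
    refine ext' rfl ?_ hα
    show deg α = -(deg γ + -deg α) + deg γ
    ring

theorem conv_indicator_of_not {B : Set (DR σ)} (c : ℂ) (g : DR σ → ℂ) (γ : DR σ)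
    (h : ∀ β ∈ B, rng β ≠ rng γ) : conv (B.indicator fun _ => c) g γ = 0 := by
  rw [conv]
  refine (finsum_congr fun α => ?_).trans finsum_zero
  have hz : B.indicator (fun _ => c) (mul γ (inv α.1) α.2.symm) = 0 :=
    Set.indicator_of_notMem (fun hm => h (mul γ (inv α.1) α.2.symm) hm rfl) _
  rw [hz, zero_mul]

theorem conv_mem {f g : DR σ → ℂ} (hf : IsLocallyConstant f) (hf' : HasCompactSupport f)
    (hg : IsLocallyConstant g) (hg' : HasCompactSupport g) :
    IsLocallyConstant (conv f g) ∧ HasCompactSupport (conv f g) := by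
  refine induction_bisection
    (P := fun f => IsLocallyConstant (conv f g) ∧ HasCompactSupport (conv f g)) ?_ ?_ ?_ f hf hf'
  · rw [conv_zero_left]
    exact ⟨IsLocallyConstant.const 0, HasCompactSupport.zero⟩
  · intro f f' _ _ _ _ h h'
    rw [conv_add_left f f' hg hg']
    exact ⟨h.1.add h'.1, h.2.add h'.2⟩
  · intro c B hB
    constructor
    · rw [IsLocallyConstant.iff_eventually_eq]
      intro γ
      by_cases hγ : ∃ β ∈ B, rng β = rng γ
      · obtain ⟨β, hβ, hr⟩ := hγ
        let h : {p : DR σ × DR σ // rng p.1 = rng p.2} → ℂ := fun p => g (mul (inv p.1.1) p.1.2 p.2)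
        have hc : Continuous fun p : {p : DR σ × DR σ // rng p.1 = rng p.2} =>
            mul (inv p.1.1) p.1.2 p.2 :=
          cont_mul.comp (f := fun p : {p : DR σ × DR σ // rng p.1 = rng p.2} =>
            (⟨(inv p.1.1, p.1.2), p.2⟩ : {p : DR σ × DR σ // src p.1 = rng p.2}))
            (((cont_inv.comp (continuous_fst.comp continuous_subtype_val)).prodMk
              (continuous_snd.comp continuous_subtype_val)).subtype_mk _)
        have hlc : IsLocallyConstant h := hg.comp_continuous hc
        have hev := hlc.eventually_eq ⟨(β, γ), hr⟩
        rw [nhds_subtype_eq_comap, Filter.eventually_comap, nhds_prod_eq,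
          Filter.eventually_prod_iff] at hev
        obtain ⟨p, hp, q, hq, hpq⟩ := hev
        have e1 := continuous_rng.continuousAt.tendsto.eventually
          (hr ▸ eventually_rng (hp.and (hB.isOpen.mem_nhds hβ)) :
            ∀ᶠ x in nhds (rng γ), ∃ β' ∈ {β' | p β' ∧ β' ∈ B}, rng β' = x)
        filter_upwards [e1, hq] with γ' ⟨β', ⟨hpβ, hβB⟩, hr'⟩ hq'
        rw [conv_indicator hB c g γ' β' hβB hr', conv_indicator hB c g γ β hβ hr]
        have := hpq hpβ hq' ⟨(β', γ'), hr'⟩ rfl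
        exact congrArg (c * ·) this
      · push Not at hγ
        have hcl : IsClosed (rng '' B) := (hB.isCompact.image continuous_rng).isClosed
        have hn : rng γ ∈ (rng '' B)ᶜ := by
          rintro ⟨β, hβ, h⟩
          exact hγ β hβ h
        filter_upwards [continuous_rng.continuousAt (hcl.isOpen_compl.mem_nhds hn)] with γ' hγ'
        rw [conv_indicator_of_not c g γ hγ, conv_indicator_of_not c g γ']
        intro β hβ h
        exact hγ' ⟨β, hβ, h⟩
    · let T : Set {p : DR σ × DR σ // src p.1 = rng p.2} := {p | p.1.1 ∈ B ∧ p.1.2 ∈ tsupport g}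
      have hT : IsCompact T := by
        have hcl : IsClosed {p : DR σ × DR σ | src p.1 = rng p.2} :=
          isClosed_eq (continuous_src.comp continuous_fst) (continuous_rng.comp continuous_snd)
        have := hcl.isClosedEmbedding_subtypeVal.isCompact_preimage
          (hB.isCompact.prod (show IsCompact (tsupport g) from hg'))
        exact this
      refine HasCompactSupport.intro (hT.image cont_mul) fun γ hγ => ?_
      by_contra hne
      apply hγ
      by_cases hex : ∃ β ∈ B, rng β = rng γ
      · obtain ⟨β, hβ, hr⟩ := hex
        rw [conv_indicator hB c g γ β hβ hr] at hne
        have hg0 := right_ne_zero_of_mul hne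
        refine ⟨⟨(β, mul (inv β) γ hr), rfl⟩, ⟨hβ, subset_tsupport g hg0⟩, ?_⟩
        refine ext' hr ?_ rfl
        show deg β + (-deg β + deg γ) = deg γ
        ring
      · push Not at hex
        exact absurd (conv_indicator_of_not c g γ hex) hne

theorem conv_assoc {f g h : DR σ → ℂ} (hf : IsLocallyConstant f) (hf' : HasCompactSupport f)
    (hg : IsLocallyConstant g) (hg' : HasCompactSupport g) (hh : IsLocallyConstant h)
    (hh' : HasCompactSupport h) : conv (conv f g) h = conv f (conv g h) := by
  have hgh := conv_mem hg hg' hh hh'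
  refine induction_bisection
    (P := fun f => conv (conv f g) h = conv f (conv g h)) ?_ ?_ ?_ f hf hf'
  · simp only [conv_zero_left]
  · intro f f' _ _ _ _ k k'
    rw [conv_add_left f f' hg hg', conv_add_left _ _ hh hh', conv_add_left f f' hgh.1 hgh.2, k, k']
  · intro c B hB
    funext γ
    by_cases hex : ∃ β ∈ B, rng β = rng γ
    · obtain ⟨β, hβ, hr⟩ := hex
      rw [conv_indicator hB c _ γ β hβ hr, conv, conv, ← smul_eq_mul, smul_finsum]
      refine finsum_congr fun α => ?_
      have hz : conv (B.indicator fun _ => c) g (mul γ (inv α.1) α.2.symm) =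
          c * g (mul (inv β) (mul γ (inv α.1) α.2.symm) hr) :=
        conv_indicator hB c g (mul γ (inv α.1) α.2.symm) β hβ hr
      have he : mul (inv β) (mul γ (inv α.1) α.2.symm) hr =
          mul (mul (inv β) γ hr) (inv α.1) α.2.symm := ext' rfl (add_assoc _ _ _).symm rfl
      rw [hz, smul_eq_mul, mul_assoc, he]
    · push Not at hex
      rw [conv_indicator_of_not c _ γ hex, conv]
      refine (finsum_congr fun α => ?_).trans finsum_zero
      have hz : conv (B.indicator fun _ => c) g (mul γ (inv α.1) α.2.symm) = 0 :=
        conv_indicator_of_not c g (mul γ (inv α.1) α.2.symm) hex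
      rw [hz, zero_mul]

instance : Mul (Steinberg σ) :=
  ⟨fun f g => ⟨conv f.1 g.1, conv_mem f.2.1 f.2.2 g.2.1 g.2.2⟩⟩

theorem mul_apply (f g : Steinberg σ) (γ : DR σ) : (f * g) γ = conv f g γ := rfl

instance : NonUnitalRing (Steinberg σ) where
  left_distrib f g h := Subtype.ext (conv_add_right f.1 g.2.1 g.2.2 h.2.1 h.2.2)
  right_distrib f g h := Subtype.ext (conv_add_left f.1 g.1 h.2.1 h.2.2)
  zero_mul f := Subtype.ext (conv_zero_left f.1)
  mul_zero f := Subtype.ext (by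
    funext γ
    show conv f.1 0 γ = 0
    simp [conv])
  mul_assoc f g h := Subtype.ext (conv_assoc f.2.1 f.2.2 g.2.1 g.2.2 h.2.1 h.2.2)

instance : IsScalarTower ℂ (Steinberg σ) (Steinberg σ) where
  smul_assoc c f g := Subtype.ext (conv_smul_left c f.1 g.1)

instance : SMulCommClass ℂ (Steinberg σ) (Steinberg σ) where
  smul_comm c f g := Subtype.ext (conv_smul_right c f.1 g.1).symm

instance : Star (Steinberg σ) :=
  ⟨fun f => ⟨fun γ => star (f.1 (inv γ)),
    (f.2.1.comp_continuous cont_inv).comp star,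
    by
      have h1 : HasCompactSupport fun γ => f.1 (inv γ) :=
        f.2.2.comp_homeomorph ⟨⟨inv, inv, inv_inv, inv_inv⟩, cont_inv, cont_inv⟩
      exact h1.comp_left (star_zero ℂ)⟩⟩

theorem star_apply (f : Steinberg σ) (γ : DR σ) : (star f) γ = star (f (inv γ)) := rfl

/-- Right translation between the sets of elements with given source. -/
def translate (γ : DR σ) : {α : DR σ // src α = src γ} ≃ {α : DR σ // src α = src (inv γ)} where
  toFun α := ⟨mul α.1 (inv γ) α.2, rfl⟩
  invFun α := ⟨mul α.1 γ α.2, rfl⟩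
  left_inv α := Subtype.ext <| ext' rfl
    (show deg α.1 + -deg γ + deg γ = deg α.1 by ring) α.2.symm
  right_inv α := Subtype.ext <| ext' rfl
    (show deg α.1 + deg γ + -deg γ = deg α.1 by ring) α.2.symm

instance : StarRing (Steinberg σ) where
  star_involutive f := ext fun γ => by rw [star_apply, star_apply, star_star, DR.inv_inv]
  star_add f g := ext fun γ => by
    rw [add_apply, star_apply, star_apply, star_apply, add_apply, star_add]
  star_mul f g := ext fun γ => by
    rw [star_apply, mul_apply, mul_apply, conv, conv]
    have h := AddEquiv.map_finsum (starAddEquiv : ℂ ≃+ ℂ)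
      (fun α : {α : DR σ // src α = src (inv γ)} => f.1 (mul (inv γ) (inv α.1) α.2.symm) * g.1 α.1)
    refine h.trans ?_
    rw [← finsum_comp_equiv (translate γ)]
    refine finsum_congr fun α => ?_
    have he1 : (translate γ α).1 = inv (mul γ (inv α.1) α.2.symm) := ext' rfl
      (show deg α.1 + -deg γ = -(deg γ + -deg α.1) by ring) rfl
    have he2 : mul (inv γ) (inv (translate γ α).1) (translate γ α).2.symm = inv α.1 := ext' α.2.symm
      (show -deg γ + -(deg α.1 + -deg γ) = -deg α.1 by ring) rfl
    refine (star_mul _ _).trans ?_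
    exact congrArg₂ (fun x y => star (g.1 x) * star (f.1 y)) he1 he2

instance : StarModule ℂ (Steinberg σ) where
  star_smul c f := ext fun γ => by
    rw [star_apply, smul_apply, smul_apply, star_apply, star_mul']

theorem indicator_mem {B : Set (DR σ)} (hB : IsBisection B) (c : ℂ) :
    (B.indicator fun _ => c) ∈ steinbergSpace σ := by
  constructor
  · rw [IsLocallyConstant.iff_eventually_eq]
    intro γ
    by_cases hγ : γ ∈ B
    · filter_upwards [hB.isOpen.mem_nhds hγ] with β hβ
      rw [Set.indicator_of_mem hβ, Set.indicator_of_mem hγ]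
    · filter_upwards [hB.isClopen.compl.2.mem_nhds hγ] with β hβ
      rw [Set.indicator_of_notMem hβ, Set.indicator_of_notMem hγ]
  · exact HasCompactSupport.intro hB.isCompact fun γ hγ => Set.indicator_of_notMem hγ _

theorem mul_star_mul_indicator {B : Set (DR σ)} (hB : IsBisection B) (a : Steinberg σ)
    (ha : a.1 = B.indicator fun _ => (1 : ℂ)) : a * (star a * a) = a := by
  have hs : (star a).1 = (DR.inv ⁻¹' B).indicator fun _ => (1 : ℂ) := by
    funext γ
    show star (a.1 (inv γ)) = _
    rw [ha]
    by_cases h : inv γ ∈ B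
    · rw [Set.indicator_of_mem h, Set.indicator_of_mem (show γ ∈ DR.inv ⁻¹' B from h), star_one]
    · rw [Set.indicator_of_notMem h, Set.indicator_of_notMem (show γ ∉ DR.inv ⁻¹' B from h),
        star_zero]
  refine ext fun γ => ?_
  show conv a.1 (conv (star a).1 a.1) γ = a.1 γ
  rw [hs]
  by_cases hex : ∃ β ∈ B, rng β = rng γ
  · obtain ⟨β, hβ, hr⟩ := hex
    conv_lhs => rw [ha]
    have hz : conv ((DR.inv ⁻¹' B).indicator fun _ => (1 : ℂ)) (B.indicator fun _ => 1)
        (mul (inv β) γ hr) = 1 * B.indicator (fun _ => 1) (mul (inv (inv β)) (mul (inv β) γ hr) rfl) :=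
      conv_indicator hB.inv 1 _ (mul (inv β) γ hr) (inv β) (by simpa using hβ) rfl
    rw [conv_indicator hB 1 _ γ β hβ hr, hz, one_mul, one_mul]
    have : mul (inv (inv β)) (mul (inv β) γ hr) rfl = γ := by
      refine ext' hr ?_ rfl
      show - -deg β + (-deg β + deg γ) = deg γ
      ring
    rw [this, ha]
  · push Not at hex
    conv_lhs => rw [ha]
    rw [conv_indicator_of_not 1 _ γ hex, ha, Set.indicator_of_notMem]
    exact fun h => hex γ h rfl

instance : CStarBounded (Steinberg σ) where
  bdd a := by
    refine induction_bisection (P := fun f => ∀ a : Steinberg σ, a.1 = f →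
      ∃ C : ℝ, ∀ p : Seminorm ℂ (Steinberg σ), IsCStarSeminorm p → p a ≤ C) ?_ ?_ ?_
      a.1 a.2.1 a.2.2 a rfl
    · intro a ha
      obtain rfl : a = 0 := Subtype.ext ha
      exact ⟨0, fun p hp => (map_zero p).le⟩
    · intro f g hf hf' hg hg' h h' a ha
      obtain ⟨C, hC⟩ := h ⟨f, hf, hf'⟩ rfl
      obtain ⟨D, hD⟩ := h' ⟨g, hg, hg'⟩ rfl
      let x : Steinberg σ := ⟨f, hf, hf'⟩
      let y : Steinberg σ := ⟨g, hg, hg'⟩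
      obtain rfl : a = x + y := Subtype.ext ha
      exact ⟨C + D, fun p hp => (map_add_le_add p _ _).trans (add_le_add (hC p hp) (hD p hp))⟩
    · intro c B hB a ha
      let b : Steinberg σ := ⟨B.indicator fun _ => 1, indicator_mem hB 1⟩
      obtain rfl : a = c • b := by
        refine ext fun γ => ?_
        rw [smul_apply]
        show a.1 γ = c * B.indicator (fun _ => 1) γ
        rw [ha]
        by_cases h : γ ∈ B <;> simp [Set.indicator, h]
      refine ⟨‖c‖ * 1, fun p hp => ?_⟩
      rw [map_smul_eq_mul]
      refine mul_le_mul_of_nonneg_left ?_ (norm_nonneg c)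
      have h1 : star b * b * (star b * b) = star b * b := by
        rw [mul_assoc, mul_star_mul_indicator hB b rfl]
      have h2 := hp.star_mul_self (star b * b)
      rw [star_mul, star_star, h1, hp.star_mul_self] at h2
      have h0 : 0 ≤ p b := apply_nonneg p b
      by_contra hc
      push Not at hc
      have ht : 1 < p b ^ 2 := one_lt_pow₀ hc two_ne_zero
      have : p b ^ 2 * 1 < p b ^ 2 * p b ^ 2 := mul_lt_mul_of_pos_left ht (by linarith)
      rw [mul_one, ← pow_two] at this
      exact this.ne h2

end Steinberg

/-- The full `C*`-algebra of the Deaconu-Renault groupoid: the enveloping `C*`-algebra of its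
Steinberg algebra. -/
abbrev GroupoidCStar [CompactSpace X] [TotallyDisconnectedSpace X] (σ : LHomeo X) : Type u :=
  Env (Steinberg σ)

end Steinberg

end DR

namespace RefinedSeq

variable {X : Type u} [MetricSpace X] [CompactSpace X] [TotallyDisconnectedSpace X] {σ : LHomeo X}

/-- The prescribed values, on the standard generators of the corners, of the `*`-isomorphism from
the algebraic colimit of the corners onto the Steinberg algebra: a vertex `U` is mapped to the
characteristic function of `Z(U, 0, 0, U)`, which is identified with `U`, and `e f*`, for edges `e`
and `f` with the same source, is mapped to the characteristic function of the set `Z(Y, k, l, Y')`,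
where `Y`, `Y'` and `k`, `l` are the sets and the degrees attached to `e` and `f`. -/
structure HasStandardValues (S : RefinedSeq σ) (φ : S.AInf ≃⋆ₐ[ℂ] Steinberg σ) : Prop where
  vertex : ∀ (n : ℕ) (U : S.P (2 * n)), (φ (SeqLim.of S.φA n (S.vertexElt n U)) : DR σ → ℂ) =
    (DR.cyl σ U 0 0 U).indicator fun _ => 1
  edge : ∀ (n : ℕ) (e f : S.Edge (2 * n)), (S.layer (2 * n)).s e = (S.layer (2 * n)).s f →
    (φ (SeqLim.of S.φA n (S.edgeElt n e f)) : DR σ → ℂ) =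
      (DR.cyl σ (S.edgeSet e) (S.edgeDeg e) (S.edgeDeg f) (S.edgeSet f)).indicator fun _ => 1

end RefinedSeq

end DRAlg

end

noncomputable section

namespace DRAlg

universe u v w

set_option linter.unusedSectionVars false
set_option linter.unusedVariables false

/-! ### Clopen measures and covariant representations of the dynamical system. -/

section CovRep

variable {X : Type u} [MetricSpace X] [CompactSpace X] {σ : LHomeo X}

/-! The colimit and the Steinberg algebra carry the same kind of data. In the Steinberg algebra let
M(U) be the characteristic function of the units over a clopen set U, and let t be that of the graph
of σ, the set of all (x, 1, σ x). Then M is a finitely additive projection-valued measure and t M(U)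
= M(σ⁻¹ U) t. For Z in P_0, where σ is injective, M(Z) t t* M(Z) = M(Z) and t* M(Z) t = M(σ Z). Such
a pair (M, t) in a *-algebra A is a `CovRep`.

A covariant representation in A represents every layer in the 2 × 2 matrices over A. Range vertices
and source vertices go to different diagonal corners, because they are orthogonal in L_n although
the sets overlap. Edges become off-diagonal: M(W) for a blue edge from W to Z, and M(Z) t M(W) or
M(Z) t* M(W) for a red one, according to the parity of n. The Leavitt relations then express that
the sources of the edges in one member of the separation tile the expected clopen set
(`layerGen_rel`). The two corners change places from one layer to the next, which absorbs the
adjoints in the connecting maps (`layerHom_connect`). Passing to the upper left corner of the even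
layers gives `infHom` from the colimit to A; for A the Steinberg algebra this is the map φ of the
theorem.

Conversely the colimit has its own covariant representation `infRep`. Its t is the class of (sum of
all red edges)(sum of all blue edges)*. This class is the same in all even layers, since two
connecting maps carry each of these sums to the sum of the same colour. A vertex of a source
partition enters the measure after conjugation by the sum of the blue edges, and the covariance
relation for t comes from the red edges of the odd layers.

Put E(U, m, n, V) = M(U) t^m t*^n M(V). These elements span the colimit (`spanE_infRep`). In the
Steinberg algebra they are the characteristic functions of the sets Z(U, m, n, V), and they span
there too (`spanE_steinbergRep`). As `infHom` matches the two families, φ is onto. For injectivity,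
the identity M(X) = ∑ M(Z) t t* M(Z), the sum over Z in P_0, raises m and n simultaneously
(`E_raise`). Hence every element is a combination of E(Y, m, n, Y') with one common value of min(m,
n) and with Y, Y' in one common partition. The corresponding sets in the groupoid are pairwise
disjoint, so evaluation at a point recovers each coefficient whose set is nonempty; when the set is
empty, E itself vanishes (`E_eq_zero`). Uniqueness of φ holds because the prescribed values
determine the images of M and t.

For the C*-algebras, the same matrix construction applied to the image of (M, t) in C*(G) extends,
by the universal property of enveloping C*-algebras, to a map from the C*-colimit to C*(G). The
inverse of φ induces a map in the other direction. The two are inverse to each other on dense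
images, hence everywhere. -/

theorem LHomeo.continuous (σ : LHomeo X) : Continuous σ := σ.isLocalHomeomorph.continuous

theorem isClopen_preimage (σ : LHomeo X) {U : Set X} (hU : IsClopen U) : IsClopen (σ ⁻¹' U) :=
  hU.preimage σ.continuous

theorem isClopen_image (σ : LHomeo X) {U : Set X} (hU : IsClopen U) : IsClopen (σ '' U) :=
  ⟨(hU.1.isCompact.image σ.continuous).isClosed, σ.isLocalHomeomorph.isOpenMap U hU.2⟩

theorem isClopen_iterate (σ : LHomeo X) {U : Set X} (hU : IsClopen U) (m : ℕ) :
    IsClopen (σ^[m] ⁻¹' U) := hU.preimage (σ.continuous.iterate m)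

theorem RefinedSeq.isClopen (S : RefinedSeq σ) {n : ℕ} {Z : Set X} (hZ : Z ∈ S.P n) : IsClopen Z :=
  (S.part n).isClopen Z hZ

theorem RefinedSeq.exists_zero_superset (S : RefinedSeq σ) {n : ℕ} {Z : Set X} (hZ : Z ∈ S.P n) :
    ∃ Y ∈ S.P 0, Z ⊆ Y := by
  induction n generalizing Z with
  | zero => exact ⟨Z, hZ, le_rfl⟩
  | succ n ih =>
    obtain ⟨W, hW, h⟩ := S.finer n Z hZ
    obtain ⟨Y, hY, h'⟩ := ih hW
    exact ⟨Y, hY, h.trans h'⟩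

/-- Finitely additive projection-valued measures on the clopen subsets of `X`. -/
structure ClopenMeasure (X : Type u) [TopologicalSpace X] (A : Type v) [NonUnitalRing A]
    [StarRing A] where
  M : Set X → A
  M_mul : ∀ {U V : Set X}, IsClopen U → IsClopen V → M U * M V = M (U ∩ V)
  star_M : ∀ {U : Set X}, IsClopen U → star (M U) = M U
  M_union : ∀ {U V : Set X}, IsClopen U → IsClopen V → Disjoint U V → M (U ∪ V) = M U + M V

/-- Covariant representations of `(X, σ)`: a finitely additive projection-valued measure on the
clopen subsets of `X`, and an element `t` which implements `σ` and its transfer operator. -/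
structure CovRep (S : RefinedSeq σ) (A : Type v) [NonUnitalRing A] [StarRing A] extends
    ClopenMeasure X A where
  t : A
  M_univ_mul_t : M Set.univ * t = t
  t_mul : ∀ {U : Set X}, IsClopen U → t * M U = M (σ ⁻¹' U) * t
  range_part : ∀ Z ∈ S.P 0, M Z * t * star t * M Z = M Z
  transfer_part : ∀ Z ∈ S.P 0, star t * M Z * t = M (σ '' Z)

namespace RefinedSeq

variable {S : RefinedSeq σ}

theorem isClopen_fst {n : ℕ} (e : S.Edge n) : IsClopen ((S.ends e).1 : Set X) :=
  S.isClopen (S.ends e).1.2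

theorem isClopen_snd {n : ℕ} (e : S.Edge n) : IsClopen ((S.ends e).2 : Set X) :=
  S.isClopen (S.ends e).2.2

/-- Edges in one member of a separation share their colour and their range, so each is determined by
its source; and distinct sources are disjoint. -/
theorem eq_of_source_mem {n : ℕ} {Z : S.P n} {Y : Set (S.Edge n)} (hY : Y ∈ S.sep n Z)
    {e f : S.Edge n} (he : e ∈ Y) (hf : f ∈ Y) {x : X} (hx : x ∈ ((S.ends e).2 : Set X))
    (hx' : x ∈ ((S.ends f).2 : Set X)) : e = f := by
  obtain ⟨hcol, h1, h2⟩ := S.sep_color hY he hf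
  exact S.sum_isLeft_eq hcol (Prod.ext (h1.trans h2.symm)
    (Subtype.ext (S.eq_of_mem (S.ends e).2.2 (S.ends f).2.2 hx hx')))

theorem source_disjoint {n : ℕ} {Z : S.P n} {Y : Set (S.Edge n)} (hY : Y ∈ S.sep n Z)
    {e f : S.Edge n} (he : e ∈ Y) (hf : f ∈ Y) (hne : e ≠ f) :
    Disjoint ((S.ends e).2 : Set X) ((S.ends f).2 : Set X) :=
  Set.disjoint_left.mpr fun _ hx hx' => hne (RefinedSeq.eq_of_source_mem hY he hf hx hx')

end RefinedSeq

namespace ClopenMeasure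

variable {A : Type v} [NonUnitalRing A] [StarRing A] (c : ClopenMeasure X A) {S : RefinedSeq σ}

theorem M_empty : c.M ∅ = 0 := by
  have := c.M_union isClopen_empty isClopen_empty (disjoint_bot_left (a := (∅ : Set X)))
  rw [Set.union_self] at this
  exact left_eq_add.mp this

theorem M_biUnion {ι : Type*} (s : Finset ι) (B : ι → Set X) (hB : ∀ i ∈ s, IsClopen (B i))
    (hd : ∀ i ∈ s, ∀ j ∈ s, i ≠ j → Disjoint (B i) (B j)) :
    c.M (⋃ i ∈ s, B i) = ∑ i ∈ s, c.M (B i) := by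
  classical
  induction s using Finset.induction_on with
  | empty => simpa using c.M_empty
  | insert i s hi ih =>
    rw [Finset.set_biUnion_insert, Finset.sum_insert hi, c.M_union, ih]
    · exact fun j hj => hB j (Finset.mem_insert_of_mem hj)
    · exact fun j hj k hk => hd j (Finset.mem_insert_of_mem hj) k (Finset.mem_insert_of_mem hk)
    · exact hB i (Finset.mem_insert_self i s)
    · exact s.finite_toSet.isClopen_biUnion fun j hj => hB j (Finset.mem_insert_of_mem hj)
    · rw [Set.disjoint_iUnion₂_right]
      intro j hj
      exact hd i (Finset.mem_insert_self i s) j (Finset.mem_insert_of_mem hj)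
        (fun h => hi (h ▸ hj))

theorem sum_M {ι : Type*} (s : Finset ι) (B : ι → Set X) (hB : ∀ i ∈ s, IsClopen (B i))
    (hd : ∀ i ∈ s, ∀ j ∈ s, i ≠ j → Disjoint (B i) (B j)) {U : Set X}
    (hU : ∀ x, x ∈ U ↔ ∃ i ∈ s, x ∈ B i) : ∑ i ∈ s, c.M (B i) = c.M U := by
  rw [← c.M_biUnion s B hB hd]
  congr 1
  ext x
  simp [hU]

theorem M_mul_of_subset {U V : Set X} (hU : IsClopen U) (hV : IsClopen V) (h : U ⊆ V) :
    c.M U * c.M V = c.M U := by rw [c.M_mul hU hV, Set.inter_eq_left.mpr h]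

theorem M_mul_of_superset {U V : Set X} (hU : IsClopen U) (hV : IsClopen V) (h : U ⊆ V) :
    c.M V * c.M U = c.M U := by rw [c.M_mul hV hU, Set.inter_eq_right.mpr h]

theorem M_mul_self {U : Set X} (hU : IsClopen U) : c.M U * c.M U = c.M U :=
  c.M_mul_of_subset hU hU le_rfl

theorem M_mul_of_disjoint {U V : Set X} (hU : IsClopen U) (hV : IsClopen V) (h : Disjoint U V) :
    c.M U * c.M V = 0 := by rw [c.M_mul hU hV, h.inter_eq, c.M_empty]

theorem M_comm {U V : Set X} (hU : IsClopen U) (hV : IsClopen V) : c.M U * c.M V = c.M V * c.M U := by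
  rw [c.M_mul hU hV, c.M_mul hV hU, Set.inter_comm]

theorem sum_M_source {n : ℕ} {Z : S.P n} {s : Finset (S.Edge n)} (hs : (s : Set _) ∈ S.sep n Z)
    {U : Set X} (hU : ∀ x, x ∈ U ↔ ∃ e ∈ s, x ∈ ((S.ends e).2 : Set X)) :
    ∑ e ∈ s, c.M (S.ends e).2 = c.M U :=
  c.sum_M s _ (fun e _ => RefinedSeq.isClopen_snd e)
    (fun e he f hf hne => RefinedSeq.source_disjoint hs (Finset.mem_coe.mpr he) (Finset.mem_coe.mpr hf) hne) hU

/-- For even n the sources of R_Z tile σ(Z): a member of the next partition that meets σ(Z) lies in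
σ(Z), by the refinement condition on images. -/
theorem sum_M_redSet {n : ℕ} (hn : Even n) (Z : S.P n) (s : Finset (S.Edge n))
    (hs : (s : Set _) = S.redSet n Z) : ∑ e ∈ s, c.M (S.ends e).2 = c.M (σ '' Z) := by
  have hmem : ∀ e, e ∈ s ↔ e ∈ S.redSet n Z := fun e => by rw [← hs, Finset.mem_coe]
  refine c.sum_M_source (Z := Z) (hs ▸ .inr (.inl ⟨hn, rfl⟩)) ?_
  intro x
  constructor
  · rintro ⟨y, hy, rfl⟩
    obtain ⟨W, hW, hxW⟩ := S.exists_mem (n + 1) (σ y)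
    exact ⟨.inr ⟨(Z, ⟨W, hW⟩), (RefinedSeq.redRel_even hn).mpr (S.subset_image hn Z.2 hW hy hxW)⟩,
      (hmem _).mpr ⟨rfl, rfl⟩, hxW⟩
  · rintro ⟨e, he, hx⟩
    obtain ⟨h1, h2⟩ := (hmem _).mp he
    rcases e with e | e
    · cases h1
    · rw [← h2]; exact (RefinedSeq.redRel_even hn).mp e.2 hx

/-- For odd n the sources of R(f), for f from Z to U, tile U ∩ σ⁻¹(Z), by the refinement condition
on preimages together with nestedness. -/
theorem sum_M_redSetBelow {n : ℕ} (hn : ¬Even n) (Z : S.P n) {U : Set X} (hU : U ∈ S.P (n - 1))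
    (h : RefinedSeq.RedRel σ (n - 1) U Z) (s : Finset (S.Edge n)) (hs : (s : Set _) = S.redSetBelow n Z U) :
    ∑ e ∈ s, c.M (S.ends e).2 = c.M (U ∩ σ ⁻¹' Z) := by
  have hmem : ∀ e, e ∈ s ↔ e ∈ S.redSetBelow n Z U := fun e => by rw [← hs, Finset.mem_coe]
  refine c.sum_M_source (Z := Z) (hs ▸ .inr (.inr ⟨hn, U, hU, h, rfl⟩)) ?_
  obtain ⟨m, rfl, hm⟩ := RefinedSeq.not_even_cases hn
  intro x
  constructor
  · rintro ⟨hx, hx'⟩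
    obtain ⟨W, hW, hxW⟩ := S.exists_mem (m + 1 + 1) x
    exact ⟨.inr ⟨(Z, ⟨W, hW⟩), (RefinedSeq.redRel_odd hn).mpr (S.subset_preimage hn Z.2 hW hxW hx')⟩,
      (hmem _).mpr ⟨⟨rfl, rfl⟩, S.subset_of_mem₂ hU hW hx hxW⟩, hxW⟩
  · rintro ⟨e, he, hx⟩
    obtain ⟨⟨h1, h2⟩, h3⟩ := (hmem _).mp he
    rcases e with e | e
    · cases h1
    · refine ⟨h3 hx, ?_⟩
      rw [← h2]; exact (RefinedSeq.redRel_odd hn).mp e.2 hx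

/-- This is the form in which the connecting map acts on range vertices: Z is tiled by the members
two steps further on. -/
theorem sum_M_nextVertices {n : ℕ} (Z : S.P n) (s : Finset (S.P (n + 2)))
    (hs : ∀ W, W ∈ s ↔ (W : Set X) ⊆ Z) : ∑ W ∈ s, c.M W = c.M Z := by
  refine c.sum_M s (fun W => (W : Set X)) (fun W _ => S.isClopen W.2) ?_ ?_
  · intro V _ W _ hne
    exact (S.part (n + 2)).disjoint V V.2 W W.2 fun h => hne (Subtype.ext h)
  · intro x
    constructor
    · intro hx
      obtain ⟨W, hW, hxW⟩ := S.exists_mem (n + 2) x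
      exact ⟨⟨W, hW⟩, (hs _).mpr (S.subset_of_mem₂ Z.2 hW hx hxW), hxW⟩
    · rintro ⟨W, hW, hx⟩
      exact (hs W).mp hW hx

theorem sum_M_part (n : ℕ) : ∑ Z : S.P n, c.M Z = c.M Set.univ := by
  refine c.sum_M _ (fun Z : S.P n => (Z : Set X)) (fun Z _ => S.isClopen Z.2) ?_ ?_
  · intro Z _ W _ h
    exact (S.part n).disjoint Z Z.2 W W.2 fun h' => h (Subtype.ext h')
  · intro x
    obtain ⟨Z, hZ, hx⟩ := S.exists_mem n x
    exact ⟨fun _ => ⟨⟨Z, hZ⟩, Finset.mem_univ _, hx⟩, fun _ => trivial⟩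

end ClopenMeasure

namespace CovRep

variable {S : RefinedSeq σ} {A : Type v} [NonUnitalRing A] [StarRing A] (c : CovRep S A)

theorem star_t_mul {U : Set X} (hU : IsClopen U) : star c.t * c.M (σ ⁻¹' U) = c.M U * star c.t := by
  have := congrArg star (c.t_mul hU)
  rw [star_mul, star_mul, c.star_M hU, c.star_M (isClopen_preimage σ hU)] at this
  exact this.symm

/-- Compress the relation for Z by M(U) on both sides; M(Z) is absorbed. -/
theorem range_small {U Z : Set X} (hZ : Z ∈ S.P 0) (hU : IsClopen U) (h : U ⊆ Z) :
    c.M U * c.t * star c.t * c.M U = c.M U := by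
  have hZc := S.isClopen hZ
  have h1 := congrArg (fun x => c.M U * x * c.M U) (c.range_part Z hZ)
  simp only [mul_assoc] at h1
  rw [c.M_mul_of_superset hU hZc h, ← mul_assoc (c.M U) (c.M Z), c.M_mul_of_subset hU hZc h,
    c.M_mul_self hU] at h1
  simpa only [mul_assoc] using h1

theorem image_inter_eq {U Z : Set X} (hZ : Z ∈ S.P 0) (h : U ⊆ Z) : Z ∩ σ ⁻¹' (σ '' U) = U := by
  ext x
  constructor
  · rintro ⟨hx, y, hy, hxy⟩
    rwa [← S.injOn 0 Z hZ (h hy) hx hxy]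
  · exact fun hx => ⟨h hx, x, hx, rfl⟩

/-- Injectivity of σ on Z gives U = Z ∩ σ⁻¹(σ U). The factor M(σ⁻¹(σ U)) moves through t and becomes
M(σ U), and what is left is the transfer relation for Z. -/
theorem transfer_small {U Z : Set X} (hZ : Z ∈ S.P 0) (hU : IsClopen U) (h : U ⊆ Z) :
    star c.t * c.M U * c.t = c.M (σ '' U) := by
  have hZc := S.isClopen hZ
  have hi := isClopen_image σ hU
  have h1 : c.M U = c.M Z * c.M (σ ⁻¹' (σ '' U)) := by
    rw [c.M_mul hZc (isClopen_preimage σ hi), image_inter_eq hZ h]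
  rw [h1, ← mul_assoc, mul_assoc, ← c.t_mul hi, ← mul_assoc, c.transfer_part Z hZ,
    c.M_mul_of_superset hi (isClopen_image σ hZc) (Set.image_mono h)]

/-! ### The representation of the layers -/

/-- The element attached to an edge. -/
def chi {n : ℕ} : S.Edge n → A
  | .inl e => c.M e.1.2
  | .inr f => if Even n then c.M f.1.1 * c.t * c.M f.1.2 else c.M f.1.1 * star c.t * c.M f.1.2

theorem chi_blue {n : ℕ} (e : S.Blue n) : c.chi (Sum.inl e) = c.M e.1.2 := rfl

theorem chi_red_even {n : ℕ} (hn : Even n) (f : S.Red n) :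
    c.chi (Sum.inr f) = c.M f.1.1 * c.t * c.M f.1.2 := if_pos hn

theorem chi_red_odd {n : ℕ} (hn : ¬Even n) (f : S.Red n) :
    c.chi (Sum.inr f) = c.M f.1.1 * star c.t * c.M f.1.2 := if_neg hn

theorem M_mul_chi {n : ℕ} (e : S.Edge n) : c.M (S.ends e).1 * c.chi e = c.chi e := by
  have h := RefinedSeq.isClopen_fst e
  rcases e with e | f
  · exact c.M_mul_of_superset (RefinedSeq.isClopen_snd (.inl e)) h e.2
  · unfold chi
    split_ifs
    · rw [← mul_assoc, ← mul_assoc, show c.M (S.ends (.inr f)).1 * c.M f.1.1 = c.M f.1.1 from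
        c.M_mul_self h]
    · rw [← mul_assoc, ← mul_assoc, show c.M (S.ends (.inr f)).1 * c.M f.1.1 = c.M f.1.1 from
        c.M_mul_self h]

theorem chi_mul_M {n : ℕ} (e : S.Edge n) : c.chi e * c.M (S.ends e).2 = c.chi e := by
  have h := RefinedSeq.isClopen_snd e
  rcases e with e | f
  · exact c.M_mul_self h
  · unfold chi
    split_ifs
    · rw [mul_assoc, show c.M f.1.2 * c.M (S.ends (.inr f)).2 = c.M f.1.2 from c.M_mul_self h]
    · rw [mul_assoc, show c.M f.1.2 * c.M (S.ends (.inr f)).2 = c.M f.1.2 from c.M_mul_self h]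

/-- In the middle appears t* M(Z) t = M(σ Z), which is absorbed because the source of e lies in
σ(Z). -/
theorem star_chi_mul_chi_of_range_eq_even {n : ℕ} (hn : Even n) (e f : S.Red n)
    (h : e.1.1 = f.1.1) : star (c.chi (Sum.inr e)) * c.chi (Sum.inr f) = c.M e.1.2 * c.M f.1.2 := by
  have hr := S.isClopen e.1.1.2
  obtain ⟨Y, hY, hYs⟩ := S.exists_zero_superset e.1.1.2
  rw [c.chi_red_even hn, c.chi_red_even hn, ← h, star_mul, star_mul, c.star_M hr,
    c.star_M (S.isClopen e.1.2.2)]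
  have : c.M e.1.2 * (star c.t * c.M e.1.1) * (c.M e.1.1 * c.t * c.M f.1.2) =
      c.M e.1.2 * (star c.t * (c.M e.1.1 * c.M e.1.1) * c.t) * c.M f.1.2 := by
    simp only [mul_assoc]
  rw [this, c.M_mul_self hr, c.transfer_small hY hr hYs, c.M_mul_of_subset
    (S.isClopen e.1.2.2) (isClopen_image σ hr) ((RefinedSeq.redRel_even hn).mp e.2)]

/-- Here t M(Z) t* appears in the middle, and t t* is not a value of the measure. It can be removed
only between projections under a set on which σ is injective. This is why, in odd layers, the red
edges are separated into the sets R(f): all sources in R(f) lie in the single set U = r(f). -/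
theorem star_chi_mul_chi_odd {n : ℕ} (hn : ¬Even n) (e f : S.Red n) (h : e.1.1 = f.1.1)
    {U : Set X} {k : ℕ} (hU : U ∈ S.P k) (he : (e.1.2 : Set X) ⊆ U) (hf : (f.1.2 : Set X) ⊆ U) :
    star (c.chi (Sum.inr e)) * c.chi (Sum.inr f) = c.M e.1.2 * c.M f.1.2 := by
  have hr := S.isClopen e.1.1.2
  have hec := S.isClopen e.1.2.2
  have hfc := S.isClopen f.1.2.2
  obtain ⟨Y, hY, hYs⟩ := S.exists_zero_superset hU
  have hUc := S.isClopen hU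
  rw [c.chi_red_odd hn, c.chi_red_odd hn, ← h, star_mul, star_mul, c.star_M hr, c.star_M hec,
    star_star]
  have h1 : c.M e.1.2 * (c.t * c.M e.1.1) * (c.M e.1.1 * star c.t * c.M f.1.2) =
      c.M e.1.2 * (c.t * (c.M e.1.1 * c.M e.1.1)) * star c.t * c.M f.1.2 := by
    simp only [mul_assoc]
  rw [h1, c.M_mul_self hr, c.t_mul hr, ← mul_assoc, c.M_mul_of_subset hec (isClopen_preimage σ hr)
    ((RefinedSeq.redRel_odd hn).mp e.2), ← c.M_mul_of_subset hec hUc he, ← c.M_mul_of_superset hfc hUc hf]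
  have h2 : c.M e.1.2 * c.M U * c.t * star c.t * (c.M U * c.M f.1.2) =
      c.M e.1.2 * (c.M U * c.t * star c.t * c.M U) * c.M f.1.2 := by simp only [mul_assoc]
  rw [h2, c.range_small hY hUc hYs, mul_assoc, mul_assoc, ← mul_assoc (c.M U),
    c.M_mul_self hUc]

/-- This contains both relations for e*f within a member of the separation: the product of the two
source projections is M(s(e)) for e = f and vanishes otherwise. -/
theorem star_chi_mul_chi {n : ℕ} {Z : S.P n} {Y : Set (S.Edge n)} (hY : Y ∈ S.sep n Z)
    {e f : S.Edge n} (he : e ∈ Y) (hf : f ∈ Y) :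
    star (c.chi e) * c.chi f = c.M (S.ends e).2 * c.M (S.ends f).2 := by
  obtain ⟨hcol, h1, h2⟩ := S.sep_color hY he hf
  rcases e with e | e
  · rcases f with f | f
    · rw [chi_blue, chi_blue, c.star_M (S.isClopen e.1.2.2)]
      rfl
    · cases hcol
  · rcases f with f | f
    · cases hcol
    · by_cases hn : Even n
      · exact c.star_chi_mul_chi_of_range_eq_even hn e f (h1.trans h2.symm)
      · rcases hY with rfl | ⟨hn', rfl⟩ | ⟨hn', U, hU, h, rfl⟩
        · cases he.1
        · exact absurd hn' hn
        · exact c.star_chi_mul_chi_odd hn e f (h1.trans h2.symm) hU he.2 hf.2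

end CovRep

end CovRep

/-! ### Matrix units over a *-algebra. -/

section MatrixUnits

variable {A : Type v} [NonUnitalRing A] [StarRing A] [Module ℂ A] [IsScalarTower ℂ A A]
  [SMulCommClass ℂ A A] [StarModule ℂ A]

instance instIsScalarTowerCStarMatrix :
    IsScalarTower ℂ (CStarMatrix Bool Bool A) (CStarMatrix Bool Bool A) :=
  ⟨fun c M N => CStarMatrix.smul_mul c M N⟩

instance instSMulCommClassCStarMatrix :
    SMulCommClass ℂ (CStarMatrix Bool Bool A) (CStarMatrix Bool Bool A) :=
  ⟨fun c M N => (CStarMatrix.mul_smul M c N).symm⟩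

/-- The matrix with `(i, j)`-entry `a` and zero entries elsewhere. -/
def entry (i j : Bool) (a : A) : CStarMatrix Bool Bool A := CStarMatrix.ofMatrix (Matrix.single i j a)

theorem entry_apply_same (i j : Bool) (a : A) : entry i j a i j = a := Matrix.single_apply_same i j a

theorem entry_add (i j : Bool) (a b : A) : entry i j (a + b) = entry i j a + entry i j b :=
  Matrix.single_add i j a b

theorem entry_zero (i j : Bool) : entry i j (0 : A) = 0 := Matrix.single_zero i j

theorem entry_sum {ι : Type*} (i j : Bool) (s : Finset ι) (f : ι → A) :
    entry i j (∑ k ∈ s, f k) = ∑ k ∈ s, entry i j (f k) :=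
  map_sum (⟨⟨entry i j, entry_zero i j⟩, entry_add i j⟩ : A →+ CStarMatrix Bool Bool A) f s

theorem entry_mul (i j k : Bool) (a b : A) : entry i j a * entry j k b = entry i k (a * b) :=
  Matrix.single_mul_single_same ..

theorem entry_mul_of_ne (i : Bool) {j j' : Bool} (k : Bool) (h : j ≠ j') (a b : A) :
    entry i j a * entry j' k b = 0 := Matrix.single_mul_single_of_ne _ _ _ _ h _

theorem star_entry (i j : Bool) (a : A) : star (entry i j a) = entry j i (star a) :=
  Matrix.conjTranspose_single i j a

end MatrixUnits

/-! ### The Leavitt relations for the matrices attached to a layer. -/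

namespace CovRep

variable {X : Type u} [MetricSpace X] [CompactSpace X] {σ : LHomeo X}
variable {S : RefinedSeq σ} {A : Type v} [NonUnitalRing A] [StarRing A] (c : CovRep S A)

theorem sum_chi_blue {n : ℕ} (Z : S.P n) (s : Finset (S.Edge n)) (hs : (s : Set _) = S.blueSet n Z) :
    ∑ e ∈ s, c.chi e = c.M Z := by
  have hmem : ∀ e, e ∈ s ↔ e ∈ S.blueSet n Z := fun e => by rw [← hs, Finset.mem_coe]
  rw [← c.sum_M_source (Z := Z) (s := s) (hs ▸ .inl rfl) (U := Z)]
  · refine Finset.sum_congr rfl fun e he => ?_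
    rcases e with e | e
    · rfl
    · cases ((hmem _).mp he).1
  · intro x
    constructor
    · intro hx
      obtain ⟨W, hW, hxW⟩ := S.exists_mem (n + 1) x
      exact ⟨.inl ⟨(Z, ⟨W, hW⟩), S.subset_of_mem Z.2 hW hx hxW⟩, (hmem _).mpr ⟨rfl, rfl⟩, hxW⟩
    · rintro ⟨e, he, hx⟩
      obtain ⟨h1, h2⟩ := (hmem _).mp he
      rcases e with e | e
      · rw [← h2]; exact e.2 hx
      · cases h1

/-- In each case the source projections are summed between fixed outer factors and replaced by one
clopen set. For blue edges it is Z itself. For red edges in an even layer it is σ(Z), and M(Z) t M(σ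
Z) t* M(Z) = M(Z) t t* M(Z). In an odd layer it is U ∩ σ⁻¹(Z), which the transfer relation turns
into its image Z. -/
theorem sum_chi_mul_star_chi {n : ℕ} {Z : S.P n} {s : Finset (S.Edge n)}
    (hs : (s : Set _) ∈ S.sep n Z) : ∑ e ∈ s, c.chi e * star (c.chi e) = c.M Z := by
  have hZ := S.isClopen Z.2
  rcases hs with hs | ⟨hn, hs⟩ | ⟨hn, U, hU, h, hs⟩
  · rw [← c.sum_chi_blue Z s hs]
    refine Finset.sum_congr rfl fun e he => ?_
    have he' : e ∈ S.blueSet n Z := hs ▸ Finset.mem_coe.mpr he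
    rcases e with e | e
    · rw [chi_blue, c.star_M (S.isClopen e.1.2.2), c.M_mul_self (S.isClopen e.1.2.2)]
    · cases he'.1
  · have h1 : ∀ e ∈ s, c.chi e * star (c.chi e) =
        c.M Z * c.t * c.M (S.ends e).2 * (star c.t * c.M Z) := by
      intro e he
      obtain ⟨he1, he2⟩ : e ∈ S.redSet n Z := hs ▸ Finset.mem_coe.mpr he
      rcases e with e | e
      · cases he1
      · rw [c.chi_red_even hn, show e.1.1 = Z from he2, star_mul, star_mul, c.star_M hZ,
          c.star_M (S.isClopen e.1.2.2), mul_assoc, ← mul_assoc (c.M e.1.2),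
          c.M_mul_self (S.isClopen e.1.2.2)]
        simp only [mul_assoc]
        rfl
    obtain ⟨Y, hY, hYs⟩ := S.exists_zero_superset Z.2
    rw [Finset.sum_congr rfl h1, ← Finset.sum_mul, ← Finset.mul_sum, c.sum_M_redSet hn Z s hs,
      mul_assoc (c.M Z), c.t_mul (isClopen_image σ hZ), ← mul_assoc, ← mul_assoc,
      c.M_mul_of_subset hZ (isClopen_preimage σ (isClopen_image σ hZ)) (Set.subset_preimage_image _ _),
      c.range_small hY hZ hYs]
  · have h1 : ∀ e ∈ s, c.chi e * star (c.chi e) =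
        c.M Z * star c.t * c.M (S.ends e).2 * (c.t * c.M Z) := by
      intro e he
      obtain ⟨⟨he1, he2⟩, he3⟩ : e ∈ S.redSetBelow n Z U := hs ▸ Finset.mem_coe.mpr he
      rcases e with e | e
      · cases he1
      · rw [c.chi_red_odd hn, show e.1.1 = Z from he2, star_mul, star_mul, c.star_M hZ,
          c.star_M (S.isClopen e.1.2.2), star_star, mul_assoc, ← mul_assoc (c.M e.1.2),
          c.M_mul_self (S.isClopen e.1.2.2)]
        simp only [mul_assoc]
        rfl
    have hUc := S.isClopen hU
    have hUZ : IsClopen (U ∩ σ ⁻¹' Z) := hUc.inter (isClopen_preimage σ hZ)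
    -- The layer before has even index, so the red edge from Z to U there means Z ⊆ σ(U).
    have himage : σ '' (U ∩ σ ⁻¹' Z) = Z := by
      obtain ⟨m, rfl, hm⟩ := RefinedSeq.not_even_cases hn
      rw [Set.image_inter_preimage]
      exact Set.inter_eq_right.mpr ((RefinedSeq.redRel_even (by simpa using hm)).mp h)
    obtain ⟨Y, hY, hYs⟩ := S.exists_zero_superset hU
    rw [Finset.sum_congr rfl h1, ← Finset.sum_mul, ← Finset.mul_sum,
      c.sum_M_redSetBelow hn Z hU h s hs]
    have h2 : c.M Z * star c.t * c.M (U ∩ σ ⁻¹' Z) * (c.t * c.M Z) =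
      c.M Z * (star c.t * c.M (U ∩ σ ⁻¹' Z) * c.t) * c.M Z := by simp only [mul_assoc]
    rw [h2, c.transfer_small hY hUZ (Set.inter_subset_left.trans hYs), himage, c.M_mul_self hZ,
      c.M_mul_self hZ]

/-- This is what compatibility with the connecting map amounts to on edges. The sources of the edges
in the image tile W for a blue edge with source W, Z ∩ σ⁻¹(W) for a red edge of an even layer, and
σ(W) for a red edge of an odd layer. In the two red cases, moving this set through t or t* restores
M(Z) t M(W) or M(Z) t* M(W). -/
theorem sum_star_chi_next {n : ℕ} (e : S.Edge n) :
    ∑ x ∈ S.nextEdges n e, star (c.chi x) = c.chi e := by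
  rcases e with e | f
  · rw [← star_sum, c.sum_chi_blue e.1.2, c.star_M (S.isClopen e.1.2.2)]
    · rfl
    · ext x
      rw [Finset.mem_coe, S.mem_nextEdges_blue]
  · have hW := S.isClopen f.1.2.2
    have hZ := S.isClopen f.1.1.2
    by_cases hn : Even n
    · have hn' : ¬Even (n + 1) := by rw [Nat.even_add_one, not_not]; exact hn
      have hs : (S.nextEdges n (.inr f) : Set (S.Edge (n + 1))) = S.redSetBelow (n + 1) f.1.2 f.1.1 := by
        ext x
        rw [Finset.mem_coe, S.mem_nextEdges_red_even hn]
      have h1 : ∀ x ∈ S.nextEdges n (.inr f), star (c.chi x) =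
          c.M (S.ends x).2 * (c.t * c.M f.1.2) := by
        intro x hx
        obtain ⟨⟨he1, he2⟩, he3⟩ : x ∈ S.redSetBelow (n + 1) f.1.2 f.1.1 := hs ▸ Finset.mem_coe.mpr hx
        rcases x with x | x
        · cases he1
        · rw [c.chi_red_odd hn', show x.1.1 = f.1.2 from he2, star_mul, star_mul, star_star,
            c.star_M hW, c.star_M (S.isClopen x.1.2.2)]
          rfl
      rw [Finset.sum_congr rfl h1, ← Finset.sum_mul,
        c.sum_M_redSetBelow hn' f.1.2 f.1.1.2 f.2 _ hs, c.t_mul hW, ← mul_assoc,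
        c.M_mul_of_subset (hZ.inter (isClopen_preimage σ hW)) (isClopen_preimage σ hW)
        Set.inter_subset_right, c.chi_red_even hn, mul_assoc, c.t_mul hW, ← mul_assoc,
        c.M_mul hZ (isClopen_preimage σ hW)]
    · have hn' : Even (n + 1) := Nat.even_add_one.mpr hn
      have hs : (S.nextEdges n (.inr f) : Set (S.Edge (n + 1))) = S.redSet (n + 1) f.1.2 := by
        ext x
        rw [Finset.mem_coe, S.mem_nextEdges_red_odd hn]
      have h1 : ∀ x ∈ S.nextEdges n (.inr f), star (c.chi x) =
          c.M (S.ends x).2 * (star c.t * c.M f.1.2) := by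
        intro x hx
        obtain ⟨he1, he2⟩ : x ∈ S.redSet (n + 1) f.1.2 := hs ▸ Finset.mem_coe.mpr hx
        rcases x with x | x
        · cases he1
        · rw [c.chi_red_even hn', show x.1.1 = f.1.2 from he2, star_mul, star_mul, c.star_M hW,
            c.star_M (S.isClopen x.1.2.2)]
          rfl
      have hi := isClopen_image σ hW
      -- Since W ⊆ σ⁻¹(σ W), the projection M(σ W) may be inserted to the left of t*; it is then
      -- absorbed by M(Z), because σ(W) ⊆ Z for odd n.
      have h2 : star c.t * c.M f.1.2 = c.M (σ '' f.1.2) * (star c.t * c.M f.1.2) := by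
        rw [← mul_assoc, ← c.star_t_mul hi, mul_assoc, c.M_mul_of_superset hW
          (isClopen_preimage σ hi) (Set.subset_preimage_image _ _)]
      have hsub : σ '' f.1.2 ⊆ f.1.1 := Set.image_subset_iff.mpr ((RefinedSeq.redRel_odd hn).mp f.2)
      rw [Finset.sum_congr rfl h1, ← Finset.sum_mul, c.sum_M_redSet hn' f.1.2 _ hs,
        c.chi_red_odd hn, mul_assoc (c.M f.1.1), h2, ← mul_assoc (c.M f.1.1),
        c.M_mul_of_superset hi hZ hsub, ← mul_assoc, c.M_mul_self hi]

variable [Module ℂ A] [IsScalarTower ℂ A A] [SMulCommClass ℂ A A] [StarModule ℂ A]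

/-- The images of the generators of the `n`-th layer. -/
def layerGen (n : ℕ) : S.Vertex n ⊕ S.Edge n → CStarMatrix Bool Bool A
  | .inl (.inl Z) => entry n.bodd n.bodd (c.M Z)
  | .inl (.inr W) => entry (!n.bodd) (!n.bodd) (c.M W)
  | .inr e => entry n.bodd (!n.bodd) (c.chi e)

/-- Vertices on the same side are orthogonal because the sets are disjoint; vertices on opposite
sides because they occupy different diagonal positions. The edge relations reduce to the identities
for `chi`. -/
theorem layerGen_rel (n : ℕ) (a b : StarTerm (S.Vertex n ⊕ S.Edge n)) (h : (S.layer n).Rel a b) :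
    StarPres.eval (c.layerGen n) a = StarPres.eval (c.layerGen n) b := by
  classical
  have hP : ∀ {k : ℕ} (Z W : S.P k), Z ≠ W → c.M Z * c.M W = 0 := fun Z W h =>
    c.M_mul_of_disjoint (S.isClopen Z.2) (S.isClopen W.2)
      ((S.part _).disjoint Z Z.2 W W.2 fun h' => h (Subtype.ext h'))
  have hsq : ∀ {Z : S.P n} {Y : Set (S.Edge n)}, Y ∈ S.sep n Z → ∀ {e f : S.Edge n}, e ∈ Y → f ∈ Y →
      star (c.layerGen n (.inr e)) * c.layerGen n (.inr f) =
        entry (!n.bodd) (!n.bodd) (c.M (S.ends e).2 * c.M (S.ends f).2) := by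
    intro Z Y hY e f he hf
    rw [layerGen, layerGen, star_entry, entry_mul, c.star_chi_mul_chi hY he hf]
  cases h with
  | vertex_mul_self v =>
    rcases v with v | v
    · exact (entry_mul _ _ _ _ _).trans (congrArg _ (c.M_mul_self (S.isClopen v.2)))
    · exact (entry_mul _ _ _ _ _).trans (congrArg _ (c.M_mul_self (S.isClopen v.2)))
  | vertex_mul_ne v w hvw =>
    rcases v with v | v <;> rcases w with w | w
    · exact (entry_mul _ _ _ _ _).trans ((congrArg _ (hP v w fun h => hvw (congrArg _ h))).trans
        (entry_zero _ _))
    · exact entry_mul_of_ne _ _ (by simp) _ _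
    · exact entry_mul_of_ne _ _ (by simp) _ _
    · exact (entry_mul _ _ _ _ _).trans ((congrArg _ (hP v w fun h => hvw (congrArg _ h))).trans
        (entry_zero _ _))
  | vertex_adj v =>
    rcases v with v | v
    · exact (star_entry _ _ _).trans (congrArg _ (c.star_M (S.isClopen v.2)))
    · exact (star_entry _ _ _).trans (congrArg _ (c.star_M (S.isClopen v.2)))
  | range_mul e => exact (entry_mul _ _ _ _ _).trans (congrArg _ (c.M_mul_chi e))
  | mul_source e => exact (entry_mul _ _ _ _ _).trans (congrArg _ (c.chi_mul_M e))
  | sck1_self v Y hY e he =>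
    rcases v with v | v
    · exact (hsq hY he he).trans (congrArg _ (c.M_mul_self (RefinedSeq.isClopen_snd e)))
    · cases hY
  | sck1_ne v Y hY e f he hf hef =>
    rcases v with v | v
    · refine (hsq hY he hf).trans ?_
      rw [c.M_mul_of_disjoint (RefinedSeq.isClopen_snd e) (RefinedSeq.isClopen_snd f) (RefinedSeq.source_disjoint hY he hf hef),
        entry_zero]
      rfl
    · cases hY
  | sck2 v l hl hY =>
    rcases v with v | v
    · rw [StarPres.eval_sum, List.map_map, ← List.sum_toFinset _ hl]
      show entry n.bodd n.bodd (c.M v) = _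
      rw [← c.sum_chi_mul_star_chi (Z := v) (s := l.toFinset), entry_sum]
      · refine Finset.sum_congr rfl fun e _ => ?_
        show _ = c.layerGen n (.inr e) * star (c.layerGen n (.inr e))
        rw [layerGen, star_entry, entry_mul]
      · convert (show {e | e ∈ l} ∈ S.sep n v from hY) using 1
        ext e
        simp
    · cases hY

/-- The `*`-homomorphism from the `n`-th layer to the `2 × 2`-matrices over `A`. -/
def layerHom (n : ℕ) : S.L n →⋆ₙₐ[ℂ] CStarMatrix Bool Bool A :=
  StarPres.lift (c.layerGen n) (c.layerGen_rel n)

theorem layerHom_inl (n : ℕ) (Z : S.P n) :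
    c.layerHom n ((S.layer n).v (.inl Z)) = entry n.bodd n.bodd (c.M Z) := rfl

theorem layerHom_inr (n : ℕ) (W : S.P (n + 1)) :
    c.layerHom n ((S.layer n).v (.inr W)) = entry (!n.bodd) (!n.bodd) (c.M W) := rfl

theorem layerHom_e (n : ℕ) (e : S.Edge n) :
    c.layerHom n ((S.layer n).e e) = entry n.bodd (!n.bodd) (c.chi e) := rfl

end CovRep

/-- `*`-homomorphisms on a presented `*`-algebra agree if they agree on the generators. -/
theorem StarPres.hom_ext {Y : Type u} {R : StarTerm Y → StarTerm Y → Prop} {A : Type v}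
    [NonUnitalRing A] [StarRing A] [Module ℂ A] {f g : StarPres R →⋆ₙₐ[ℂ] A}
    (h : ∀ x, f (StarPres.of R x) = g (StarPres.of R x)) (a : StarPres R) : f a = g a := by
  refine StarPres.ind a fun t => ?_
  induction t with
  | of x => exact h x
  | zero => exact (map_zero f).trans (map_zero g).symm
  | add s t hs ht =>
    exact (map_add f (mk R s) (mk R t)).trans
      ((congrArg₂ _ hs ht).trans (map_add g (mk R s) (mk R t)).symm)
  | mul s t hs ht =>
    exact (map_mul f (mk R s) (mk R t)).trans
      ((congrArg₂ _ hs ht).trans (map_mul g (mk R s) (mk R t)).symm)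
  | smul z t ht =>
    have h1 : f (z • mk R t) = g (z • mk R t) := by rw [map_smul, map_smul, ht]
    exact h1
  | adj t ht =>
    have h1 : f (star (mk R t)) = g (star (mk R t)) := by rw [map_star, map_star, ht]
    exact h1

/-! ### Compatibility of the matrix representations with the connecting maps. -/

namespace CovRep

variable {X : Type u} [MetricSpace X] [CompactSpace X] {σ : LHomeo X}
variable {S : RefinedSeq σ} {A : Type v} [NonUnitalRing A] [StarRing A] (c : CovRep S A)
variable [Module ℂ A] [IsScalarTower ℂ A A] [SMulCommClass ℂ A A] [StarModule ℂ A]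

open Classical in
-- The source partition of one layer is the range partition of the next, and the diagonal position
-- of the range side is the parity of n. So a vertex keeps its position. An edge goes to adjoints of
-- edges, whose matrix position is transposed back.
theorem layerHom_connect (n : ℕ) (x : S.L n) :
    c.layerHom (n + 1) (S.connect n x) = c.layerHom n x := by
  refine StarPres.hom_ext (f := (c.layerHom (n + 1)).comp (S.connect n)) ?_ x
  rintro ((Z | W) | e)
  · show c.layerHom (n + 1) (S.connect n ((S.layer n).v (.inl Z))) = _
    rw [S.connect_inl, RefinedSeq.nextVertices, Finset.sum_map, map_sum]
    show (∑ W ∈ _, c.layerHom (n + 1) ((S.layer (n + 1)).v (.inr W))) = entry n.bodd n.bodd (c.M Z)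
    simp only [layerHom_inr, Nat.bodd_succ, Bool.not_not]
    rw [← entry_sum, c.sum_M_nextVertices Z _ fun W => by simp]
  · show c.layerHom (n + 1) (S.connect n ((S.layer n).v (.inr W))) = _
    rw [S.connect_inr, layerHom_inl, Nat.bodd_succ]
    rfl
  · show c.layerHom (n + 1) (S.connect n ((S.layer n).e e)) = entry n.bodd (!n.bodd) (c.chi e)
    rw [RefinedSeq.connect, SumMap.hom_e, map_sum]
    simp only [map_star, layerHom_e, star_entry, Nat.bodd_succ, Bool.not_not]
    rw [← entry_sum]
    exact congrArg _ (c.sum_star_chi_next e)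

end CovRep

theorem bodd_two_mul (n : ℕ) : (2 * n).bodd = false := by simp [Nat.bodd_mul]

/-! ### From 2 × 2 matrices to their upper left entry. -/

section CornerEntry

variable {L : Type u} [NonUnitalRing L] [StarRing L] [Module ℂ L] [IsScalarTower ℂ L L]
  [SMulCommClass ℂ L L] [StarModule ℂ L]
variable {A : Type v} [NonUnitalRing A] [StarRing A] [Module ℂ A] [IsScalarTower ℂ A A]
  [SMulCommClass ℂ A A] [StarModule ℂ A]

theorem mul_entry_apply_true (u : A) (N : CStarMatrix Bool Bool A) (i : Bool) :
    (N * entry false false u) i true = 0 := by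
  rw [CStarMatrix.mul_apply, Fintype.sum_bool]
  simp [entry]

/-- The upper left entry, as a `*`-homomorphism on a corner which is mapped to the upper left
corner of the `2 × 2`-matrices. -/
def cornerEntry (F : L →⋆ₙₐ[ℂ] CStarMatrix Bool Bool A) {p : L} (hp : IsStarProjection p) {u : A}
    (hu : F p = entry false false u) : corner p hp →⋆ₙₐ[ℂ] A where
  toFun x := F x false false
  map_smul' c x := by
    show F (c • (x : L)) false false = c • F x false false
    rw [map_smul]; rfl
  map_zero' := by
    show F 0 false false = 0
    rw [map_zero]; rfl
  map_add' x y := by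
    show F ((x : L) + y) false false = _
    rw [map_add]; rfl
  map_mul' x y := by
    -- The element x ends in p, whose image has only an upper left entry, so the second column of F
    -- x vanishes and the entry of a product has a single term.
    have hx : F x false true = 0 := by
      have := mem_corner_iff.mp x.2
      rw [← this, map_mul, hu, mul_entry_apply_true]
    show F ((x : L) * y) false false = _
    rw [map_mul, CStarMatrix.mul_apply, Fintype.sum_bool, hx, zero_mul, zero_add]
  map_star' x := by
    show F (star (x : L)) false false = _
    rw [map_star]; rfl

end CornerEntry

/-! ### Calculus of the elements M(U) t^m t*^n M(V). -/

namespace CovRep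

variable {X : Type u} [MetricSpace X] [CompactSpace X] {σ : LHomeo X}
variable {S : RefinedSeq σ} {A : Type v} [NonUnitalRing A] [StarRing A] (c : CovRep S A)

theorem t_mul_M_univ : c.t * c.M Set.univ = c.t := by
  rw [c.t_mul isClopen_univ, Set.preimage_univ, c.M_univ_mul_t]

/-- The powers of `t`, starting with the unit of the representation. -/
def tp : ℕ → A
  | 0 => c.M Set.univ
  | m + 1 => c.t * tp m

theorem tp_mul (m : ℕ) {U : Set X} (hU : IsClopen U) :
    c.tp m * c.M U = c.M (σ^[m] ⁻¹' U) * c.tp m := by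
  induction m with
  | zero => exact c.M_comm isClopen_univ hU
  | succ m ih =>
    rw [tp, mul_assoc, ih, ← mul_assoc, c.t_mul (isClopen_iterate σ hU m), mul_assoc]
    rfl

theorem M_mul_tp_mul (m : ℕ) {U V : Set X} (hU : IsClopen U) (hV : IsClopen V) :
    c.M U * (c.tp m * c.M V) = c.M (U ∩ σ^[m] ⁻¹' V) * c.tp m := by
  rw [c.tp_mul m hV, ← mul_assoc, c.M_mul hU (isClopen_iterate σ hV m)]

theorem star_tp_mul (m : ℕ) {U : Set X} (hU : IsClopen U) :
    c.M U * star (c.tp m) = star (c.tp m) * c.M (σ^[m] ⁻¹' U) := by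
  have := congrArg star (c.tp_mul m hU)
  rwa [star_mul, star_mul, c.star_M hU, c.star_M (isClopen_iterate σ hU m)] at this

theorem tp_mul_M_univ (m : ℕ) : c.tp m * c.M Set.univ = c.tp m := by
  induction m with
  | zero => exact c.M_mul_self isClopen_univ
  | succ m ih => rw [tp, mul_assoc, ih]

/-- The power t^0 is M(X), a two-sided unit for t, so t may be appended on either side. -/
theorem tp_succ (m : ℕ) : c.tp (m + 1) = c.tp m * c.t := by
  induction m with
  | zero => exact c.t_mul_M_univ.trans c.M_univ_mul_t.symm
  | succ m ih => rw [tp, ih, ← mul_assoc, ← tp, ← ih]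

/-- The elements which span the algebra. -/
def E (U : Set X) (m n : ℕ) (V : Set X) : A := c.M U * c.tp m * (star (c.tp n) * c.M V)

theorem M_mul_E {U V W : Set X} (hW : IsClopen W) (hU : IsClopen U) (m n : ℕ) :
    c.M W * c.E U m n V = c.E (W ∩ U) m n V := by
  rw [E, E, ← mul_assoc, ← mul_assoc (c.M W), c.M_mul hW hU]

theorem t_mul_E {U V : Set X} (hU : IsClopen U) (m n : ℕ) :
    c.t * c.E U m n V = c.E (σ ⁻¹' U) (m + 1) n V := by
  rw [E, E, ← mul_assoc, ← mul_assoc c.t, c.t_mul hU, tp, mul_assoc (c.M _)]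

theorem star_t_mul_E_succ {U V Z : Set X} (hZ : Z ∈ S.P 0) (hU : IsClopen U) (hUZ : U ⊆ Z)
    (m n : ℕ) : star c.t * c.E U (m + 1) n V = c.E (σ '' U) m n V := by
  rw [E, E, tp, ← c.transfer_small hZ hU hUZ]
  simp only [mul_assoc]

/-- With no power of t to cancel against, M(U) is moved to the right past t*^n, where it becomes
M(σ⁻ⁿ U), and t* joins the other adjoints. -/
theorem star_t_mul_E_zero {U V : Set X} (hU : IsClopen U) (hV : IsClopen V) (n : ℕ) :
    star c.t * c.E U 0 n V = c.E Set.univ 0 (n + 1) (σ^[n] ⁻¹' U ∩ V) := by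
  rw [E, E, tp, c.M_mul_self isClopen_univ, c.M_mul_of_subset hU isClopen_univ (Set.subset_univ U),
    ← mul_assoc (c.M U), c.star_tp_mul n hU, mul_assoc (star (c.tp n)),
    c.M_mul (isClopen_iterate σ hU n) hV, ← mul_assoc, ← star_mul, ← c.tp_succ, ← mul_assoc,
    c.star_tp_mul (n + 1) isClopen_univ, Set.preimage_univ, mul_assoc,
    c.M_mul isClopen_univ ((isClopen_iterate σ hU n).inter hV), Set.univ_inter]

theorem E_eq_sum_left {U V : Set X} (hU : IsClopen U) (m n k : ℕ) :
    c.E U m n V = ∑ Z : S.P k, c.E (U ∩ Z) m n V := by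
  have h1 : c.M U = ∑ Z : S.P k, c.M (U ∩ Z) := by
    rw [← c.M_mul_of_subset hU isClopen_univ (Set.subset_univ U), ← c.sum_M_part k, Finset.mul_sum]
    exact Finset.sum_congr rfl fun Z _ => c.M_mul hU (S.isClopen Z.2)
  simp only [E]
  rw [← Finset.sum_mul, ← Finset.sum_mul, ← h1]

theorem sum_range_part : ∑ Z : S.P 0, c.M Z * c.t * star c.t * c.M Z = c.M Set.univ := by
  rw [← c.sum_M_part 0]
  exact Finset.sum_congr rfl fun Z _ => c.range_part Z Z.2

/-- Write the unit between t^m and t*^n as ∑ M(Z) t t* M(Z) and move each M(Z) outwards. Both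
exponents grow by one with their difference unchanged, so finitely many such elements can be brought
to a common level. -/
theorem E_raise {U V : Set X} (hU : IsClopen U) (hV : IsClopen V) (m n : ℕ) :
    c.E U m n V = ∑ Z : S.P 0, c.E (U ∩ σ^[m] ⁻¹' Z) (m + 1) (n + 1) (σ^[n] ⁻¹' Z ∩ V) := by
  have h : ∀ Z : S.P 0, c.E (U ∩ σ^[m] ⁻¹' Z) (m + 1) (n + 1) (σ^[n] ⁻¹' Z ∩ V) =
      c.M U * c.tp m * (c.M Z * c.t * star c.t * c.M Z) * (star (c.tp n) * c.M V) := by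
    intro Z
    have hZ := S.isClopen Z.2
    rw [E, c.tp_succ, c.tp_succ, star_mul, ← mul_assoc (c.M _),
      ← c.M_mul_tp_mul m hU hZ, ← c.M_mul (isClopen_iterate σ hZ n) hV]
    have h1 : star c.t * star (c.tp n) * (c.M (σ^[n] ⁻¹' Z) * c.M V) =
        star c.t * (star (c.tp n) * c.M (σ^[n] ⁻¹' Z)) * c.M V := by simp only [mul_assoc]
    rw [h1, ← c.star_tp_mul n hZ]
    simp only [mul_assoc]
  simp only [h]
  rw [← Finset.sum_mul, ← Finset.mul_sum, c.sum_range_part, mul_assoc (c.M U), c.tp_mul_M_univ]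
  rfl

/-- The projections M(σ^m U) and M(σ^n V) can be inserted in the middle, and these two sets are
disjoint. Applied in the colimit, this disposes of the terms that evaluation at points of the
groupoid cannot detect. -/
theorem E_eq_zero {U V : Set X} (hU : IsClopen U) (hV : IsClopen V) (m n : ℕ)
    (h : ∀ x ∈ U, ∀ y ∈ V, σ^[m] x ≠ σ^[n] y) : c.E U m n V = 0 := by
  have him : ∀ {W : Set X} (k : ℕ), IsClopen W → IsClopen (σ^[k] '' W) := by
    intro W k hW
    exact ⟨(hW.1.isCompact.image (σ.continuous.iterate k)).isClosed,
      (DR.isLocalHomeomorph_iterate σ k).isOpenMap W hW.2⟩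
  have h1 : c.M U * c.tp m = c.M U * c.tp m * c.M (σ^[m] '' U) := by
    rw [mul_assoc, c.M_mul_tp_mul m hU (him m hU), Set.inter_eq_left.mpr
      (Set.subset_preimage_image _ _)]
  have h2 : star (c.tp n) * c.M V = c.M (σ^[n] '' V) * (star (c.tp n) * c.M V) := by
    rw [← mul_assoc, c.star_tp_mul n (him n hV), mul_assoc, c.M_mul_of_superset hV
      (isClopen_iterate σ (him n hV) n) (Set.subset_preimage_image _ _)]
  rw [E, h1, h2, mul_assoc, ← mul_assoc (c.M (σ^[m] '' U)), c.M_mul_of_disjoint (him m hU) (him n hV),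
    zero_mul, mul_zero]
  rw [Set.disjoint_left]
  rintro _ ⟨x, hx, rfl⟩ ⟨y, hy, hxy⟩
  exact h x hx y hy hxy.symm

theorem M_eq_E {U : Set X} (hU : IsClopen U) : c.M U = c.E U 0 0 U := by
  rw [E, tp, c.star_M isClopen_univ, c.M_mul_of_subset hU isClopen_univ (Set.subset_univ U),
    c.M_mul_of_superset hU isClopen_univ (Set.subset_univ U), c.M_mul_self hU]

variable [Module ℂ A] [IsScalarTower ℂ A A] [SMulCommClass ℂ A A] [StarModule ℂ A]

/-- The linear span of the elements `E U m n V`. -/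
def spanE : Submodule ℂ A :=
  Submodule.span ℂ {a | ∃ U m n V, IsClopen U ∧ IsClopen V ∧ a = c.E U m n V}

theorem E_mem_spanE {U V : Set X} (hU : IsClopen U) (hV : IsClopen V) (m n : ℕ) :
    c.E U m n V ∈ c.spanE := Submodule.subset_span ⟨U, m, n, V, hU, hV, rfl⟩

/-- The criterion serves to show that the span is stable under left multiplication by M(W), t and
t*; these three cases suffice to identify it with the whole colimit. -/
theorem mul_mem_spanE_of {a : A} (h : ∀ U m n V, IsClopen U → IsClopen V → a * c.E U m n V ∈ c.spanE)
    {x : A} (hx : x ∈ c.spanE) : a * x ∈ c.spanE := by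
  have : c.spanE ≤ c.spanE.comap (LinearMap.mulLeft ℂ a) := by
    refine Submodule.span_le.mpr ?_
    rintro _ ⟨U, m, n, V, hU, hV, rfl⟩
    exact h U m n V hU hV
  exact this hx

theorem M_mul_mem_spanE {W : Set X} (hW : IsClopen W) {x : A} (hx : x ∈ c.spanE) :
    c.M W * x ∈ c.spanE := c.mul_mem_spanE_of (fun U m n V hU hV => by
  rw [c.M_mul_E hW hU]
  exact c.E_mem_spanE (hW.inter hU) hV m n) hx

theorem t_mul_mem_spanE {x : A} (hx : x ∈ c.spanE) : c.t * x ∈ c.spanE :=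
  c.mul_mem_spanE_of (fun U m n V hU hV => by
    rw [c.t_mul_E hU]
    exact c.E_mem_spanE (isClopen_preimage σ hU) hV _ n) hx

theorem star_t_mul_mem_spanE {x : A} (hx : x ∈ c.spanE) : star c.t * x ∈ c.spanE :=
  c.mul_mem_spanE_of (fun U m n V hU hV => by
    cases m with
    | zero =>
      rw [c.star_t_mul_E_zero hU hV]
      exact c.E_mem_spanE isClopen_univ ((isClopen_iterate σ hU n).inter hV) _ _
    | succ m =>
      -- Cutting U along P_0 makes σ injective on each piece, as the transfer relation requires.
      rw [c.E_eq_sum_left hU _ n 0, Finset.mul_sum]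
      refine Submodule.sum_mem _ fun Z _ => ?_
      have hUZ := hU.inter (S.isClopen Z.2)
      rw [c.star_t_mul_E_succ Z.2 hUZ Set.inter_subset_right]
      exact c.E_mem_spanE (isClopen_image σ hUZ) hV _ _) hx

/-! ### The homomorphism on the colimit -/

theorem layerHom_p (n : ℕ) : c.layerHom n (S.p n) = entry n.bodd n.bodd (c.M Set.univ) := by
  rw [RefinedSeq.p, map_sum, ← c.sum_M_part n, entry_sum]
  rfl

theorem layerHom_p_even (n : ℕ) :
    c.layerHom (2 * n) (S.p (2 * n)) = entry false false (c.M Set.univ) := by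
  rw [c.layerHom_p, bodd_two_mul]

/-- The homomorphism of the corner of the layer `2n` given by a covariant representation. -/
def cornerHom (n : ℕ) : S.A n →⋆ₙₐ[ℂ] A :=
  cornerEntry (c.layerHom (2 * n)) (S.isStarProjection_p _) (c.layerHom_p_even n)

/-- The homomorphism of the colimit of the corners given by a covariant representation. -/
def infHom : S.AInf →⋆ₙₐ[ℂ] A := SeqLim.lift c.cornerHom fun n x => by
  show c.layerHom (2 * n + 1 + 1) (S.connect (2 * n + 1) (S.connect (2 * n) (x : S.L (2 * n)))) false
    false = c.layerHom (2 * n) x false false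
  rw [layerHom_connect, layerHom_connect]

theorem infHom_of (n : ℕ) (x : S.A n) :
    c.infHom (SeqLim.of S.φA n x) = c.layerHom (2 * n) x false false := rfl

theorem infHom_vertexElt (n : ℕ) (Z : S.P (2 * n)) :
    c.infHom (SeqLim.of S.φA n (S.vertexElt n Z)) = c.M Z := by
  rw [infHom_of]
  show c.layerHom (2 * n) ((S.layer (2 * n)).v (.inl Z)) false false = _
  rw [layerHom_inl, bodd_two_mul, entry_apply_same]

theorem infHom_edgeElt (n : ℕ) (e f : S.Edge (2 * n)) :
    c.infHom (SeqLim.of S.φA n (S.edgeElt n e f)) = c.chi e * star (c.chi f) := by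
  rw [infHom_of]
  show c.layerHom (2 * n) ((S.layer (2 * n)).e e * star ((S.layer (2 * n)).e f)) false false = _
  rw [map_mul, map_star, layerHom_e, layerHom_e, star_entry, entry_mul, bodd_two_mul,
    entry_apply_same]

theorem chi_even {n : ℕ} (hn : Even n) (e : S.Edge n) :
    c.chi e = c.M (S.edgeSet e) * c.tp (S.edgeDeg e) * c.M (S.ends e).2 := by
  rcases e with e | f
  · have hW := S.isClopen e.1.2.2
    show c.M e.1.2 = c.M e.1.2 * c.M Set.univ * c.M e.1.2
    rw [c.M_mul_of_subset hW isClopen_univ (Set.subset_univ _), c.M_mul_self hW]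
  · have hW := S.isClopen f.1.2.2
    have hZ := S.isClopen f.1.1.2
    rw [c.chi_red_even hn]
    show _ = c.M (f.1.1 ∩ σ ⁻¹' f.1.2) * (c.t * c.M Set.univ) * c.M f.1.2
    rw [c.t_mul_M_univ, ← c.M_mul hZ (isClopen_preimage σ hW), mul_assoc (c.M f.1.1) (c.M _),
      ← c.t_mul hW, mul_assoc, mul_assoc, mul_assoc, c.M_mul_self hW]

theorem isClopen_edgeSet {n : ℕ} (e : S.Edge n) : IsClopen (S.edgeSet e) := by
  rcases e with e | f
  · exact S.isClopen e.1.2.2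
  · exact (S.isClopen f.1.1.2).inter (isClopen_preimage σ (S.isClopen f.1.2.2))

theorem edgeSet_subset {n : ℕ} (e : S.Edge n) :
    S.edgeSet e ⊆ σ^[S.edgeDeg e] ⁻¹' (S.ends e).2 := by
  rcases e with e | f
  · exact le_rfl
  · exact Set.inter_subset_right

/-- The set of an edge is contained in the preimage of its source under the matching power of σ. So
the source projection disappears from both factors, and only M(Y_e) t^d remains on each side. -/
theorem chi_mul_star_chi {n : ℕ} (hn : Even n) (e f : S.Edge n) (h : (S.ends e).2 = (S.ends f).2) :
    c.chi e * star (c.chi f) = c.E (S.edgeSet e) (S.edgeDeg e) (S.edgeDeg f) (S.edgeSet f) := by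
  have hs : ∀ e : S.Edge n, c.chi e = c.M (S.edgeSet e) * c.tp (S.edgeDeg e) := by
    intro e
    rw [c.chi_even hn, mul_assoc, c.M_mul_tp_mul _ (isClopen_edgeSet e) (RefinedSeq.isClopen_snd e),
      Set.inter_eq_left.mpr (edgeSet_subset e)]
  rw [hs, hs, star_mul, c.star_M (isClopen_edgeSet f)]
  rfl

end CovRep

/-! ### The covariant representation in the Steinberg algebra. -/

section SteinbergRep

open DR Steinberg

variable {X : Type u} [MetricSpace X] [CompactSpace X] [TotallyDisconnectedSpace X] {σ : LHomeo X}

namespace DR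

/-- The element `(x, m, σ^m x)` of the groupoid. -/
def path (m : ℕ) (x : X) : DR σ := ⟨(x, (m : ℤ), σ^[m] x), m, 0, by simp, rfl⟩

/-- The product of the inverse of `(x, m, σ^m x)`, where `x` is the range of `γ`, and `γ`. -/
def shift (m : ℕ) (γ : DR σ) : DR σ := mul (inv (path m (rng γ))) γ rfl

@[simp] theorem rng_shift (m : ℕ) (γ : DR σ) : rng (shift m γ) = σ^[m] (rng γ) := rfl
@[simp] theorem src_shift (m : ℕ) (γ : DR σ) : src (shift m γ) = src γ := rfl
@[simp] theorem deg_shift (m : ℕ) (γ : DR σ) : deg (shift m γ) = -m + deg γ := rfl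

theorem shift_zero (γ : DR σ) : shift 0 γ = γ :=
  ext' rfl (show -((0 : ℕ) : ℤ) + deg γ = deg γ by simp) rfl

theorem shift_shift_one (m : ℕ) (γ : DR σ) : shift m (shift 1 γ) = shift (m + 1) γ :=
  ext' rfl (show -(m : ℤ) + (-((1 : ℕ) : ℤ) + deg γ) = -((m + 1 : ℕ) : ℤ) + deg γ by
    push_cast; ring) rfl

theorem isClopen_cyl {U V : Set X} (hU : IsClopen U) (hV : IsClopen V) (m n : ℕ) :
    IsClopen (cyl σ U m n V) := ⟨(isCompact_cyl hU.1 hV.1 m n).isClosed, isOpen_cyl hU.2 hV.2 m n⟩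

theorem isOpen_image_rng {O : Set (DR σ)} (hO : IsOpen O) : IsOpen (rng '' O) := by
  rw [isOpen_iff_mem_nhds]
  rintro _ ⟨γ, hγ, rfl⟩
  filter_upwards [eventually_rng (hO.mem_nhds hγ)] with x hx
  exact hx

theorem isBisection_unit {U : Set X} (hU : IsClopen U) : IsBisection (cyl σ U 0 0 U) where
  isCompact := isCompact_cyl hU.1 hU.1 0 0
  isOpen := isOpen_cyl hU.2 hU.2 0 0
  rng_inj := fun α hα β hβ h => ext' h (hα.2.2.1.trans hβ.2.2.1.symm)
    (hα.2.2.2.symm.trans (h.trans hβ.2.2.2))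
  src_inj := fun α hα β hβ h => ext' (hα.2.2.2.trans (h.trans hβ.2.2.2.symm))
    (hα.2.2.1.trans hβ.2.2.1.symm) h

theorem isBisection_graph {U : Set X} (hU : IsClopen U) (hi : Set.InjOn σ U) :
    IsBisection (cyl σ U 1 0 Set.univ) where
  isCompact := isCompact_cyl hU.1 isClosed_univ 1 0
  isOpen := isOpen_cyl hU.2 isOpen_univ 1 0
  rng_inj := fun α hα β hβ h => ext' h (hα.2.2.1.trans hβ.2.2.1.symm)
    (hα.2.2.2.symm.trans ((congrArg σ h).trans hβ.2.2.2))
  src_inj := fun α hα β hβ h => ext' (hi hα.1 hβ.1 (hα.2.2.2.trans (h.trans hβ.2.2.2.symm)))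
    (hα.2.2.1.trans hβ.2.2.1.symm) h

end DR

namespace Steinberg

open Classical in
/-- The characteristic function of the units in a clopen set. -/
def unitInd (σ : LHomeo X) (U : Set X) : Steinberg σ :=
  if h : IsClopen U then ⟨(cyl σ U 0 0 U).indicator fun _ => 1, indicator_mem (isBisection_unit h) 1⟩
  -- A default value: all laws of the measure concern clopen sets only.
  else 0

theorem unitInd_val {U : Set X} (hU : IsClopen U) :
    (unitInd σ U).1 = (cyl σ U 0 0 U).indicator fun _ => 1 :=
  congrArg Subtype.val (dif_pos hU)

open Classical in
theorem unitInd_apply {U : Set X} (hU : IsClopen U) (γ : DR σ) :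
    unitInd σ U γ = if rng γ ∈ U ∧ deg γ = 0 ∧ rng γ = src γ then 1 else 0 := by
  rw [unitInd_val hU, Set.indicator_apply]
  congr 1
  simp only [cyl, Set.mem_ofPred_eq, eq_iff_iff]
  constructor
  · rintro ⟨h1, -, h2, h3⟩
    exact ⟨h1, by simpa using h2, h3⟩
  · rintro ⟨h1, h2, h3⟩
    exact ⟨h1, h3 ▸ h1, by simpa using h2, h3⟩

theorem star_unitInd {U : Set X} (hU : IsClopen U) : star (unitInd σ U) = unitInd σ U := by
  classical
  refine Steinberg.ext fun γ => ?_
  rw [Steinberg.star_apply, unitInd_apply hU, unitInd_apply hU]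
  have : (rng (inv γ) ∈ U ∧ deg (inv γ) = 0 ∧ rng (inv γ) = src (inv γ)) ↔
      (rng γ ∈ U ∧ deg γ = 0 ∧ rng γ = src γ) := by
    simp only [rng_inv, src_inv, deg_inv, neg_eq_zero]
    constructor
    · rintro ⟨h1, h2, h3⟩; exact ⟨h3 ▸ h1, h2, h3.symm⟩
    · rintro ⟨h1, h2, h3⟩; exact ⟨h3 ▸ h1, h2, h3.symm⟩
  simp only [this]
  split_ifs <;> simp

variable (σ) in
/-- The characteristic function of the graph of `σ`. -/
def graphInd : Steinberg σ :=
  ⟨(cyl σ Set.univ 1 0 Set.univ).indicator fun _ => 1, by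
    have hc : IsClopen (cyl σ Set.univ 1 0 Set.univ) := isClopen_cyl isClopen_univ isClopen_univ 1 0
    refine ⟨?_, HasCompactSupport.intro (isCompact_cyl isClosed_univ isClosed_univ 1 0)
      fun γ hγ => Set.indicator_of_notMem hγ _⟩
    rw [IsLocallyConstant.iff_eventually_eq]
    intro γ
    by_cases hγ : γ ∈ cyl σ Set.univ 1 0 Set.univ
    · filter_upwards [hc.2.mem_nhds hγ] with β hβ
      rw [Set.indicator_of_mem hβ, Set.indicator_of_mem hγ]
    · filter_upwards [hc.compl.2.mem_nhds hγ] with β hβ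
      rw [Set.indicator_of_notMem hβ, Set.indicator_of_notMem hγ]⟩

open Classical in
theorem graphInd_apply (γ : DR σ) :
    graphInd σ γ = if deg γ = 1 ∧ σ (rng γ) = src γ then 1 else 0 := by
  show (cyl σ Set.univ 1 0 Set.univ).indicator (fun _ => (1 : ℂ)) γ = _
  rw [Set.indicator_apply]
  congr 1
  simp only [cyl, Set.mem_ofPred_eq, eq_iff_iff]
  constructor
  · rintro ⟨-, -, h2, h3⟩
    exact ⟨by simpa using h2, h3⟩
  · rintro ⟨h2, h3⟩
    exact ⟨trivial, trivial, by simpa using h2, h3⟩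

open Classical in
theorem unitInd_mul_apply {U : Set X} (hU : IsClopen U) (g : Steinberg σ) (γ : DR σ) :
    (unitInd σ U * g) γ = if rng γ ∈ U then g γ else 0 := by
  rw [mul_apply, unitInd_val hU]
  split_ifs with h
  · rw [conv_indicator (isBisection_unit hU) 1 g.1 γ (path 0 (rng γ)) ⟨h, h, rfl, rfl⟩ rfl, one_mul]
    exact congrArg g.1 (shift_zero γ)
  · exact conv_indicator_of_not 1 g.1 γ fun β hβ hr => h (hr ▸ hβ.1)

/-- The graph of σ need not be a bisection, as σ need not be injective, but it contains exactly one
element with a given range. So a single term of the convolution survives. -/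
theorem graphInd_mul_apply (g : Steinberg σ) (γ : DR σ) : (graphInd σ * g) γ = g (shift 1 γ) := by
  classical
  rw [mul_apply, conv, finsum_eq_single _ ⟨shift 1 γ, rfl⟩]
  · have : graphInd σ (mul γ (inv (shift 1 γ)) rfl) = 1 := by
      rw [graphInd_apply, if_pos]
      exact ⟨show deg γ + -(-((1 : ℕ) : ℤ) + deg γ) = 1 by push_cast; ring, rfl⟩
    rw [show (graphInd σ).1 (mul γ (inv (shift 1 γ)) rfl) = 1 from this, one_mul]
  · rintro ⟨α, hα⟩ hne
    have : graphInd σ (mul γ (inv α) hα.symm) = 0 := by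
      rw [graphInd_apply, if_neg]
      rintro ⟨h1, h2⟩
      apply hne
      apply Subtype.ext
      refine ext' h2.symm ?_ hα
      have h3 : deg γ + -deg α = 1 := h1
      show deg α = -((1 : ℕ) : ℤ) + deg γ
      push_cast
      omega
    rw [show (graphInd σ).1 (mul γ (inv α) hα.symm) = 0 from this, zero_mul]

open Classical in
theorem unitInd_mul_graphInd_val {U : Set X} (hU : IsClopen U) :
    (unitInd σ U * graphInd σ).1 = (cyl σ U 1 0 Set.univ).indicator fun _ => 1 := by
  funext γ
  rw [unitInd_mul_apply hU, graphInd_apply, Set.indicator_apply, ← ite_and]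
  congr 1
  simp only [cyl, Set.mem_ofPred_eq, eq_iff_iff]
  constructor
  · rintro ⟨h1, h2, h3⟩
    exact ⟨h1, trivial, by simpa using h2, h3⟩
  · rintro ⟨h1, -, h2, h3⟩
    exact ⟨h1, by simpa using h2, h3⟩

open Classical in
-- Over U the graph is a bisection, so the convolution can be evaluated by `conv_indicator`: the
-- element of the inverse graph with range r(γ) is (σ y, -1, y), for the only y in U above r(γ).
theorem star_mul_self_graph {U : Set X} (hU : IsClopen U) (hi : Set.InjOn σ U) :
    star (unitInd σ U * graphInd σ) * (unitInd σ U * graphInd σ) = unitInd σ (σ '' U) := by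
  have hB := isBisection_graph hU hi
  have hs : (star (unitInd σ U * graphInd σ)).1 =
      (DR.inv ⁻¹' cyl σ U 1 0 Set.univ).indicator fun _ => (1 : ℂ) := by
    funext γ
    show star ((unitInd σ U * graphInd σ).1 (DR.inv γ)) = _
    rw [unitInd_mul_graphInd_val hU, Set.indicator_apply, Set.indicator_apply]
    simp only [Set.mem_preimage]
    split_ifs <;> simp
  refine Steinberg.ext fun γ => ?_
  rw [mul_apply, hs, unitInd_apply (isClopen_image σ hU)]
  by_cases h : rng γ ∈ σ '' U
  · obtain ⟨y, hy, hyr⟩ := h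
    have hmem : inv (path 1 y) ∈ DR.inv ⁻¹' cyl σ U 1 0 Set.univ := ⟨hy, trivial, rfl, rfl⟩
    rw [conv_indicator hB.inv 1 _ γ (inv (path 1 y)) hmem hyr, one_mul,
      unitInd_mul_graphInd_val hU, Set.indicator_apply]
    congr 1
    simp only [eq_iff_iff]
    constructor
    · rintro ⟨h1, -, h2, h3⟩
      refine ⟨⟨y, hy, hyr⟩, ?_, ?_⟩
      · have h4 : deg γ + 1 = 1 := by
          rw [add_comm]; simpa [path, deg, mul, inv] using h2
        omega
      · rw [← hyr]; exact h3
    · rintro ⟨-, h2, h3⟩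
      refine ⟨hy, trivial, ?_, hyr.trans h3⟩
      show - -((1 : ℕ) : ℤ) + deg γ = _
      rw [h2]; simp
  · rw [if_neg fun h' => h h'.1]
    refine conv_indicator_of_not 1 _ γ fun β hβ hr => h ⟨src β, hβ.1, ?_⟩
    rw [← hr]
    exact hβ.2.2.2

end Steinberg

open Classical in
/-- The canonical covariant representation in the Steinberg algebra. -/
def steinbergRep (S : RefinedSeq σ) : CovRep S (Steinberg σ) where
  M := unitInd σ
  t := graphInd σ
  M_mul := by
    intro U V hU hV
    refine Steinberg.ext fun γ => ?_
    rw [unitInd_mul_apply hU, unitInd_apply hV, unitInd_apply (hU.inter hV), ← ite_and]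
    simp only [Set.mem_inter_iff, and_assoc]
  star_M := star_unitInd
  M_union := by
    intro U V hU hV h
    refine Steinberg.ext fun γ => ?_
    rw [Steinberg.add_apply, unitInd_apply hU, unitInd_apply hV, unitInd_apply (hU.union hV)]
    have hd : rng γ ∈ U → rng γ ∉ V := fun h1 h2 => Set.disjoint_left.mp h h1 h2
    by_cases h1 : rng γ ∈ U <;> by_cases h2 : rng γ ∈ V <;> simp [h1, h2] at hd ⊢
  M_univ_mul_t := by
    refine Steinberg.ext fun γ => ?_
    rw [unitInd_mul_apply isClopen_univ, if_pos (Set.mem_univ _)]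
  t_mul := by
    intro U hU
    refine Steinberg.ext fun γ => ?_
    rw [graphInd_mul_apply, unitInd_apply hU, unitInd_mul_apply (isClopen_preimage σ hU),
      graphInd_apply, ← ite_and]
    congr 1
    simp only [rng_shift, deg_shift, src_shift, eq_iff_iff, Function.iterate_one, Set.mem_preimage]
    constructor
    · rintro ⟨h1, h2, h3⟩; exact ⟨h1, by push_cast at h2; omega, h3⟩
    · rintro ⟨h1, h2, h3⟩; exact ⟨h1, by push_cast; omega, h3⟩
  range_part := by
    intro Z hZ
    have hZc := S.isClopen hZ
    -- Only left multiplications by M(Z) and t have explicit formulas; a right multiplication is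
    -- reached through the adjoint.
    have h1 : star (graphInd σ) * unitInd σ Z = star (unitInd σ Z * graphInd σ) := by
      rw [star_mul, star_unitInd hZc]
    rw [mul_assoc, mul_assoc, h1]
    refine Steinberg.ext fun γ => ?_
    rw [unitInd_mul_apply hZc, graphInd_mul_apply, Steinberg.star_apply, unitInd_mul_apply hZc,
      graphInd_apply, unitInd_apply hZc]
    simp only [rng_inv, src_inv, deg_inv, rng_shift, src_shift, deg_shift, Function.iterate_one]
    by_cases hr : rng γ ∈ Z
    · by_cases hs : src γ ∈ Z
      -- Injectivity of σ on Z turns the equality of the images of source and range into equality of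
      -- the points themselves.
      · have : (-(-((1 : ℕ) : ℤ) + deg γ) = 1 ∧ σ (src γ) = σ (rng γ)) ↔
            (deg γ = 0 ∧ rng γ = src γ) := by
          constructor
          · rintro ⟨h1, h2⟩
            exact ⟨by push_cast at h1; omega, S.injOn 0 Z hZ hr hs h2.symm⟩
          · rintro ⟨h1, h2⟩
            exact ⟨by push_cast; omega, by rw [h2]⟩
        simp only [this, hr, hs, if_true, true_and]
        split_ifs <;> simp
      · have : ¬(deg γ = 0 ∧ rng γ = src γ) := fun h => hs (h.2 ▸ hr)
        simp [hr, hs, this]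
    · simp [hr]
  transfer_part := by
    intro Z hZ
    have hZc := S.isClopen hZ
    rw [← star_mul_self_graph hZc (S.injOn 0 Z hZ), star_mul, star_unitInd hZc, mul_assoc,
      mul_assoc, ← mul_assoc (unitInd σ Z)]
    congr 2
    refine Steinberg.ext fun γ => ?_
    rw [unitInd_mul_apply hZc, unitInd_apply hZc, ← ite_and]
    simp

theorem steinbergRep_tp_mul_apply (S : RefinedSeq σ) (m : ℕ) (g : Steinberg σ) (γ : DR σ) :
    ((steinbergRep S).tp m * g) γ = g (shift m γ) := by
  classical
  induction m generalizing γ with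
  | zero =>
    have h1 := unitInd_mul_apply (σ := σ) isClopen_univ g γ
    rw [if_pos (Set.mem_univ _)] at h1
    rw [shift_zero]
    exact h1
  | succ m ih =>
    have h1 : ((steinbergRep S).tp (m + 1) * g) γ = ((steinbergRep S).tp m * g) (shift 1 γ) := by
      rw [← graphInd_mul_apply, ← mul_assoc]
      rfl
    rw [h1, ih, shift_shift_one]

/-- Rewriting the element as M(U) (t^m (M(V) (t^n M(X)))*) leaves only left multiplications and
adjoints. Each left multiplication either restricts the range or shifts the argument along σ, so the
value at γ can be read off. -/
theorem steinbergRep_E_apply (S : RefinedSeq σ) {U V : Set X} (hU : IsClopen U) (hV : IsClopen V)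
    (m n : ℕ) : ((steinbergRep S).E U m n V : DR σ → ℂ) = (cyl σ U m n V).indicator fun _ => 1 := by
  classical
  have h1 : (steinbergRep S).E U m n V = unitInd σ U *
      ((steinbergRep S).tp m * star (unitInd σ V * ((steinbergRep S).tp n * unitInd σ Set.univ))) := by
    have h2 : (steinbergRep S).tp n * unitInd σ Set.univ = (steinbergRep S).tp n :=
      (steinbergRep S).tp_mul_M_univ n
    rw [h2, star_mul, star_unitInd hV, CovRep.E, mul_assoc]
    rfl
  funext γ
  rw [h1, unitInd_mul_apply hU, steinbergRep_tp_mul_apply, Steinberg.star_apply,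
    unitInd_mul_apply hV, steinbergRep_tp_mul_apply, unitInd_apply isClopen_univ, Set.indicator_apply]
  have h3 : γ ∈ cyl σ U m n V ↔ rng γ ∈ U ∧ src γ ∈ V ∧ deg γ = m - n ∧
    σ^[m] (rng γ) = σ^[n] (src γ) := Iff.rfl
  have h4 : (rng (shift n (inv (shift m γ))) ∈ Set.univ ∧ deg (shift n (inv (shift m γ))) = 0 ∧
      rng (shift n (inv (shift m γ))) = src (shift n (inv (shift m γ)))) ↔
      (deg γ = m - n ∧ σ^[m] (rng γ) = σ^[n] (src γ)) := by
    simp only [Set.mem_univ, true_and, rng_shift, src_shift, deg_shift, rng_inv, src_inv, deg_inv]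
    constructor
    · rintro ⟨a, b⟩; exact ⟨by omega, b.symm⟩
    · rintro ⟨a, b⟩; exact ⟨by omega, b.symm⟩
  simp only [h4]
  simp only [h3, rng_inv, src_shift]
  split_ifs <;> simp_all

theorem exists_cyl_mem {γ : DR σ} {O : Set (DR σ)} (hO : O ∈ nhds γ) :
    ∃ U V m n, IsClopen U ∧ IsClopen V ∧ γ ∈ cyl σ U m n V ∧ cyl σ U m n V ⊆ O := by
  obtain ⟨m, n, h⟩ := exists_mem_cyl γ
  obtain ⟨U, hU, V, hV, hUV⟩ := exists_nhds h hO
  obtain ⟨U', hU', hUs⟩ := (nhds_basis_clopen (rng γ)).mem_iff.mp hU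
  obtain ⟨V', hV', hVs⟩ := (nhds_basis_clopen (src γ)).mem_iff.mp hV
  exact ⟨U', V', m, n, hU'.2, hV'.2, ⟨hU'.1, hV'.1, h.2.2⟩,
    fun β hβ => hUV ⟨hUs hβ.1, hVs hβ.2.1, hβ.2.2⟩⟩

/-- The characteristic function of a bisection. -/
def bisInd {B : Set (DR σ)} (hB : IsBisection B) : Steinberg σ :=
  ⟨B.indicator fun _ => 1, indicator_mem hB 1⟩

open Classical in
theorem bisInd_apply {B : Set (DR σ)} (hB : IsBisection B) (γ : DR σ) :
    bisInd hB γ = if γ ∈ B then 1 else 0 :=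
  Set.indicator_apply B (fun _ => (1 : ℂ)) γ

/-- Compactness covers B by finitely many cylinders inside B. They may overlap, so they are peeled
off by their ranges: over the range of a cylinder C the bisection B coincides with C, and what is
left is B cut down to the remaining ranges. For this the induction keeps a variable clopen set U of
admitted ranges. -/
theorem bisInd_mem_spanE (S : RefinedSeq σ) {B : Set (DR σ)} (hB : IsBisection B) :
    bisInd hB ∈ (steinbergRep S).spanE := by
  classical
  have key : ∀ (T : Finset (Set (DR σ))), (∀ C ∈ T, C ⊆ B ∧ ∃ U V m n, IsClopen U ∧ IsClopen V ∧
      C = cyl σ U m n V) → ∀ U : Set X, IsClopen U → (∀ γ ∈ B, rng γ ∈ U → ∃ C ∈ T, γ ∈ C) →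
      unitInd σ U * bisInd hB ∈ (steinbergRep S).spanE := by
    intro T
    induction T using Finset.induction_on with
    | empty =>
      intro _ U hU h
      have : unitInd σ U * bisInd hB = 0 := by
        refine Steinberg.ext fun γ => ?_
        rw [unitInd_mul_apply hU]
        split_ifs with hr
        · rw [bisInd_apply, if_neg]
          · rfl
          intro hγ
          obtain ⟨C, hC, -⟩ := h γ hγ hr
          simp at hC
        · rfl
      rw [this]
      exact Submodule.zero_mem _
    | insert C T hC ih =>
      intro hT U hU h
      obtain ⟨hCB, U', V', m, n, hU', hV', hCeq⟩ := hT C (Finset.mem_insert_self C T)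
      have hCc : IsClopen C := hCeq ▸ isClopen_cyl hU' hV' m n
      have hR : IsClopen (rng '' C) := ⟨((hCeq ▸ isCompact_cyl hU'.1 hV'.1 m n :
        IsCompact C).image continuous_rng).isClosed, isOpen_image_rng hCc.2⟩
      have h1 : unitInd σ U * bisInd hB = unitInd σ U * (steinbergRep S).E U' m n V' +
          unitInd σ (U \ rng '' C) * bisInd hB := by
        refine Steinberg.ext fun γ => ?_
        rw [Steinberg.add_apply, unitInd_mul_apply hU, unitInd_mul_apply hU,
          unitInd_mul_apply (hU.diff hR), steinbergRep_E_apply S hU' hV', ← hCeq, bisInd_apply,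
          Set.indicator_apply]
        by_cases hr : rng γ ∈ U
        · by_cases hr' : rng γ ∈ rng '' C
          -- The range map is injective on B, so a point of B whose range is that of a point of C ⊆
          -- B lies in C.
          · have : γ ∈ B ↔ γ ∈ C := by
              obtain ⟨β, hβ, hβr⟩ := hr'
              refine ⟨fun hγ => ?_, fun hγ => hCB hγ⟩
              rwa [← hB.rng_inj (hCB hβ) hγ hβr]
            simp only [this, Set.mem_sdiff, hr, hr', not_true, and_false,
              if_true, if_false, add_zero]
          · have : γ ∉ C := fun h => hr' ⟨γ, h, rfl⟩
            simp [this, hr, hr']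
        · simp [hr]
      rw [h1]
      refine Submodule.add_mem _ ((steinbergRep S).M_mul_mem_spanE hU
        ((steinbergRep S).E_mem_spanE hU' hV' m n))
        (ih (fun D hD => hT D (Finset.mem_insert_of_mem hD)) _ (hU.diff hR) ?_)
      intro γ hγ hr
      obtain ⟨D, hD, hγD⟩ := h γ hγ hr.1
      rcases Finset.mem_insert.mp hD with rfl | hD
      · exact absurd ⟨γ, hγD, rfl⟩ hr.2
      · exact ⟨D, hD, hγD⟩
  choose! U V m n hU hV hmem hsub using fun (γ : DR σ) (hγ : γ ∈ B) =>
    exists_cyl_mem (hB.isOpen.mem_nhds hγ)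
  obtain ⟨T, hT, hcov⟩ := hB.isCompact.elim_nhds_subcover (fun γ => cyl σ (U γ) (m γ) (n γ) (V γ))
    (fun γ hγ => (isOpen_cyl (hU γ hγ).2 (hV γ hγ).2 _ _).mem_nhds (hmem γ hγ))
  have := key (T.image fun γ => cyl σ (U γ) (m γ) (n γ) (V γ)) ?_ Set.univ isClopen_univ ?_
  · have h1 : unitInd σ Set.univ * bisInd hB = bisInd hB := by
      refine Steinberg.ext fun γ => ?_
      rw [unitInd_mul_apply isClopen_univ, if_pos (Set.mem_univ _)]
    rwa [h1] at this
  · intro C hC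
    obtain ⟨γ, hγ, rfl⟩ := Finset.mem_image.mp hC
    exact ⟨hsub γ (hT γ hγ), U γ, V γ, m γ, n γ, hU γ (hT γ hγ), hV γ (hT γ hγ), rfl⟩
  · intro γ hγ _
    obtain ⟨β, hβ, h⟩ := Set.mem_iUnion₂.mp (hcov hγ)
    exact ⟨_, Finset.mem_image_of_mem _ hβ, h⟩

theorem spanE_steinbergRep (S : RefinedSeq σ) : (steinbergRep S).spanE = ⊤ := by
  rw [eq_top_iff]
  rintro a -
  refine induction_bisection (P := fun f => ∀ a : Steinberg σ, a.1 = f →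
    a ∈ (steinbergRep S).spanE) ?_ ?_ ?_ a.1 a.2.1 a.2.2 a rfl
  · intro a ha
    obtain rfl : a = 0 := Subtype.ext ha
    exact Submodule.zero_mem _
  · intro f g hf hf' hg hg' h h' a ha
    let x : Steinberg σ := ⟨f, hf, hf'⟩
    let y : Steinberg σ := ⟨g, hg, hg'⟩
    obtain rfl : a = x + y := Subtype.ext ha
    exact Submodule.add_mem _ (h x rfl) (h' y rfl)
  · intro c B hB a ha
    have : a = c • bisInd hB := by
      classical
      refine Steinberg.ext fun γ => ?_
      rw [Steinberg.smul_apply, bisInd_apply]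
      show a.1 γ = _
      rw [ha, Set.indicator_apply]
      simp
    rw [this]
    exact Submodule.smul_mem _ _ (bisInd_mem_spanE S hB)

end SteinbergRep

/-! ### Sums of blue and of red edges in the layers. -/

section Layers

open Classical

variable {X : Type u} [MetricSpace X] [CompactSpace X] {σ : LHomeo X}

namespace RefinedSeq

variable (S : RefinedSeq σ)

/-- The blue edges with range `Z`. -/
def blueFin (n : ℕ) (Z : S.P n) : Finset (S.Edge n) := {e | e ∈ S.blueSet n Z}

/-- The red edges with range `Z`. -/
def redFin (n : ℕ) (Z : S.P n) : Finset (S.Edge n) := {e | e ∈ S.redSet n Z}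

theorem mem_blueFin {n : ℕ} {Z : S.P n} {e : S.Edge n} :
    e ∈ S.blueFin n Z ↔ e.isLeft ∧ (S.ends e).1 = Z := by
  rw [blueFin, Finset.mem_filter, and_iff_right (Finset.mem_univ e)]
  rfl

theorem mem_redFin {n : ℕ} {Z : S.P n} {e : S.Edge n} :
    e ∈ S.redFin n Z ↔ e.isRight ∧ (S.ends e).1 = Z := by
  rw [redFin, Finset.mem_filter, and_iff_right (Finset.mem_univ e)]
  rfl

/-- The members of the `n`-th partition which are contained in `U`. -/
def subFin (n : ℕ) (U : Set X) : Finset (S.P n) :=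
  (Finset.univ : Finset (S.P n)).filter fun W => (W : Set X) ⊆ U

theorem mem_subFin {n : ℕ} {U : Set X} {W : S.P n} : W ∈ S.subFin n U ↔ (W : Set X) ⊆ U := by
  rw [subFin, Finset.mem_filter, and_iff_right (Finset.mem_univ W)]

theorem coe_blueFin (n : ℕ) (Z : S.P n) : (S.blueFin n Z : Set _) = S.blueSet n Z := by
  ext e; simp [blueFin]

theorem coe_redFin (n : ℕ) (Z : S.P n) : (S.redFin n Z : Set _) = S.redSet n Z := by
  ext e; simp [redFin]

/-- A vertex of the range side of a layer. -/
def vl (n : ℕ) (Z : S.P n) : S.L n := (S.layer n).v (.inl Z)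

/-- A vertex of the source side of a layer. -/
def vr (n : ℕ) (W : S.P (n + 1)) : S.L n := (S.layer n).v (.inr W)

/-- An edge of a layer. -/
def ed (n : ℕ) (e : S.Edge n) : S.L n := (S.layer n).e e

/-- The sum of the blue edges of a layer. -/
def blueSum (n : ℕ) : S.L n := ∑ e : S.Edge n with e.isLeft, S.ed n e

/-- The sum of the red edges of a layer. -/
def redSum (n : ℕ) : S.L n := ∑ e : S.Edge n with e.isRight, S.ed n e

theorem star_vl (n : ℕ) (Z : S.P n) : star (S.vl n Z) = S.vl n Z := (S.layer n).star_v _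

theorem star_vr (n : ℕ) (W : S.P (n + 1)) : star (S.vr n W) = S.vr n W := (S.layer n).star_v _

theorem vl_mul_self (n : ℕ) (Z : S.P n) : S.vl n Z * S.vl n Z = S.vl n Z := (S.layer n).v_mul_self _

theorem vl_mul_ne (n : ℕ) {Z W : S.P n} (h : Z ≠ W) : S.vl n Z * S.vl n W = 0 :=
  (S.layer n).v_mul_ne fun h' => h (Sum.inl_injective h')

theorem vr_mul_self (n : ℕ) (W : S.P (n + 1)) : S.vr n W * S.vr n W = S.vr n W :=
  (S.layer n).v_mul_self _

theorem vr_mul_ne (n : ℕ) {Z W : S.P (n + 1)} (h : Z ≠ W) : S.vr n Z * S.vr n W = 0 :=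
  (S.layer n).v_mul_ne fun h' => h (Sum.inr_injective h')

theorem vl_mul_vr (n : ℕ) (Z : S.P n) (W : S.P (n + 1)) : S.vl n Z * S.vr n W = 0 :=
  (S.layer n).v_mul_ne (by simp)

theorem vr_mul_vl (n : ℕ) (Z : S.P n) (W : S.P (n + 1)) : S.vr n W * S.vl n Z = 0 :=
  (S.layer n).v_mul_ne (by simp)

theorem vl_mul_ed (n : ℕ) (Z : S.P n) (e : S.Edge n) :
    S.vl n Z * S.ed n e = if (S.ends e).1 = Z then S.ed n e else 0 := by
  have h : S.vl n (S.ends e).1 * S.ed n e = S.ed n e := (S.layer n).v_mul_e e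
  split_ifs with h'
  · rwa [← h']
  · rw [← h, ← mul_assoc, S.vl_mul_ne n (Ne.symm h'), zero_mul]

theorem ed_mul_vr (n : ℕ) (W : S.P (n + 1)) (e : S.Edge n) :
    S.ed n e * S.vr n W = if (S.ends e).2 = W then S.ed n e else 0 := by
  have h : S.ed n e * S.vr n (S.ends e).2 = S.ed n e := (S.layer n).e_mul_v e
  split_ifs with h'
  · rwa [← h']
  · rw [← h, mul_assoc, S.vr_mul_ne n h', mul_zero]

theorem vr_mul_ed (n : ℕ) (W : S.P (n + 1)) (e : S.Edge n) : S.vr n W * S.ed n e = 0 := by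
  have h := S.vl_mul_ed n (S.ends e).1 e
  rw [if_pos rfl] at h
  rw [← h, ← mul_assoc, S.vr_mul_vl, zero_mul]

theorem ed_mul_vl (n : ℕ) (Z : S.P n) (e : S.Edge n) : S.ed n e * S.vl n Z = 0 := by
  have h := S.ed_mul_vr n (S.ends e).2 e
  rw [if_pos rfl] at h
  rw [← h, mul_assoc, S.vr_mul_vl, mul_zero]

theorem q_mul_ed (n : ℕ) (e : S.Edge n) : S.q n * S.ed n e = 0 := by
  rw [q, Finset.sum_mul]
  exact Finset.sum_eq_zero fun W _ => S.vr_mul_ed n W e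

theorem ed_mul_p (n : ℕ) (e : S.Edge n) : S.ed n e * S.p n = 0 := by
  rw [p, Finset.mul_sum]
  exact Finset.sum_eq_zero fun W _ => S.ed_mul_vl n W e

theorem ed_mul_q (n : ℕ) (e : S.Edge n) : S.ed n e * S.q n = S.ed n e := by
  have h : ∀ W : S.P (n + 1), S.ed n e * (S.layer n).v (.inr W) =
    if (S.ends e).2 = W then S.ed n e else 0 := fun W => S.ed_mul_vr n W e
  rw [q, Finset.mul_sum]
  simp [h]

theorem star_q (n : ℕ) : star (S.q n) = S.q n := by
  rw [q, star_sum]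
  exact Finset.sum_congr rfl fun W _ => S.star_vr n W

theorem p_mul_q (n : ℕ) : S.p n * S.q n = 0 := by
  rw [p, q, Finset.sum_mul_sum]
  exact Finset.sum_eq_zero fun Z _ => Finset.sum_eq_zero fun W _ => S.vl_mul_vr n Z W

theorem q_mul_p (n : ℕ) : S.q n * S.p n = 0 := by
  have := congrArg star (S.p_mul_q n)
  rwa [star_mul, S.star_p, S.star_q, star_zero] at this

theorem p_mul_vl (n : ℕ) (Z : S.P n) : S.p n * S.vl n Z = S.vl n Z := S.p_mul_v n Z

theorem vl_mul_p (n : ℕ) (Z : S.P n) : S.vl n Z * S.p n = S.vl n Z := by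
  have := congrArg star (S.p_mul_vl n Z)
  rwa [star_mul, S.star_p, S.star_vl] at this

theorem q_mul_vr (n : ℕ) (W : S.P (n + 1)) : S.q n * S.vr n W = S.vr n W := by
  rw [q, Finset.sum_mul, Finset.sum_eq_single_of_mem W (Finset.mem_univ _)]
  · exact S.vr_mul_self n W
  · exact fun V _ h => S.vr_mul_ne n h

theorem p_mul_vr (n : ℕ) (W : S.P (n + 1)) : S.p n * S.vr n W = 0 := by
  rw [← S.q_mul_vr, ← mul_assoc, S.p_mul_q, zero_mul]

theorem q_mul_vl (n : ℕ) (Z : S.P n) : S.q n * S.vl n Z = 0 := by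
  rw [← S.p_mul_vl, ← mul_assoc, S.q_mul_p, zero_mul]

theorem p_mul_ed (n : ℕ) (e : S.Edge n) : S.p n * S.ed n e = S.ed n e := S.p_mul_e n e

/-- The sum of all vertices is a unit. -/
theorem unit_mul (n : ℕ) (x : S.L n) : (S.p n + S.q n) * x = x := by
  suffices h : (S.p n + S.q n) * x = x ∧ x * (S.p n + S.q n) = x from h.1
  have hs : star (S.p n + S.q n) = S.p n + S.q n := by rw [star_add, S.star_p, S.star_q]
  refine StarPres.ind x fun t => ?_
  induction t with
  | of y =>
    rcases y with (Z | W) | e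
    · show (S.p n + S.q n) * S.vl n Z = S.vl n Z ∧ S.vl n Z * (S.p n + S.q n) = S.vl n Z
      have h : (S.p n + S.q n) * S.vl n Z = S.vl n Z := by
        rw [add_mul, S.p_mul_vl, S.q_mul_vl, add_zero]
      refine ⟨h, ?_⟩
      have := congrArg star h
      rwa [star_mul, hs, S.star_vl] at this
    · show (S.p n + S.q n) * S.vr n W = S.vr n W ∧ S.vr n W * (S.p n + S.q n) = S.vr n W
      have h : (S.p n + S.q n) * S.vr n W = S.vr n W := by
        rw [add_mul, S.p_mul_vr, S.q_mul_vr, zero_add]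
      refine ⟨h, ?_⟩
      have := congrArg star h
      rwa [star_mul, hs, S.star_vr] at this
    · show (S.p n + S.q n) * S.ed n e = S.ed n e ∧ S.ed n e * (S.p n + S.q n) = S.ed n e
      rw [add_mul, mul_add, S.p_mul_ed, S.q_mul_ed, S.ed_mul_p, S.ed_mul_q, add_zero, zero_add]
      exact ⟨rfl, rfl⟩
  | zero =>
    show (S.p n + S.q n) * 0 = 0 ∧ 0 * (S.p n + S.q n) = 0
    simp
  | add a b ha hb =>
    show (S.p n + S.q n) * (StarPres.mk _ a + StarPres.mk _ b) = StarPres.mk _ a + StarPres.mk _ b ∧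
      (StarPres.mk _ a + StarPres.mk _ b) * (S.p n + S.q n) = StarPres.mk _ a + StarPres.mk _ b
    rw [mul_add, add_mul (StarPres.mk _ a), ha.1, ha.2, hb.1, hb.2]
    exact ⟨rfl, rfl⟩
  | mul a b ha hb =>
    show (S.p n + S.q n) * (StarPres.mk _ a * StarPres.mk _ b) = StarPres.mk _ a * StarPres.mk _ b ∧
      (StarPres.mk _ a * StarPres.mk _ b) * (S.p n + S.q n) = StarPres.mk _ a * StarPres.mk _ b
    rw [← mul_assoc, ha.1, mul_assoc, hb.2]
    exact ⟨rfl, rfl⟩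
  | smul c a ha =>
    show (S.p n + S.q n) * (c • StarPres.mk _ a) = c • StarPres.mk _ a ∧
      (c • StarPres.mk _ a) * (S.p n + S.q n) = c • StarPres.mk _ a
    rw [mul_smul_comm, smul_mul_assoc, ha.1, ha.2]
    exact ⟨rfl, rfl⟩
  | adj a ha =>
    show (S.p n + S.q n) * star (StarPres.mk _ a) = star (StarPres.mk _ a) ∧
      star (StarPres.mk _ a) * (S.p n + S.q n) = star (StarPres.mk _ a)
    constructor
    · conv_lhs => rw [← hs]
      rw [← star_mul, ha.2]
    · conv_lhs => rw [← hs]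
      rw [← star_mul, ha.1]

theorem star_sum_ed_mul_sum_ed (n : ℕ) {Z : S.P n} {s : Finset (S.Edge n)}
    (hs : (s : Set _) ∈ S.sep n Z) :
    star (∑ e ∈ s, S.ed n e) * ∑ e ∈ s, S.ed n e = ∑ e ∈ s, S.vr n (S.ends e).2 := by
  rw [star_sum, Finset.sum_mul_sum]
  refine Finset.sum_congr rfl fun e he => ?_
  rw [Finset.sum_eq_single_of_mem e he]
  · exact (S.layer n).star_e_mul_self e
  · intro f hf hfe
    exact (S.layer n).star_e_mul_ne (z := .inl Z) hs (Finset.mem_coe.mpr he) (Finset.mem_coe.mpr hf)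
      hfe.symm

/-- The products e f* with e ≠ f vanish because the sources differ, so only the sum in the last
Leavitt relation remains. Thus the edges of a member of the separation add up to a partial isometry
with range projection Z. -/
theorem sum_ed_mul_star_sum_ed (n : ℕ) {Z : S.P n} {s : Finset (S.Edge n)}
    (hs : (s : Set _) ∈ S.sep n Z) :
    (∑ e ∈ s, S.ed n e) * star (∑ e ∈ s, S.ed n e) = S.vl n Z := by
  rw [star_sum, Finset.sum_mul_sum]
  have hl : {e | e ∈ s.toList} ∈ (S.layer n).C (.inl Z) := by
    convert (show (s : Set _) ∈ (S.layer n).C (.inl Z) from hs) using 1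
    ext e; simp
  have := (S.layer n).sck2 _ s.nodup_toList hl
  rw [Finset.sum_map_toList] at this
  refine Eq.trans ?_ this.symm
  refine Finset.sum_congr rfl fun e he => Finset.sum_eq_single_of_mem e he fun f hf hfe => ?_
  refine SumMap.e_mul_star_e_of_ne fun h => hfe ?_
  obtain ⟨x, hx⟩ := (S.part (n + 1)).nonempty _ (S.ends e).2.2
  have h' : (S.ends e).2 = (S.ends f).2 := Sum.inr_injective h
  exact eq_of_source_mem hs (Finset.mem_coe.mpr hf) (Finset.mem_coe.mpr he) (h' ▸ hx) hx

theorem vl_mul_blueSum (n : ℕ) (Z : S.P n) : S.vl n Z * S.blueSum n = ∑ e ∈ S.blueFin n Z, S.ed n e := by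
  rw [blueSum, Finset.mul_sum, Finset.sum_congr rfl fun e _ => S.vl_mul_ed n Z e, ← Finset.sum_filter,
    Finset.filter_filter]
  refine Finset.sum_congr ?_ fun _ _ => rfl
  ext e
  simp [S.mem_blueFin]

theorem vl_mul_redSum (n : ℕ) (Z : S.P n) : S.vl n Z * S.redSum n = ∑ e ∈ S.redFin n Z, S.ed n e := by
  rw [redSum, Finset.mul_sum, Finset.sum_congr rfl fun e _ => S.vl_mul_ed n Z e, ← Finset.sum_filter,
    Finset.filter_filter]
  refine Finset.sum_congr ?_ fun _ _ => rfl
  ext e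
  simp [S.mem_redFin]

theorem p_mul_blueSum (n : ℕ) : S.p n * S.blueSum n = S.blueSum n := by
  rw [blueSum, Finset.mul_sum]
  exact Finset.sum_congr rfl fun e _ => S.p_mul_ed n e

theorem p_mul_redSum (n : ℕ) : S.p n * S.redSum n = S.redSum n := by
  rw [redSum, Finset.mul_sum]
  exact Finset.sum_congr rfl fun e _ => S.p_mul_ed n e

theorem blueSum_mul_q (n : ℕ) : S.blueSum n * S.q n = S.blueSum n := by
  rw [blueSum, Finset.sum_mul]
  exact Finset.sum_congr rfl fun e _ => S.ed_mul_q n e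

theorem redSum_mul_q (n : ℕ) : S.redSum n * S.q n = S.redSum n := by
  rw [redSum, Finset.sum_mul]
  exact Finset.sum_congr rfl fun e _ => S.ed_mul_q n e

theorem star_blueSum_mul_vl_mul (n : ℕ) (Z : S.P n) :
    star (S.blueSum n) * S.vl n Z * S.blueSum n = ∑ e ∈ S.blueFin n Z, S.vr n (S.ends e).2 := by
  rw [← S.star_sum_ed_mul_sum_ed n (Z := Z) (.inl (S.coe_blueFin n Z)), ← S.vl_mul_blueSum, star_mul,
    S.star_vl, mul_assoc, mul_assoc, ← mul_assoc (S.vl n Z) (S.vl n Z), S.vl_mul_self]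

/-- Evenness matters: only then is R_Z a single member of the separation, so that e*f = 0 for
distinct red edges e, f with range Z. -/
theorem star_redSum_mul_vl_mul {n : ℕ} (hn : Even n) (Z : S.P n) :
    star (S.redSum n) * S.vl n Z * S.redSum n = ∑ e ∈ S.redFin n Z, S.vr n (S.ends e).2 := by
  rw [← S.star_sum_ed_mul_sum_ed n (Z := Z) (.inr (.inl ⟨hn, S.coe_redFin n Z⟩)), ← S.vl_mul_redSum,
    star_mul, S.star_vl, mul_assoc, mul_assoc, ← mul_assoc (S.vl n Z) (S.vl n Z), S.vl_mul_self]

theorem sum_blueFin {M : Type*} [AddCommMonoid M] (n : ℕ) (Z : S.P n) (f : S.P (n + 1) → M) :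
    ∑ e ∈ S.blueFin n Z, f (S.ends e).2 = ∑ W ∈ S.subFin (n + 1) Z, f W := by
  refine Finset.sum_bij (fun e _ => (S.ends e).2) ?_ ?_ ?_ fun _ _ => rfl
  · intro e he
    obtain ⟨h1, h2⟩ := S.mem_blueFin.mp he
    rcases e with e | e
    · refine S.mem_subFin.mpr ?_
      rw [← h2]
      exact e.2
    · cases h1
  · intro e he f hf h
    obtain ⟨h1, h2⟩ := S.mem_blueFin.mp he
    obtain ⟨h3, h4⟩ := S.mem_blueFin.mp hf
    exact S.sum_isLeft_eq (h1.trans h3.symm) (Prod.ext (h2.trans h4.symm) h)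
  · intro W hW
    exact ⟨.inl ⟨(Z, W), S.mem_subFin.mp hW⟩, S.mem_blueFin.mpr ⟨rfl, rfl⟩, rfl⟩

theorem exists_unique_superset (n : ℕ) (W : S.P (n + 1)) : ∃ Z : S.P n, (W : Set X) ⊆ Z := by
  obtain ⟨Z, hZ, h⟩ := S.finer n W W.2
  exact ⟨⟨Z, hZ⟩, h⟩

theorem eq_of_superset {n k : ℕ} {W : S.P k} {Z Z' : S.P n} (h : (W : Set X) ⊆ Z)
    (h' : (W : Set X) ⊆ Z') : Z = Z' := by
  obtain ⟨x, hx⟩ := (S.part k).nonempty W W.2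
  exact Subtype.ext (S.eq_of_mem Z.2 Z'.2 (h hx) (h' hx))

/-- Every member of the finer partition is the source of exactly one blue edge. So the sum of the
blue edges is a partial isometry whose source projection is the whole source side of the layer. -/
theorem star_blueSum_mul_blueSum (n : ℕ) : star (S.blueSum n) * S.blueSum n = S.q n := by
  have h1 : star (S.blueSum n) * S.blueSum n = star (S.blueSum n) * S.p n * S.blueSum n := by
    rw [mul_assoc, S.p_mul_blueSum]
  have h2 : S.p n = ∑ Z : S.P n, S.vl n Z := rfl
  have h3 : S.q n = ∑ W : S.P (n + 1), S.vr n W := rfl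
  rw [h1, h2, Finset.mul_sum, Finset.sum_mul, h3]
  simp only [S.star_blueSum_mul_vl_mul, S.sum_blueFin]
  rw [Finset.sum_sigma']
  refine Finset.sum_bij (fun a _ => a.2) (fun _ _ => Finset.mem_univ _) ?_ ?_ fun _ _ => rfl
  · rintro ⟨Z, W⟩ h ⟨Z', W'⟩ h' hW
    obtain rfl : W = W' := hW
    simp only [Finset.mem_sigma, Finset.mem_univ, mem_subFin, true_and] at h h'
    rw [S.eq_of_superset h h']
  · intro W _
    obtain ⟨Z, hZ⟩ := S.exists_unique_superset n W
    exact ⟨⟨Z, W⟩, Finset.mem_sigma.mpr ⟨Finset.mem_univ _, S.mem_subFin.mpr hZ⟩, rfl⟩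

/-- An edge x in the image of e remembers e: they have the same colour, the range of x is the source
of e, and the source of x lies in only one member of the partition that contains the range of e. -/
theorem next_unique {n : ℕ} {e f : S.Edge n} {x : S.Edge (n + 1)} (he : x ∈ S.nextEdges n e)
    (hf : x ∈ S.nextEdges n f) : e = f := by
  refine S.sum_isLeft_eq ((S.nextEdges_color he).symm.trans (S.nextEdges_color hf)) (Prod.ext ?_ ?_)
  · exact S.eq_of_superset (S.nextEdges_sub he) (S.nextEdges_sub hf)
  · exact (S.nextEdges_range he).symm.trans (S.nextEdges_range hf)

theorem next_exists {n : ℕ} (x : S.Edge (n + 1)) : ∃ e : S.Edge n, x ∈ S.nextEdges n e := by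
  rcases x with x | x
  · obtain ⟨Z, hZ⟩ := S.exists_unique_superset n x.1.1
    exact ⟨.inl ⟨(Z, x.1.1), hZ⟩, S.mem_nextEdges_blue.mpr ⟨rfl, rfl⟩⟩
  · obtain ⟨z, hz⟩ := (S.part (n + 2)).nonempty _ x.1.2.2
    obtain ⟨Z, hZ, hzZ⟩ := S.exists_mem n z
    by_cases hn : Even n
    · have hn' : ¬Even (n + 1) := by rw [Nat.even_add_one, not_not]; exact hn
      have h1 := (redRel_odd hn').mp x.2 hz
      exact ⟨.inr ⟨(⟨Z, hZ⟩, x.1.1), (redRel_even hn).mpr (S.subset_image hn hZ x.1.1.2 hzZ h1)⟩,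
        (S.mem_nextEdges_red_even hn).mpr ⟨⟨rfl, rfl⟩, S.subset_of_mem₂ hZ x.1.2.2 hzZ hz⟩⟩
    · have hn' : Even (n + 1) := Nat.even_add_one.mpr hn
      obtain ⟨y, hy, hyz⟩ := (redRel_even hn').mp x.2 hz
      rw [← hyz] at hzZ
      exact ⟨.inr ⟨(⟨Z, hZ⟩, x.1.1), (redRel_odd hn).mpr (S.subset_preimage hn hZ x.1.1.2 hy hzZ)⟩,
        (S.mem_nextEdges_red_odd hn).mpr ⟨rfl, rfl⟩⟩

theorem connect_ed (n : ℕ) (e : S.Edge n) :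
    S.connect n (S.ed n e) = ∑ x ∈ S.nextEdges n e, star (S.ed (n + 1) x) := rfl

/-- The images of the edges under the connecting map partition the edges of the next layer, so sums
over compatible sets of edges correspond, up to the adjoint. -/
theorem connect_sum_ed (n : ℕ) (s : Finset (S.Edge n)) (s' : Finset (S.Edge (n + 1)))
    (h : ∀ e x, x ∈ S.nextEdges n e → (e ∈ s ↔ x ∈ s')) :
    S.connect n (∑ e ∈ s, S.ed n e) = star (∑ x ∈ s', S.ed (n + 1) x) := by
  simp only [map_sum, star_sum, connect_ed]
  rw [Finset.sum_sigma']
  refine Finset.sum_bij (fun a _ => a.2) ?_ ?_ ?_ fun _ _ => rfl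
  · rintro ⟨e, x⟩ hx
    rw [Finset.mem_sigma] at hx
    exact (h e x hx.2).mp hx.1
  · rintro ⟨e, x⟩ hx ⟨f, y⟩ hy hxy
    obtain rfl : x = y := hxy
    rw [Finset.mem_sigma] at hx hy
    obtain rfl := S.next_unique hx.2 hy.2
    rfl
  · intro x hx
    obtain ⟨e, he⟩ := S.next_exists x
    exact ⟨⟨e, x⟩, Finset.mem_sigma.mpr ⟨(h e x he).mpr hx, he⟩, rfl⟩

theorem connect_blueSum (n : ℕ) : S.connect n (S.blueSum n) = star (S.blueSum (n + 1)) := by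
  refine S.connect_sum_ed n _ _ fun e x hx => ?_
  rw [Finset.mem_filter, Finset.mem_filter, S.nextEdges_color hx]
  simp

theorem connect_redSum (n : ℕ) : S.connect n (S.redSum n) = star (S.redSum (n + 1)) := by
  refine S.connect_sum_ed n _ _ fun e x hx => ?_
  have := S.nextEdges_color hx
  rw [Finset.mem_filter, Finset.mem_filter, ← Sum.not_isLeft, ← Sum.not_isLeft, this]
  simp

theorem connect_vl (n : ℕ) (Z : S.P n) :
    S.connect n (S.vl n Z) = ∑ W ∈ S.subFin (n + 2) Z, S.vr (n + 1) W := by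
  show ∑ w ∈ S.nextVertices n (.inl Z), (S.layer (n + 1)).v w = _
  rw [nextVertices, Finset.sum_map]
  rfl

theorem connect_vr (n : ℕ) (W : S.P (n + 1)) : S.connect n (S.vr n W) = S.vl (n + 1) W :=
  S.connect_inr n W

/-- In an odd layer a red edge has its source inside σ⁻¹ of its range. So restricting the range to Z
is the same as restricting the source to σ⁻¹(Z). The covariance relation in the colimit originates
here. -/
theorem vl_mul_redSum_odd {n : ℕ} (hn : ¬Even n) (Z : S.P n) :
    S.vl n Z * S.redSum n =
      S.redSum n * ∑ W ∈ S.subFin (n + 1) (σ ⁻¹' Z), S.vr n W := by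
  rw [vl_mul_redSum, redSum, Finset.sum_mul]
  simp only [Finset.mul_sum, S.ed_mul_vr]
  simp only [Finset.sum_ite_eq, mem_subFin]
  rw [← Finset.sum_filter, Finset.filter_filter]
  refine Finset.sum_congr ?_ fun _ _ => rfl
  ext e
  rw [S.mem_redFin, Finset.mem_filter]
  simp only [Finset.mem_univ, true_and]
  refine and_congr_right fun he => ?_
  rcases e with e | e
  · cases he
  · have h1 := (redRel_odd hn).mp e.2
    constructor
    · rintro rfl
      exact h1
    · intro h2
      obtain ⟨z, hz⟩ := (S.part (n + 1)).nonempty _ e.1.2.2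
      exact Subtype.ext (S.eq_of_mem e.1.1.2 Z.2 (h1 hz) (h2 hz))

end RefinedSeq

end Layers


/-! ### The covariant representation in the colimit. -/

section InfRep

open Classical

variable {X : Type u} [MetricSpace X] [CompactSpace X] {σ : LHomeo X}

namespace RefinedSeq

variable (S : RefinedSeq σ)

/-- A set is measurable for the `n`-th partition if it is a union of members of it. -/
def Meas (n : ℕ) (U : Set X) : Prop := ∀ Z ∈ S.P n, ∀ x ∈ Z, x ∈ U → Z ⊆ U

variable {S}

theorem Meas.succ {n : ℕ} {U : Set X} (h : S.Meas n U) : S.Meas (n + 1) U := by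
  intro W hW x hx hxU
  obtain ⟨Z, hZ, hWZ⟩ := S.finer n W hW
  exact hWZ.trans (h Z hZ x (hWZ hx) hxU)

theorem Meas.mono {n m : ℕ} {U : Set X} (h : S.Meas n U) (hnm : n ≤ m) : S.Meas m U := by
  induction m, hnm using Nat.le_induction with
  | base => exact h
  | succ m _ ih => exact ih.succ

theorem Meas.inter {n : ℕ} {U V : Set X} (hU : S.Meas n U) (hV : S.Meas n V) : S.Meas n (U ∩ V) :=
  fun Z hZ x hx hxU => Set.subset_inter (hU Z hZ x hx hxU.1) (hV Z hZ x hx hxU.2)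

theorem Meas.union {n : ℕ} {U V : Set X} (hU : S.Meas n U) (hV : S.Meas n V) : S.Meas n (U ∪ V) := by
  intro Z hZ x hx hxU
  rcases hxU with hxU | hxU
  · exact (hU Z hZ x hx hxU).trans Set.subset_union_left
  · exact (hV Z hZ x hx hxU).trans Set.subset_union_right

theorem meas_part {n : ℕ} (Z : S.P n) : S.Meas n Z := by
  intro W hW x hx hxZ
  rw [S.eq_of_mem hW Z.2 hx hxZ]

theorem meas_univ (n : ℕ) : S.Meas n Set.univ := fun _ _ _ _ _ => Set.subset_univ _

theorem exists_superset_preimage (k : ℕ) (V : S.P (2 * k + 2)) :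
    ∃ W : S.P (2 * k + 1), (V : Set X) ⊆ σ ⁻¹' W := by
  obtain ⟨x, hx⟩ := (S.part (2 * k + 2)).nonempty V V.2
  obtain ⟨W, hW, hxW⟩ := S.exists_mem (2 * k + 1) (σ x)
  exact ⟨⟨W, hW⟩, S.subset_preimage (Nat.not_even_bit1 k) hW V.2 hx hxW⟩

/-- One step of refinement reaches an odd partition, and from there the next step refines the
preimages; hence the shift by two. -/
theorem Meas.preimage {k : ℕ} {U : Set X} (h : S.Meas (2 * k) U) : S.Meas (2 * (k + 1)) (σ ⁻¹' U) := by
  intro V hV x hx hxU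
  obtain ⟨W, hW⟩ := S.exists_superset_preimage k ⟨V, hV⟩
  exact hW.trans (Set.preimage_mono (h.succ W W.2 (σ x) (hW hx) hxU))

/-- Take a Lebesgue number of the cover of X by U and its complement. As soon as all members of a
partition have smaller diameter, each lies in U or in the complement. -/
theorem exists_meas {U : Set X} (hU : IsClopen U) : ∃ n, S.Meas n U := by
  obtain ⟨δ, hδ, h⟩ := lebesgue_number_lemma_of_metric (s := (Set.univ : Set X))
    (c := fun b : Bool => if b then U else Uᶜ) isCompact_univ
    (by
      intro b
      cases b
      · exact hU.compl.2
      · exact hU.2)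
    (by
      intro x _
      rw [Set.mem_iUnion]
      by_cases hx : x ∈ U
      · exact ⟨true, hx⟩
      · exact ⟨false, hx⟩)
  obtain ⟨n, hn⟩ := (S.diam.eventually (gt_mem_nhds hδ)).exists
  refine ⟨n, fun Z hZ x hx hxU => ?_⟩
  obtain ⟨b, hb⟩ := h x trivial
  have hZb : Z ⊆ Metric.ball x δ := by
    intro y hy
    rw [Metric.mem_ball]
    refine lt_of_le_of_lt (Metric.dist_le_diam_of_mem (isCompact_univ.isBounded.subset
      (Set.subset_univ Z)) hy hx) (lt_of_le_of_lt ?_ hn)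
    exact le_ciSup (f := fun Z : S.P n => Metric.diam (Z : Set X)) (Set.finite_range _).bddAbove ⟨Z, hZ⟩
  cases b
  · exact absurd hxU (hb (Metric.mem_ball_self hδ))
  · exact hZb.trans hb

theorem exists_meas_even {U : Set X} (hU : IsClopen U) : ∃ k, S.Meas (2 * k) U := by
  obtain ⟨n, hn⟩ := S.exists_meas hU
  exact ⟨n, hn.mono (by omega)⟩

/-- Each member V contained in g⁻¹(U) is counted exactly once: it lies over a single W, and
measurability of U puts this W inside U. -/
theorem sum_subFin_preimage {M : Type*} [AddCommMonoid M] {n m : ℕ} (g : X → X) {U : Set X}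
    (hU : S.Meas n U) (h : ∀ V : S.P m, ∃ W : S.P n, (V : Set X) ⊆ g ⁻¹' W) (f : S.P m → M) :
    ∑ W ∈ S.subFin n U, ∑ V ∈ S.subFin m (g ⁻¹' W), f V = ∑ V ∈ S.subFin m (g ⁻¹' U), f V := by
  rw [Finset.sum_sigma']
  refine Finset.sum_bij (fun a _ => a.2) ?_ ?_ ?_ fun _ _ => rfl
  · rintro ⟨W, V⟩ h
    simp only [Finset.mem_sigma, mem_subFin] at h ⊢
    exact h.2.trans (Set.preimage_mono h.1)
  · rintro ⟨W, V⟩ h ⟨W', V'⟩ h' hV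
    obtain rfl : V = V' := hV
    simp only [Finset.mem_sigma, mem_subFin] at h h'
    obtain ⟨x, hx⟩ := (S.part m).nonempty V V.2
    obtain rfl : W = W' := Subtype.ext (S.eq_of_mem W.2 W'.2 (h.2 hx) (h'.2 hx))
    rfl
  · intro V hV
    rw [mem_subFin] at hV
    obtain ⟨W, hW⟩ := h V
    obtain ⟨x, hx⟩ := (S.part m).nonempty V V.2
    refine ⟨⟨W, V⟩, ?_, rfl⟩
    simp only [Finset.mem_sigma, mem_subFin]
    exact ⟨hU W W.2 (g x) (hW hx) (hV hx), hW⟩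

theorem sum_subFin {M : Type*} [AddCommMonoid M] {n m : ℕ} {U : Set X}
    (hU : S.Meas n U) (h : ∀ V : S.P m, ∃ W : S.P n, (V : Set X) ⊆ W) (f : S.P m → M) :
    ∑ W ∈ S.subFin n U, ∑ V ∈ S.subFin m W, f V = ∑ V ∈ S.subFin m U, f V :=
  sum_subFin_preimage id hU h f

theorem subFin_part {n : ℕ} (Z : S.P n) : S.subFin n Z = {Z} := by
  ext W
  rw [mem_subFin, Finset.mem_singleton]
  refine ⟨fun h => S.eq_of_superset (W := W) le_rfl h, ?_⟩
  rintro rfl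
  exact le_rfl

variable (S)

/-- The compression of an element of an even layer, as an element of the colimit. -/
def inc (k : ℕ) : S.L (2 * k) →ₗ[ℂ] S.AInf where
  toFun x := SeqLim.of S.φA k ⟨S.p (2 * k) * x * S.p (2 * k), mem_corner_iff.mpr (by
    have h := (S.isStarProjection_p (2 * k)).1
    rw [mul_assoc, mul_assoc (S.p (2 * k) * x), h, ← mul_assoc, ← mul_assoc, h])⟩
  map_add' x y := by
    rw [← map_add]
    exact congrArg _ (Subtype.ext (by
      show S.p (2 * k) * (x + y) * S.p (2 * k) = _
      rw [mul_add, add_mul]; rfl))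
  map_smul' c x := by
    rw [RingHom.id_apply, ← map_smul]
    exact congrArg _ (Subtype.ext (by
      show S.p (2 * k) * (c • x) * S.p (2 * k) = _
      rw [mul_smul_comm, smul_mul_assoc]; rfl))

theorem of_eq_inc (k : ℕ) (x : S.A k) : SeqLim.of S.φA k x = S.inc k x :=
  congrArg _ (Subtype.ext (mem_corner_iff.mp x.2).symm)

theorem exists_inc (x : S.AInf) : ∃ k, ∃ y : S.L (2 * k), S.p (2 * k) * y * S.p (2 * k) = y ∧ S.inc k y = x := by
  obtain ⟨k, a, rfl⟩ := SeqLim.exists_of x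
  exact ⟨k, a, mem_corner_iff.mp a.2, (S.of_eq_inc k a).symm⟩

theorem inc_star (k : ℕ) (x : S.L (2 * k)) : S.inc k (star x) = star (S.inc k x) := by
  show SeqLim.of S.φA k _ = star (SeqLim.of S.φA k _)
  rw [← map_star]
  refine congrArg _ (Subtype.ext ?_)
  show S.p (2 * k) * star x * S.p (2 * k) = star (S.p (2 * k) * x * S.p (2 * k))
  rw [star_mul, star_mul, S.star_p, mul_assoc]

/-- Compression by p is not multiplicative in general; it is when p can be inserted between the two
factors. -/
theorem inc_mul (k : ℕ) {x : S.L (2 * k)} (y : S.L (2 * k)) (h : x * S.p (2 * k) = x) :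
    S.inc k (x * y) = S.inc k x * S.inc k y := by
  show SeqLim.of S.φA k _ = SeqLim.of S.φA k _ * SeqLim.of S.φA k _
  rw [← map_mul]
  refine congrArg _ (Subtype.ext ?_)
  show S.p (2 * k) * (x * y) * S.p (2 * k) =
    S.p (2 * k) * x * S.p (2 * k) * (S.p (2 * k) * y * S.p (2 * k))
  rw [mul_assoc (S.p (2 * k)) x (S.p (2 * k)), h, mul_assoc (S.p (2 * k)) x, ← mul_assoc x, ← mul_assoc x,
    h, mul_assoc, mul_assoc]

/-- Two connecting maps carry the compressing projection of one even layer to that of the next, so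
they commute with compression. This is how identities are transported between layers. -/
theorem inc_connect (k : ℕ) (x : S.L (2 * k)) :
    S.inc (k + 1) (S.connect (2 * k + 1) (S.connect (2 * k) x)) = S.inc k x := by
  show SeqLim.of S.φA (k + 1) _ = SeqLim.of S.φA k _
  rw [← SeqLim.of_succ S.φA k]
  refine congrArg _ (Subtype.ext ?_)
  show _ = S.connect (2 * k + 1) (S.connect (2 * k) _)
  rw [map_mul, map_mul, map_mul, map_mul, S.connect_p, S.connect_q]
  rfl

/-- The sum of the members of the partition `2k` which are contained in `U`. -/
def vtx (k : ℕ) (U : Set X) : S.L (2 * k) := ∑ Z ∈ S.subFin (2 * k) U, S.vl (2 * k) Z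

theorem star_vtx (k : ℕ) (U : Set X) : star (S.vtx k U) = S.vtx k U := by
  rw [vtx, star_sum]
  exact Finset.sum_congr rfl fun Z _ => S.star_vl _ Z

theorem vtx_mul_p (k : ℕ) (U : Set X) : S.vtx k U * S.p (2 * k) = S.vtx k U := by
  rw [vtx, Finset.sum_mul]
  exact Finset.sum_congr rfl fun Z _ => S.vl_mul_p _ Z

theorem vtx_part (k : ℕ) (Z : S.P (2 * k)) : S.vtx k Z = S.vl (2 * k) Z := by
  rw [vtx, subFin_part, Finset.sum_singleton]

theorem vtx_univ (k : ℕ) : S.vtx k Set.univ = S.p (2 * k) := by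
  have : S.subFin (2 * k) Set.univ = Finset.univ := by ext; simp [mem_subFin]
  rw [vtx, this]
  rfl

theorem vtx_mul (k : ℕ) (U V : Set X) : S.vtx k U * S.vtx k V = S.vtx k (U ∩ V) := by
  rw [vtx, vtx, Finset.sum_mul_sum]
  have h : ∀ Z ∈ S.subFin (2 * k) U, ∑ W ∈ S.subFin (2 * k) V, S.vl (2 * k) Z * S.vl (2 * k) W =
      if (Z : Set X) ⊆ V then S.vl (2 * k) Z else 0 := by
    intro Z _
    split_ifs with hZ
    · rw [Finset.sum_eq_single_of_mem Z (S.mem_subFin.mpr hZ), S.vl_mul_self]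
      exact fun W _ hW => S.vl_mul_ne _ hW.symm
    · refine Finset.sum_eq_zero fun W hW => S.vl_mul_ne _ ?_
      rintro rfl
      exact hZ (S.mem_subFin.mp hW)
  rw [Finset.sum_congr rfl h, ← Finset.sum_filter, vtx]
  refine Finset.sum_congr ?_ fun _ _ => rfl
  ext Z
  rw [Finset.mem_filter, mem_subFin, mem_subFin, Set.subset_inter_iff]

theorem vtx_union (k : ℕ) {U V : Set X} (hU : S.Meas (2 * k) U) (hV : S.Meas (2 * k) V)
    (h : Disjoint U V) : S.vtx k (U ∪ V) = S.vtx k U + S.vtx k V := by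
  rw [vtx, vtx, vtx, ← Finset.sum_union]
  · refine Finset.sum_congr ?_ fun _ _ => rfl
    ext Z
    rw [Finset.mem_union, mem_subFin, mem_subFin, mem_subFin]
    constructor
    · intro hZ
      obtain ⟨x, hx⟩ := (S.part (2 * k)).nonempty Z Z.2
      exact (hZ hx).imp (hU Z Z.2 x hx) (hV Z Z.2 x hx)
    · rintro (hZ | hZ)
      · exact hZ.trans Set.subset_union_left
      · exact hZ.trans Set.subset_union_right
  · rw [Finset.disjoint_left]
    intro Z h1 h2
    rw [mem_subFin] at h1 h2
    obtain ⟨x, hx⟩ := (S.part (2 * k)).nonempty Z Z.2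
    exact Set.disjoint_left.mp h (h1 hx) (h2 hx)

theorem exists_superset_two (n : ℕ) (W : S.P (n + 2)) : ∃ Z : S.P n, (W : Set X) ⊆ Z := by
  obtain ⟨V, hV⟩ := S.exists_unique_superset (n + 1) W
  obtain ⟨Z, hZ⟩ := S.exists_unique_superset n V
  exact ⟨Z, hV.trans hZ⟩

theorem connect_vtx (k : ℕ) {U : Set X} (hU : S.Meas (2 * k) U) :
    S.connect (2 * k + 1) (S.connect (2 * k) (S.vtx k U)) = S.vtx (k + 1) U := by
  rw [vtx, map_sum, map_sum]
  simp only [connect_vl, map_sum, connect_vr]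
  exact sum_subFin hU (S.exists_superset_two (2 * k)) _

theorem inc_vtx_succ (k : ℕ) {U : Set X} (hU : S.Meas (2 * k) U) :
    S.inc (k + 1) (S.vtx (k + 1) U) = S.inc k (S.vtx k U) := by
  rw [← S.connect_vtx k hU, inc_connect]

theorem inc_vtx_of_le {k l : ℕ} {U : Set X} (hU : S.Meas (2 * k) U) (h : k ≤ l) :
    S.inc l (S.vtx l U) = S.inc k (S.vtx k U) := by
  induction l, h using Nat.le_induction with
  | base => rfl
  | succ l h ih => rw [S.inc_vtx_succ l (hU.mono (by omega)), ih]

/-- The element of the colimit given by a clopen set. -/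
def infM (U : Set X) : S.AInf :=
  -- For clopen U such a k exists, and the value does not depend on the choice; other sets get the
  -- default value 0.
  if h : ∃ k, S.Meas (2 * k) U then S.inc h.choose (S.vtx h.choose U) else 0

theorem infM_eq {k : ℕ} {U : Set X} (hU : S.Meas (2 * k) U) : S.infM U = S.inc k (S.vtx k U) := by
  have h : ∃ k, S.Meas (2 * k) U := ⟨k, hU⟩
  rw [infM, dif_pos h]
  rcases le_total h.choose k with h' | h'
  · exact (S.inc_vtx_of_le h.choose_spec h').symm
  · exact S.inc_vtx_of_le hU h'

theorem infM_part (k : ℕ) (Z : S.P (2 * k)) : S.infM Z = S.inc k (S.vl (2 * k) Z) := by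
  rw [S.infM_eq (meas_part Z), vtx_part]

theorem exists_meas_pair {U V : Set X} (hU : IsClopen U) (hV : IsClopen V) :
    ∃ k, S.Meas (2 * k) U ∧ S.Meas (2 * k) V := by
  obtain ⟨k, hk⟩ := S.exists_meas_even hU
  obtain ⟨l, hl⟩ := S.exists_meas_even hV
  exact ⟨k + l, hk.mono (by omega), hl.mono (by omega)⟩

/-- The projection-valued measure of the colimit. -/
def infMeasure : ClopenMeasure X S.AInf where
  M := S.infM
  M_mul hU hV := by
    obtain ⟨k, hk, hl⟩ := S.exists_meas_pair hU hV
    rw [S.infM_eq hk, S.infM_eq hl, S.infM_eq (hk.inter hl), ← S.inc_mul k _ (S.vtx_mul_p k _), vtx_mul]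
  star_M hU := by
    obtain ⟨k, hk⟩ := S.exists_meas_even hU
    rw [S.infM_eq hk, ← inc_star, star_vtx]
  M_union hU hV h := by
    obtain ⟨k, hk, hl⟩ := S.exists_meas_pair hU hV
    rw [S.infM_eq hk, S.infM_eq hl, S.infM_eq (hk.union hl), S.vtx_union k hk hl h, map_add]

theorem infM_univ_mul (x : S.AInf) : S.infM Set.univ * x = x := by
  obtain ⟨k, y, hy, rfl⟩ := S.exists_inc x
  rw [S.infM_eq (meas_univ (2 * k)), ← S.inc_mul k _ (S.vtx_mul_p k _), vtx_univ]
  congr 1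
  rw [← hy, ← mul_assoc, ← mul_assoc, (S.isStarProjection_p (2 * k)).1]

/-- The element of an even layer which implements `σ`. -/
def tElt (k : ℕ) : S.L (2 * k) := S.redSum (2 * k) * star (S.blueSum (2 * k))

theorem star_blueSum_mul_p (n : ℕ) : star (S.blueSum n) * S.p n = star (S.blueSum n) := by
  rw [← S.star_p, ← star_mul, p_mul_blueSum]

theorem star_redSum_mul_p (n : ℕ) : star (S.redSum n) * S.p n = star (S.redSum n) := by
  rw [← S.star_p, ← star_mul, p_mul_redSum]

theorem tElt_mul_p (k : ℕ) : S.tElt k * S.p (2 * k) = S.tElt k := by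
  rw [tElt, mul_assoc, star_blueSum_mul_p]

theorem star_tElt_mul_p (k : ℕ) : star (S.tElt k) * S.p (2 * k) = star (S.tElt k) := by
  rw [tElt, star_mul, star_star, mul_assoc, star_redSum_mul_p]

/-- Each connecting map sends the sum of the blue, or of the red, edges to the adjoint of the
corresponding sum. Two of them cancel the adjoint, so the same formula defines t in every even
layer. -/
theorem inc_tElt_succ (k : ℕ) : S.inc (k + 1) (S.tElt (k + 1)) = S.inc k (S.tElt k) := by
  rw [← S.inc_connect k (S.tElt k), tElt, tElt]
  congr 1
  rw [map_mul, map_mul, map_star, map_star, connect_redSum, connect_blueSum, map_star, map_star,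
    connect_redSum, connect_blueSum, star_star, star_star]
  rfl

theorem inc_tElt (k : ℕ) : S.inc k (S.tElt k) = S.inc 0 (S.tElt 0) := by
  induction k with
  | zero => rfl
  | succ k ih => rw [inc_tElt_succ, ih]

/-- The sum of the sources which are contained in `U`. -/
def vtr (n : ℕ) (U : Set X) : S.L n := ∑ W ∈ S.subFin (n + 1) U, S.vr n W

theorem star_vtr (n : ℕ) (U : Set X) : star (S.vtr n U) = S.vtr n U := by
  rw [vtr, star_sum]
  exact Finset.sum_congr rfl fun Z _ => S.star_vr _ Z

theorem q_mul_vtr (n : ℕ) (U : Set X) : S.q n * S.vtr n U = S.vtr n U := by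
  rw [vtr, Finset.mul_sum]
  exact Finset.sum_congr rfl fun Z _ => S.q_mul_vr _ Z

theorem connect_vtr (n : ℕ) (U : Set X) :
    S.connect n (S.vtr n U) = ∑ W ∈ S.subFin (n + 1) U, S.vl (n + 1) W := by
  rw [vtr, map_sum]
  exact Finset.sum_congr rfl fun Z _ => S.connect_vr _ Z

/-- Conjugation by the sum of the blue edges brings a source vertex into the corner. After two
connecting maps it becomes the sum of the vertices below it, so members of the odd partitions are
also available inside the corners. -/
theorem connect_blue_conj (k : ℕ) {U : Set X} (hU : S.Meas (2 * k + 1) U) :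
    S.connect (2 * k + 1) (S.connect (2 * k)
      (S.blueSum (2 * k) * S.vtr (2 * k) U * star (S.blueSum (2 * k)))) = S.vtx (k + 1) U := by
  have h : S.connect (2 * k) (S.blueSum (2 * k) * S.vtr (2 * k) U * star (S.blueSum (2 * k))) =
      star (S.blueSum (2 * k + 1)) * (∑ W ∈ S.subFin (2 * k + 1) U, S.vl (2 * k + 1) W) *
        S.blueSum (2 * k + 1) := by
    rw [map_mul, map_mul, map_star, connect_blueSum, star_star, connect_vtr]
  rw [h, Finset.mul_sum, Finset.sum_mul]
  simp only [star_blueSum_mul_vl_mul, S.sum_blueFin]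
  rw [sum_subFin hU (S.exists_unique_superset (2 * k + 1))]
  exact S.connect_vtr (2 * k + 1) U

theorem infM_eq_blue_conj (k : ℕ) {U : Set X} (hU : S.Meas (2 * k + 1) U) :
    S.infM U = S.inc k (S.blueSum (2 * k) * S.vtr (2 * k) U * star (S.blueSum (2 * k))) := by
  rw [← S.inc_connect, S.connect_blue_conj k hU]
  exact S.infM_eq (k := k + 1) hU.succ

/-- The first connecting map makes source vertices into range vertices of an odd layer. There
`vl_mul_redSum_odd` exchanges them with the red sum at the price of σ⁻¹, and the second connecting
map returns to an even layer. -/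
theorem connect_red_conj (k : ℕ) {U : Set X} (hU : S.Meas (2 * k + 1) U) :
    S.connect (2 * k + 1) (S.connect (2 * k)
      (S.redSum (2 * k) * S.vtr (2 * k) U * star (S.blueSum (2 * k)))) =
      S.vtx (k + 1) (σ ⁻¹' U) * S.tElt (k + 1) := by
  have h1 : star (∑ W ∈ S.subFin (2 * k + 1) U, S.vl (2 * k + 1) W * S.redSum (2 * k + 1)) =
      S.vtr (2 * k + 1) (σ ⁻¹' U) * star (S.redSum (2 * k + 1)) := by
    simp only [S.vl_mul_redSum_odd (Nat.not_even_bit1 k)]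
    rw [← Finset.mul_sum, sum_subFin_preimage σ hU (exists_superset_preimage k), star_mul]
    congr 1
    exact S.star_vtr _ _
  have h2 : star (S.redSum (2 * k + 1)) * ∑ W ∈ S.subFin (2 * k + 1) U, S.vl (2 * k + 1) W =
      S.vtr (2 * k + 1) (σ ⁻¹' U) * star (S.redSum (2 * k + 1)) := by
    rw [← h1, ← Finset.sum_mul, star_mul, star_sum]
    simp only [star_vl]
  have h3 : S.connect (2 * k) (S.redSum (2 * k) * S.vtr (2 * k) U * star (S.blueSum (2 * k))) =
      S.vtr (2 * k + 1) (σ ⁻¹' U) * star (S.redSum (2 * k + 1)) * S.blueSum (2 * k + 1) := by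
    rw [map_mul, map_mul, map_star, connect_blueSum, star_star, connect_vtr, connect_redSum, h2]
  rw [h3, map_mul, map_mul, map_star, connect_redSum, star_star, connect_blueSum, connect_vtr, mul_assoc]
  rfl

/-- The covariant representation in the colimit. -/
def infRep : CovRep S S.AInf where
  toClopenMeasure := S.infMeasure
  t := S.inc 0 (S.tElt 0)
  M_univ_mul_t := S.infM_univ_mul _
  t_mul {U} hU := by
    obtain ⟨k, hk⟩ := S.exists_meas_even hU
    show _ * S.infM U = S.infM _ * _
    -- Let b and r be the sums of the blue and of the red edges, and let w be the sum of the source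
    -- vertices inside U. Then t M(U) = r b* b w b* = r w b*, whose image two layers further is
    -- M(σ⁻¹ U) t.
    rw [S.infM_eq_blue_conj k hk.succ, ← S.inc_tElt k, ← S.inc_mul k _ (S.tElt_mul_p k),
      S.infM_eq hk.preimage, ← S.inc_tElt_succ k, ← S.inc_mul (k + 1) _ (S.vtx_mul_p _ _),
      ← S.connect_red_conj k hk.succ, S.inc_connect]
    congr 1
    rw [tElt, mul_assoc, ← mul_assoc (star _), ← mul_assoc (star _), star_blueSum_mul_blueSum,
      q_mul_vtr, mul_assoc]
  range_part Z hZ := by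
    have h : S.infM Z = S.inc 0 (S.vl (2 * 0) ⟨Z, hZ⟩) := S.infM_part 0 ⟨Z, hZ⟩
    show S.infM Z * _ * _ * S.infM Z = S.infM Z
    have hp := S.vl_mul_p (2 * 0) ⟨Z, hZ⟩
    rw [h, ← inc_star, ← S.inc_mul 0 _ hp, ← S.inc_mul 0, ← S.inc_mul 0]
    · congr 1
      -- In t t* the blue sums cancel, and what remains is the product of the sum of R_Z with its
      -- adjoint, which is Z by the last Leavitt relation.
      have h0 := S.sum_ed_mul_star_sum_ed (2 * 0) (Z := ⟨Z, hZ⟩) (s := S.redFin (2 * 0) ⟨Z, hZ⟩)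
        (.inr (.inl ⟨by simp, S.coe_redFin _ _⟩))
      rw [← S.vl_mul_redSum, star_mul, S.star_vl] at h0
      refine Eq.trans ?_ h0
      rw [tElt, star_mul, star_star]
      simp only [mul_assoc]
      rw [← mul_assoc (star (S.blueSum _)), star_blueSum_mul_blueSum, ← mul_assoc (S.redSum _) (S.q _),
        redSum_mul_q]
    · rw [mul_assoc, star_tElt_mul_p]
    · rw [mul_assoc, tElt_mul_p]
  transfer_part Z hZ := by
    have h : S.infM Z = S.inc 0 (S.vl (2 * 0) ⟨Z, hZ⟩) := S.infM_part 0 ⟨Z, hZ⟩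
    show _ * S.infM Z * _ = S.infM (σ '' Z)
    have hp := S.vl_mul_p (2 * 0) ⟨Z, hZ⟩
    rw [h, ← inc_star, ← S.inc_mul 0 _ (S.star_tElt_mul_p 0), ← S.inc_mul 0]
    · have h1 := S.infMeasure.sum_M_redSet (n := 2 * 0) (by simp) ⟨Z, hZ⟩ _ (S.coe_redFin _ _)
      refine Eq.trans ?_ h1
      -- The red sums produce the source projections of R_Z, and the blue sums conjugate these into
      -- the corner; the sources of R_Z tile σ(Z).
      have h2 : star (S.tElt 0) * S.vl (2 * 0) ⟨Z, hZ⟩ * S.tElt 0 =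
        ∑ e ∈ S.redFin (2 * 0) ⟨Z, hZ⟩, S.blueSum (2 * 0) * S.vtr (2 * 0) (S.ends e).2 *
          star (S.blueSum (2 * 0)) := by
        rw [← Finset.sum_mul, ← Finset.mul_sum]
        have : ∀ W : S.P (2 * 0 + 1), S.vtr (2 * 0) W = S.vr (2 * 0) W := fun W => by
          rw [vtr, subFin_part, Finset.sum_singleton]
        simp only [this]
        rw [← S.star_redSum_mul_vl_mul (by simp), tElt, star_mul, star_star]
        simp only [mul_assoc]
      rw [h2, map_sum]
      refine Finset.sum_congr rfl fun e _ => ?_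
      exact (S.infM_eq_blue_conj 0 (meas_part (n := 2 * 0 + 1) (S.ends e).2)).symm
    · rw [mul_assoc, hp]

end RefinedSeq

end InfRep


/-- Induction on the elements of a presented `*`-algebra. -/
theorem StarPres.induction {Y : Type u} {R : StarTerm Y → StarTerm Y → Prop} {Q : StarPres R → Prop}
    (of : ∀ y, Q (StarPres.of R y)) (zero : Q 0) (add : ∀ x y, Q x → Q y → Q (x + y))
    (mul : ∀ x y, Q x → Q y → Q (x * y)) (smul : ∀ (z : ℂ) x, Q x → Q (z • x))
    (star : ∀ x, Q x → Q (star x)) (x : StarPres R) : Q x := by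
  refine StarPres.ind x fun s => ?_
  induction s with
  | of y => exact of y
  | zero => exact zero
  | add a b ha hb => exact add (mk R a) (mk R b) ha hb
  | mul a b ha hb => exact mul (mk R a) (mk R b) ha hb
  | smul z a ha => exact smul z (mk R a) ha
  | adj a ha => exact star (mk R a) ha

/-! ### The colimit is spanned by the elements M(U) t^m t*^n M(V). -/

section Generation

open Classical

variable {X : Type u} [MetricSpace X] [CompactSpace X] {σ : LHomeo X}

namespace RefinedSeq

variable (S : RefinedSeq σ)

theorem blueSum_mul_vl (n : ℕ) (Z : S.P n) : S.blueSum n * S.vl n Z = 0 := by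
  rw [← S.blueSum_mul_q, mul_assoc, q_mul_vl, mul_zero]

theorem blueSum_mul_ed (n : ℕ) (e : S.Edge n) : S.blueSum n * S.ed n e = 0 := by
  rw [← S.blueSum_mul_q, mul_assoc, q_mul_ed, mul_zero]

/-- A colour together with range and source determines an edge, so cutting the sum of a colour by
two vertices isolates it. -/
theorem ed_eq_blue {n : ℕ} {e : S.Edge n} (he : e.isLeft) :
    S.ed n e = S.vl n (S.ends e).1 * S.blueSum n * S.vr n (S.ends e).2 := by
  rw [vl_mul_blueSum, Finset.sum_mul, Finset.sum_eq_single_of_mem e (S.mem_blueFin.mpr ⟨he, rfl⟩)]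
  · rw [ed_mul_vr, if_pos rfl]
  · intro f hf hne
    obtain ⟨h1, h2⟩ := S.mem_blueFin.mp hf
    rw [ed_mul_vr, if_neg]
    intro h
    exact hne (S.sum_isLeft_eq (h1.trans he.symm) (Prod.ext h2 h))

theorem ed_eq_red {n : ℕ} {e : S.Edge n} (he : e.isRight) :
    S.ed n e = S.vl n (S.ends e).1 * S.redSum n * S.vr n (S.ends e).2 := by
  rw [vl_mul_redSum, Finset.sum_mul, Finset.sum_eq_single_of_mem e (S.mem_redFin.mpr ⟨he, rfl⟩)]
  · rw [ed_mul_vr, if_pos rfl]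
  · intro f hf hne
    obtain ⟨h1, h2⟩ := S.mem_redFin.mp hf
    rw [ed_mul_vr, if_neg]
    intro h
    refine hne (S.sum_isLeft_eq ?_ (Prod.ext h2 h))
    rcases f with f | f <;> rcases e with e | e <;> simp_all

/-- The two elements which compress a layer into its corner. -/
def compr (n : ℕ) (i : Bool) : S.L n := if i then S.blueSum n else S.p n

theorem star_compr_mul_p (n : ℕ) (i : Bool) : star (S.compr n i) * S.p n = star (S.compr n i) := by
  cases i
  · show star (S.p n) * S.p n = star (S.p n)
    rw [star_p, (S.isStarProjection_p n).1]
  · exact S.star_blueSum_mul_p n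

theorem sum_compr (n : ℕ) : ∑ i, star (S.compr n i) * S.compr n i = S.p n + S.q n := by
  rw [Fintype.sum_bool, add_comm]
  show star (S.p n) * S.p n + star (S.blueSum n) * S.blueSum n = _
  rw [star_p, (S.isStarProjection_p n).1, star_blueSum_mul_blueSum]

/-- The compressions of an element of an even layer. -/
def cmp (k : ℕ) (i j : Bool) (x : S.L (2 * k)) : S.AInf :=
  S.inc k (S.compr (2 * k) i * x * star (S.compr (2 * k) j))

theorem cmp_star (k : ℕ) (i j : Bool) (x : S.L (2 * k)) : S.cmp k i j (star x) = star (S.cmp k j i x) := by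
  rw [cmp, cmp, ← inc_star, star_mul, star_mul, star_star, mul_assoc]

/-- The products (compressor)*(compressor) add up to the unit p + q of the layer. So the
compressions of a product multiply like 2 × 2 matrices, and the whole layer, not just its corner,
can be studied inside the colimit. -/
theorem cmp_mul (k : ℕ) (i j : Bool) (x y : S.L (2 * k)) :
    S.cmp k i j (x * y) = ∑ l, S.cmp k i l x * S.cmp k l j y := by
  have h : ∀ l, S.cmp k i l x * S.cmp k l j y = S.inc k (S.compr (2 * k) i * x *
      (star (S.compr (2 * k) l) * S.compr (2 * k) l) * (y * star (S.compr (2 * k) j))) := by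
    intro l
    rw [cmp, cmp, ← inc_mul]
    · simp only [mul_assoc]
    · rw [mul_assoc, star_compr_mul_p]
  simp only [h]
  rw [← map_sum, ← Finset.sum_mul, ← Finset.mul_sum, sum_compr, mul_assoc _ (S.p _ + _), unit_mul, cmp]
  simp only [mul_assoc]

/-- The elements whose multiplication preserves the span of the elements `E U m n V`. -/
def Preserves (a : S.AInf) : Prop := ∀ y ∈ S.infRep.spanE, a * y ∈ S.infRep.spanE

variable {S}

theorem Preserves.zero : S.Preserves 0 := fun y _ => by
  rw [zero_mul]
  exact Submodule.zero_mem _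

theorem Preserves.add {a b : S.AInf} (ha : S.Preserves a) (hb : S.Preserves b) : S.Preserves (a + b) :=
  fun y hy => by
    rw [add_mul]
    exact Submodule.add_mem _ (ha y hy) (hb y hy)

theorem Preserves.smul {a : S.AInf} (z : ℂ) (ha : S.Preserves a) : S.Preserves (z • a) := fun y hy => by
  rw [smul_mul_assoc]
  exact Submodule.smul_mem _ z (ha y hy)

theorem Preserves.mul {a b : S.AInf} (ha : S.Preserves a) (hb : S.Preserves b) : S.Preserves (a * b) :=
  fun y hy => by
    rw [mul_assoc]
    exact ha _ (hb y hy)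

theorem Preserves.infM {U : Set X} (hU : IsClopen U) : S.Preserves (S.infM U) :=
  fun _ hy => S.infRep.M_mul_mem_spanE hU hy

theorem Preserves.t : S.Preserves S.infRep.t := fun _ hy => S.infRep.t_mul_mem_spanE hy

theorem Preserves.star_t : S.Preserves (star S.infRep.t) := fun _ hy => S.infRep.star_t_mul_mem_spanE hy

variable (S)

theorem cmp_zero (k : ℕ) (i j : Bool) : S.cmp k i j 0 = 0 := by
  rw [cmp, mul_zero, zero_mul, map_zero]

theorem cmp_add (k : ℕ) (i j : Bool) (x y : S.L (2 * k)) :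
    S.cmp k i j (x + y) = S.cmp k i j x + S.cmp k i j y := by
  rw [cmp, mul_add, add_mul, map_add]
  rfl

theorem cmp_smul (k : ℕ) (i j : Bool) (z : ℂ) (x : S.L (2 * k)) :
    S.cmp k i j (z • x) = z • S.cmp k i j x := by
  rw [cmp, mul_smul_comm, smul_mul_assoc, map_smul]
  rfl

theorem cmp_vl (k : ℕ) (i j : Bool) (Z : S.P (2 * k)) :
    S.cmp k i j (S.vl (2 * k) Z) = if i || j then 0 else S.infM Z := by
  rw [cmp, S.infM_part]
  have h : S.vl (2 * k) Z * star (S.blueSum (2 * k)) = 0 := by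
    have := congrArg star (S.blueSum_mul_vl (2 * k) Z)
    rwa [star_mul, S.star_vl, star_zero] at this
  cases i <;> cases j
  · show S.inc k (S.p (2 * k) * _ * star (S.p (2 * k))) = S.inc k _
    rw [star_p, p_mul_vl, vl_mul_p]
  · show S.inc k (S.p (2 * k) * _ * star (S.blueSum (2 * k))) = 0
    rw [mul_assoc, h, mul_zero, map_zero]
  · show S.inc k (S.blueSum (2 * k) * _ * star (S.p (2 * k))) = 0
    rw [blueSum_mul_vl, zero_mul, map_zero]
  · show S.inc k (S.blueSum (2 * k) * _ * star (S.blueSum (2 * k))) = 0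
    rw [blueSum_mul_vl, zero_mul, map_zero]

theorem vtr_part (n : ℕ) (W : S.P (n + 1)) : S.vtr n W = S.vr n W := by
  rw [vtr, subFin_part, Finset.sum_singleton]

theorem cmp_vr (k : ℕ) (i j : Bool) (W : S.P (2 * k + 1)) :
    S.cmp k i j (S.vr (2 * k) W) = if i && j then S.infM W else 0 := by
  rw [cmp, S.infM_eq_blue_conj k (meas_part W), vtr_part]
  have h : S.vr (2 * k) W * S.p (2 * k) = 0 := by
    have := congrArg star (S.p_mul_vr (2 * k) W)
    rwa [star_mul, S.star_vr, S.star_p, star_zero] at this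
  cases i <;> cases j
  · show S.inc k (S.p (2 * k) * _ * star (S.p (2 * k))) = 0
    rw [p_mul_vr, zero_mul, map_zero]
  · show S.inc k (S.p (2 * k) * _ * star (S.blueSum (2 * k))) = 0
    rw [p_mul_vr, zero_mul, map_zero]
  · show S.inc k (S.blueSum (2 * k) * _ * star (S.p (2 * k))) = 0
    rw [star_p, mul_assoc, h, mul_zero, map_zero]
  · rfl

/-- Multiplying by the adjoint of the blue sum moves the source of an edge into the corner; a blue
edge then becomes a product of projections, and a red one becomes t between two projections. -/
theorem inc_ed (k : ℕ) (e : S.Edge (2 * k)) :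
    S.inc k (S.ed (2 * k) e * star (S.blueSum (2 * k))) =
      S.infM (S.ends e).1 * (if e.isLeft then S.infM Set.univ else S.infRep.t) * S.infM (S.ends e).2 := by
  have ht : S.infRep.t = S.inc k (S.tElt k) := (S.inc_tElt k).symm
  cases he : e.isLeft
  · have he' : e.isRight := by rw [← Sum.bnot_isLeft, he]; rfl
    rw [if_neg Bool.false_ne_true, ht, S.infM_part, S.infM_eq_blue_conj k (meas_part (S.ends e).2), vtr_part,
      ← S.inc_mul k _ (S.vl_mul_p _ _), ← S.inc_mul, S.ed_eq_red he', tElt]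
    · simp only [mul_assoc]
      rw [← mul_assoc (star _) (S.blueSum _), star_blueSum_mul_blueSum, ← mul_assoc (S.q _), q_mul_vr]
    · rw [mul_assoc, tElt_mul_p]
  · rw [if_pos rfl, mul_assoc, infM_univ_mul, S.infM_part, S.infM_eq_blue_conj k (meas_part (S.ends e).2),
      vtr_part, ← S.inc_mul k _ (S.vl_mul_p _ _), S.ed_eq_blue he]
    simp only [mul_assoc]

theorem cmp_ed (k : ℕ) (i j : Bool) (e : S.Edge (2 * k)) :
    S.cmp k i j (S.ed (2 * k) e) = if !i && j then
      S.infM (S.ends e).1 * (if e.isLeft then S.infM Set.univ else S.infRep.t) * S.infM (S.ends e).2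
      else 0 := by
  rw [← S.inc_ed, cmp]
  cases i <;> cases j
  · show S.inc k (S.p (2 * k) * _ * star (S.p (2 * k))) = 0
    rw [star_p, mul_assoc, ed_mul_p, mul_zero, map_zero]
  · show S.inc k (S.p (2 * k) * _ * star (S.blueSum (2 * k))) = S.inc k _
    rw [p_mul_ed]
  · show S.inc k (S.blueSum (2 * k) * _ * star (S.p (2 * k))) = 0
    rw [blueSum_mul_ed, zero_mul, map_zero]
  · show S.inc k (S.blueSum (2 * k) * _ * star (S.blueSum (2 * k))) = 0
    rw [blueSum_mul_ed, zero_mul, map_zero]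

theorem star_infM {U : Set X} (hU : IsClopen U) : star (S.infM U) = S.infM U := S.infMeasure.star_M hU

/-- The elements all of whose compressions, and their adjoints, preserve the span. -/
def CmpPreserves (k : ℕ) (x : S.L (2 * k)) : Prop :=
  ∀ i j, S.Preserves (S.cmp k i j x) ∧ S.Preserves (star (S.cmp k i j x))

variable {S}

theorem CmpPreserves.vl {k : ℕ} (Z : S.P (2 * k)) : S.CmpPreserves k (S.vl (2 * k) Z) := by
  intro i j
  rw [cmp_vl]
  split_ifs
  · rw [star_zero]
    exact ⟨.zero, .zero⟩
  · rw [S.star_infM (S.isClopen Z.2)]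
    exact ⟨.infM (S.isClopen Z.2), .infM (S.isClopen Z.2)⟩

theorem CmpPreserves.vr {k : ℕ} (W : S.P (2 * k + 1)) : S.CmpPreserves k (S.vr (2 * k) W) := by
  intro i j
  rw [cmp_vr]
  split_ifs
  · rw [S.star_infM (S.isClopen W.2)]
    exact ⟨.infM (S.isClopen W.2), .infM (S.isClopen W.2)⟩
  · rw [star_zero]
    exact ⟨.zero, .zero⟩

theorem CmpPreserves.ed {k : ℕ} (e : S.Edge (2 * k)) : S.CmpPreserves k (S.ed (2 * k) e) := by
  intro i j
  rw [cmp_ed]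
  have h1 := isClopen_fst e
  have h2 := isClopen_snd e
  split_ifs
  · rw [star_mul, star_mul, S.star_infM h1, S.star_infM h2, S.star_infM isClopen_univ]
    exact ⟨((Preserves.infM h1).mul (.infM isClopen_univ)).mul (.infM h2),
      (Preserves.infM h2).mul ((Preserves.infM isClopen_univ).mul (.infM h1))⟩
  · rw [star_mul, star_mul, S.star_infM h1, S.star_infM h2]
    exact ⟨((Preserves.infM h1).mul .t).mul (.infM h2),
      (Preserves.infM h2).mul (Preserves.star_t.mul (.infM h1))⟩
  · rw [star_zero]
    exact ⟨.zero, .zero⟩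

theorem CmpPreserves.zero {k : ℕ} : S.CmpPreserves k 0 := by
  intro i j
  rw [cmp_zero, star_zero]
  exact ⟨.zero, .zero⟩

theorem CmpPreserves.add {k : ℕ} {x y : S.L (2 * k)} (hx : S.CmpPreserves k x)
    (hy : S.CmpPreserves k y) : S.CmpPreserves k (x + y) := by
  intro i j
  rw [cmp_add, star_add]
  exact ⟨(hx i j).1.add (hy i j).1, (hx i j).2.add (hy i j).2⟩

theorem CmpPreserves.mul {k : ℕ} {x y : S.L (2 * k)} (hx : S.CmpPreserves k x)
    (hy : S.CmpPreserves k y) : S.CmpPreserves k (x * y) := by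
  intro i j
  rw [cmp_mul, Fintype.sum_bool, star_add, star_mul, star_mul]
  exact ⟨((hx i true).1.mul (hy true j).1).add ((hx i false).1.mul (hy false j).1),
    ((hy true j).2.mul (hx i true).2).add ((hy false j).2.mul (hx i false).2)⟩

theorem CmpPreserves.smul {k : ℕ} {x : S.L (2 * k)} (z : ℂ) (hx : S.CmpPreserves k x) :
    S.CmpPreserves k (z • x) := by
  intro i j
  rw [cmp_smul, star_smul]
  exact ⟨(hx i j).1.smul z, (hx i j).2.smul _⟩

theorem CmpPreserves.star {k : ℕ} {x : S.L (2 * k)} (hx : S.CmpPreserves k x) :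
    S.CmpPreserves k (star x) := by
  intro i j
  rw [cmp_star, star_star]
  exact ⟨(hx j i).2, (hx j i).1⟩

variable (S)

/-- The compressions of vertices and edges are zero or products of M(U) and t. Sums, products and
scalars follow from the matrix rules; adjoints follow because the property includes the adjoints of
the compressions. -/
theorem cmpPreserves (k : ℕ) (x : S.L (2 * k)) : S.CmpPreserves k x := by
  refine StarPres.induction ?_ CmpPreserves.zero (fun x y hx hy => hx.add hy)
    (fun x y hx hy => hx.mul hy) (fun z x hx => hx.smul z) (fun x hx => hx.star) x
  rintro ((Z | W) | e)
  · exact CmpPreserves.vl Z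
  · exact CmpPreserves.vr W
  · exact CmpPreserves.ed e

/-- The colimit of the corners is spanned by the elements `E U m n V`. -/
theorem spanE_infRep : S.infRep.spanE = ⊤ := by
  refine eq_top_iff.mpr fun x _ => ?_
  obtain ⟨k, y, hy, rfl⟩ := S.exists_inc x
  -- An element x of the colimit is a compression, hence preserves the span. As the unit M(X) lies
  -- in the span, so does x = x M(X).
  have h1 : S.cmp k false false y = S.inc k y := by
    show S.inc k (S.p (2 * k) * y * star (S.p (2 * k))) = _
    rw [star_p, hy]
  have h2 : S.infM Set.univ ∈ S.infRep.spanE := by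
    have := S.infRep.E_mem_spanE isClopen_univ isClopen_univ 0 0
    rwa [← S.infRep.M_eq_E isClopen_univ] at this
  have h3 := (S.cmpPreserves k y false false).1 _ h2
  rw [h1] at h3
  have h4 := congrArg star (S.infM_univ_mul (star (S.inc k y)))
  rw [star_mul, star_star, S.star_infM isClopen_univ] at h4
  rwa [h4] at h3

end RefinedSeq

end Generation

theorem ClopenMeasure.sum_M_subFin {X : Type u} [MetricSpace X] [CompactSpace X] {σ : LHomeo X}
    {S : RefinedSeq σ} {A : Type v} [NonUnitalRing A] [StarRing A] (c : ClopenMeasure X A) {k : ℕ}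
    {U : Set X} (hk : S.Meas k U) : ∑ Z ∈ S.subFin k U, c.M Z = c.M U := by
  refine c.sum_M _ (fun Z : S.P k => (Z : Set X)) (fun Z _ => S.isClopen Z.2) ?_ ?_
  · intro Z _ W _ h
    exact (S.part _).disjoint Z Z.2 W W.2 fun h' => h (Subtype.ext h')
  · intro x
    constructor
    · intro hx
      obtain ⟨Z, hZ, hxZ⟩ := S.exists_mem k x
      exact ⟨⟨Z, hZ⟩, S.mem_subFin.mpr (hk Z hZ x hxZ hx), hxZ⟩
    · rintro ⟨Z, hZ, hx⟩
      exact S.mem_subFin.mp hZ hx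

/-! ### Homomorphisms on the colimit are determined by the standard values. -/

section Determined

variable {X : Type u} [MetricSpace X] [CompactSpace X] {σ : LHomeo X} {S : RefinedSeq σ}
variable {A : Type v} [NonUnitalRing A] [StarRing A] [Module ℂ A] [IsScalarTower ℂ A A]
  [SMulCommClass ℂ A A] [StarModule ℂ A] (c : CovRep S A) (F : S.AInf →⋆ₙₐ[ℂ] A)

open RefinedSeq

theorem inc_vl_eq (n : ℕ) (Z : S.P (2 * n)) :
    S.inc n (S.vl (2 * n) Z) = SeqLim.of S.φA n (S.vertexElt n Z) :=
  (S.of_eq_inc n (S.vertexElt n Z)).symm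

theorem hom_infM (hv : ∀ n (Z : S.P (2 * n)), F (SeqLim.of S.φA n (S.vertexElt n Z)) = c.M Z)
    {U : Set X} (hU : IsClopen U) : F (S.infRep.M U) = c.M U := by
  obtain ⟨k, hk⟩ := S.exists_meas_even hU
  show F (S.infM U) = _
  rw [S.infM_eq hk, vtx, map_sum, map_sum]
  simp only [inc_vl_eq, hv]
  exact c.sum_M_subFin hk

/-- The adjoint of the blue sum contains only one term with the right source, because the blue edge
with a given source is unique. This expresses t through standard generators e f*. -/
theorem ed_mul_star_blueSum (n : ℕ) (e f : S.Edge n) (hf : f.isLeft)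
    (h : (S.ends e).2 = (S.ends f).2) : S.ed n e * star (S.blueSum n) = S.ed n e * star (S.ed n f) := by
  rw [blueSum, star_sum, Finset.mul_sum, Finset.sum_eq_single_of_mem f
    (Finset.mem_filter.mpr ⟨Finset.mem_univ _, hf⟩)]
  intro g hg hgf
  refine SumMap.e_mul_star_e_of_ne fun h' => hgf ?_
  have h1 : (S.ends e).2 = (S.ends g).2 := Sum.inr_injective h'
  have h2 : (S.ends g).2 = (S.ends f).2 := h1.symm.trans h
  refine S.sum_isLeft_eq ((Finset.mem_filter.mp hg).2.trans hf.symm) (Prod.ext ?_ h2)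
  have h3 : ∀ x : S.Edge n, x.isLeft → ((S.ends x).2 : Set X) ⊆ (S.ends x).1 := by
    rintro (x | x) hx
    · exact x.2
    · cases hx
  exact S.eq_of_superset (h3 g (Finset.mem_filter.mp hg).2) (h2 ▸ h3 f hf)

/-- The red edges with range Z contribute M(Z) t, as their sources tile σ(Z) and M(Z) t M(σ Z) =
M(Z) t; then sum over the partition. -/
theorem sum_red_chi : ∑ e : S.Edge (2 * 0) with e.isRight, c.chi e = c.t := by
  have h1 : ∀ Z : S.P (2 * 0), ∑ e ∈ S.redFin (2 * 0) Z, c.chi e = c.M Z * c.t := by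
    intro Z
    have h2 : ∀ e ∈ S.redFin (2 * 0) Z, c.chi e = c.M Z * c.t * c.M (S.ends e).2 := by
      intro e he
      obtain ⟨h1, h2⟩ := S.mem_redFin.mp he
      rcases e with e | e
      · cases h1
      · rw [c.chi_red_even (by simp), ← h2]
        rfl
    have hZ := S.isClopen Z.2
    have hi := isClopen_image σ hZ
    rw [Finset.sum_congr rfl h2, ← Finset.mul_sum, c.sum_M_redSet (by simp) Z _ (S.coe_redFin _ _),
      mul_assoc, c.t_mul hi, ← mul_assoc, c.M_mul_of_subset hZ (isClopen_preimage σ hi)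
      (Set.subset_preimage_image _ _)]
  have h3 : ∑ Z : S.P (2 * 0), c.M Z * c.t = c.t := by
    rw [← Finset.sum_mul, c.sum_M_part, c.M_univ_mul_t]
  refine Eq.trans ?_ h3
  rw [← Finset.sum_congr rfl fun Z _ => h1 Z, Finset.sum_sigma']
  refine Finset.sum_bij' (fun e _ => ⟨(S.ends e).1, e⟩) (fun a _ => a.2) ?_ ?_ ?_ ?_ ?_
  · intro e he
    exact Finset.mem_sigma.mpr ⟨Finset.mem_univ _, S.mem_redFin.mpr ⟨(Finset.mem_filter.mp he).2, rfl⟩⟩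
  · rintro ⟨Z, e⟩ h
    exact Finset.mem_filter.mpr ⟨Finset.mem_univ _, (S.mem_redFin.mp (Finset.mem_sigma.mp h).2).1⟩
  · intro _ _; rfl
  · rintro ⟨Z, e⟩ h
    have h' : (S.ends e).1 = Z := (S.mem_redFin.mp (Finset.mem_sigma.mp h).2).2
    subst h'
    rfl
  · intro _ _; rfl

/-- The element t is the sum of e f* over the red edges e of layer 0, where f is the blue edge with
the same source. So the edge values in layer 0 alone determine its image. -/
theorem hom_inft (he : ∀ e f : S.Edge (2 * 0), (S.ends e).2 = (S.ends f).2 →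
      F (SeqLim.of S.φA 0 (S.edgeElt 0 e f)) = c.chi e * star (c.chi f)) :
    F S.infRep.t = c.t := by
  show F (S.inc 0 (S.tElt 0)) = _
  rw [tElt, redSum, Finset.sum_mul, map_sum, map_sum, ← sum_red_chi c]
  refine Finset.sum_congr rfl fun e _ => ?_
  obtain ⟨Z, hZ⟩ := S.exists_unique_superset (2 * 0) (S.ends e).2
  have h := he e (.inl ⟨(Z, (S.ends e).2), hZ⟩) rfl
  rw [S.of_eq_inc] at h
  rw [ed_mul_star_blueSum (2 * 0) e (.inl ⟨(Z, (S.ends e).2), hZ⟩) rfl rfl]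
  refine h.trans ?_
  exact (congrArg (c.chi e * ·) (c.star_M (isClopen_snd e))).trans (c.chi_mul_M e)

theorem hom_tp (hv : ∀ n (Z : S.P (2 * n)), F (SeqLim.of S.φA n (S.vertexElt n Z)) = c.M Z)
    (he : ∀ e f : S.Edge (2 * 0), (S.ends e).2 = (S.ends f).2 →
      F (SeqLim.of S.φA 0 (S.edgeElt 0 e f)) = c.chi e * star (c.chi f)) (m : ℕ) :
    F (S.infRep.tp m) = c.tp m := by
  induction m with
  | zero => exact hom_infM c F hv isClopen_univ
  | succ m ih => rw [CovRep.tp, map_mul, hom_inft c F he, ih, CovRep.tp]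

theorem hom_infE (hv : ∀ n (Z : S.P (2 * n)), F (SeqLim.of S.φA n (S.vertexElt n Z)) = c.M Z)
    (he : ∀ e f : S.Edge (2 * 0), (S.ends e).2 = (S.ends f).2 →
      F (SeqLim.of S.φA 0 (S.edgeElt 0 e f)) = c.chi e * star (c.chi f))
    {U V : Set X} (hU : IsClopen U) (hV : IsClopen V) (m n : ℕ) :
    F (S.infRep.E U m n V) = c.E U m n V := by
  rw [CovRep.E, map_mul, map_mul, map_mul, map_star, hom_infM c F hv hU, hom_infM c F hv hV,
    hom_tp c F hv he, hom_tp c F hv he, CovRep.E]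

theorem hom_ext_of_values {G : S.AInf →⋆ₙₐ[ℂ] A}
    (hv : ∀ n (Z : S.P (2 * n)), F (SeqLim.of S.φA n (S.vertexElt n Z)) = c.M Z)
    (he : ∀ e f : S.Edge (2 * 0), (S.ends e).2 = (S.ends f).2 →
      F (SeqLim.of S.φA 0 (S.edgeElt 0 e f)) = c.chi e * star (c.chi f))
    (hv' : ∀ n (Z : S.P (2 * n)), G (SeqLim.of S.φA n (S.vertexElt n Z)) = c.M Z)
    (he' : ∀ e f : S.Edge (2 * 0), (S.ends e).2 = (S.ends f).2 →
      G (SeqLim.of S.φA 0 (S.edgeElt 0 e f)) = c.chi e * star (c.chi f)) (x : S.AInf) : F x = G x := by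
  have hx : x ∈ S.infRep.spanE := by
    rw [S.spanE_infRep]
    trivial
  induction hx using Submodule.span_induction with
  | mem x hx =>
    obtain ⟨U, m, n, V, hU, hV, rfl⟩ := hx
    rw [hom_infE c F hv he hU hV, hom_infE c G hv' he' hU hV]
  | zero => rw [map_zero, map_zero]
  | add x y _ _ hx hy => rw [map_add, map_add, hx, hy]
  | smul z x _ hx => rw [map_smul, map_smul, hx]

theorem infHom_infE {U V : Set X} (hU : IsClopen U) (hV : IsClopen V) (m n : ℕ) :
    c.infHom (S.infRep.E U m n V) = c.E U m n V :=
  hom_infE c c.infHom c.infHom_vertexElt (fun e f _ => c.infHom_edgeElt 0 e f) hU hV m n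

end Determined


/-! ### A normal form at one level and in one partition. -/

section NormalForm

variable {X : Type u} [MetricSpace X] [CompactSpace X] {σ : LHomeo X} {S : RefinedSeq σ}
variable {A : Type v} [NonUnitalRing A] [StarRing A] (c : CovRep S A)

namespace CovRep

theorem E_eq_sum_subFin {U V : Set X} {N : ℕ} (hU : S.Meas N U) (hV : S.Meas N V) (m n : ℕ) :
    c.E U m n V = ∑ Y ∈ S.subFin N U, ∑ Y' ∈ S.subFin N V, c.E Y m n Y' := by
  simp only [E]
  rw [← c.sum_M_subFin hU, ← c.sum_M_subFin hV, Finset.sum_mul, Finset.sum_mul]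
  simp only [Finset.mul_sum]

variable [Module ℂ A] [IsScalarTower ℂ A A] [SMulCommClass ℂ A A] [StarModule ℂ A]

/-- The span of the elements `E U m n V` with `min m n = K`. -/
def levelSpan (K : ℕ) : Submodule ℂ A :=
  Submodule.span ℂ {a | ∃ (U : Set X) (k : ℤ) (V : Set X), IsClopen U ∧ IsClopen V ∧
    a = c.E U (K + k.toNat) (K + (-k).toNat) V}

/-- The exponents K + k⁺ and K + k⁻ have difference k and minimum K; raising both by one keeps k and
replaces K by K + 1. -/
theorem levelSpan_le_succ (K : ℕ) : c.levelSpan K ≤ c.levelSpan (K + 1) := by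
  refine Submodule.span_le.mpr ?_
  rintro _ ⟨U, k, V, hU, hV, rfl⟩
  rw [c.E_raise hU hV]
  refine Submodule.sum_mem _ fun Z _ => Submodule.subset_span ⟨U ∩ σ^[K + k.toNat] ⁻¹' Z, k,
    σ^[K + (-k).toNat] ⁻¹' Z ∩ V, hU.inter (isClopen_iterate σ (S.isClopen Z.2) _),
    (isClopen_iterate σ (S.isClopen Z.2) _).inter hV, ?_⟩
  rw [Nat.add_right_comm K 1, Nat.add_right_comm K 1]

theorem exists_mem_levelSpan {x : A} (hx : x ∈ c.spanE) : ∃ K, x ∈ c.levelSpan K := by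
  have hm : Monotone c.levelSpan := monotone_nat_of_le_succ c.levelSpan_le_succ
  induction hx using Submodule.span_induction with
  | mem x hx =>
    obtain ⟨U, m, n, V, hU, hV, rfl⟩ := hx
    refine ⟨min m n, Submodule.subset_span ⟨U, (m : ℤ) - n, V, hU, hV, ?_⟩⟩
    congr 1 <;> omega
  | zero => exact ⟨0, Submodule.zero_mem _⟩
  | add x y _ _ hx hy =>
    obtain ⟨K, hK⟩ := hx
    obtain ⟨L, hL⟩ := hy
    exact ⟨max K L, Submodule.add_mem _ (hm (le_max_left K L) hK) (hm (le_max_right K L) hL)⟩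
  | smul z x _ hx =>
    obtain ⟨K, hK⟩ := hx
    exact ⟨K, Submodule.smul_mem _ z hK⟩

/-- The elements `E Y m n Y'` with `min m n = K` and `Y`, `Y'` in the `N`-th partition. -/
def basicE (K N : ℕ) (i : ℤ × S.P N × S.P N) : A :=
  c.E i.2.1 (K + i.1.toNat) (K + (-i.1).toNat) i.2.2

theorem E_mem_span_basicE {U V : Set X} {N : ℕ} (hU : S.Meas N U) (hV : S.Meas N V) (K : ℕ) (k : ℤ) :
    c.E U (K + k.toNat) (K + (-k).toNat) V ∈ Submodule.span ℂ (Set.range (c.basicE K N)) := by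
  rw [c.E_eq_sum_subFin hU hV]
  exact Submodule.sum_mem _ fun Y _ => Submodule.sum_mem _ fun Y' _ =>
    Submodule.subset_span ⟨(k, Y, Y'), rfl⟩

theorem span_basicE_le_succ (K N : ℕ) : Submodule.span ℂ (Set.range (c.basicE K N)) ≤
    Submodule.span ℂ (Set.range (c.basicE K (N + 1))) := by
  refine Submodule.span_le.mpr ?_
  rintro _ ⟨⟨k, Y, Y'⟩, rfl⟩
  exact c.E_mem_span_basicE (RefinedSeq.meas_part Y).succ (RefinedSeq.meas_part Y').succ K k

/-- The spans increase with the level and with the partition, so finitely many terms can be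
collected at one level and over one partition. There the cylinders are indexed by degree and by a
pair of parts, hence are disjoint. -/
theorem exists_mem_span_basicE {x : A} (hx : x ∈ c.spanE) :
    ∃ K N, x ∈ Submodule.span ℂ (Set.range (c.basicE K N)) := by
  obtain ⟨K, hK⟩ := c.exists_mem_levelSpan hx
  have hm : Monotone fun N => Submodule.span ℂ (Set.range (c.basicE K N)) :=
    monotone_nat_of_le_succ (c.span_basicE_le_succ K)
  refine ⟨K, ?_⟩
  clear hx
  induction hK using Submodule.span_induction with
  | mem x hx =>
    obtain ⟨U, k, V, hU, hV, rfl⟩ := hx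
    obtain ⟨N, h1, h2⟩ := S.exists_meas_pair hU hV
    exact ⟨2 * N, c.E_mem_span_basicE h1 h2 K k⟩
  | zero => exact ⟨0, Submodule.zero_mem _⟩
  | add x y _ _ hx hy =>
    obtain ⟨N, hN⟩ := hx
    obtain ⟨L, hL⟩ := hy
    exact ⟨max N L, Submodule.add_mem _ (hm (le_max_left N L) hN) (hm (le_max_right N L) hL)⟩
  | smul z x _ hx =>
    obtain ⟨N, hN⟩ := hx
    exact ⟨N, Submodule.smul_mem _ z hN⟩

end CovRep

end NormalForm

/-! ### The isomorphism with the Steinberg algebra. -/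

section Isomorphism

open DR

variable {X : Type u} [MetricSpace X] [CompactSpace X] [TotallyDisconnectedSpace X] {σ : LHomeo X}

/-- The homomorphism from the colimit of the corners to the Steinberg algebra. -/
def infSteinberg (S : RefinedSeq σ) : S.AInf →⋆ₙₐ[ℂ] Steinberg σ := (steinbergRep S).infHom

variable (S : RefinedSeq σ)

theorem infSteinberg_surjective : Function.Surjective (infSteinberg S) := by
  intro f
  have hf : f ∈ (steinbergRep S).spanE := by
    rw [spanE_steinbergRep]
    trivial
  induction hf using Submodule.span_induction with
  | mem x hx =>
    obtain ⟨U, m, n, V, hU, hV, rfl⟩ := hx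
    exact ⟨_, infHom_infE (steinbergRep S) hU hV m n⟩
  | zero => exact ⟨0, map_zero _⟩
  | add x y _ _ hx hy =>
    obtain ⟨a, rfl⟩ := hx
    obtain ⟨b, rfl⟩ := hy
    exact ⟨a + b, map_add _ a b⟩
  | smul z x _ hx =>
    obtain ⟨a, rfl⟩ := hx
    exact ⟨z • a, map_smul _ z a⟩

theorem infSteinberg_basicE (K N : ℕ) (i : ℤ × S.P N × S.P N) (γ : DR σ) :
    infSteinberg S (S.infRep.basicE K N i) γ =
      (cyl σ (i.2.1 : Set X) (K + i.1.toNat) (K + (-i.1).toNat) i.2.2).indicator (fun _ => 1) γ := by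
  rw [← steinbergRep_E_apply S (S.isClopen i.2.1.2) (S.isClopen i.2.2.2)]
  exact congrArg (fun f : Steinberg σ => f γ)
    (infHom_infE (steinbergRep S) (S.isClopen i.2.1.2) (S.isClopen i.2.2.2) _ _)

/-- Evaluation at an element of the groupoid. -/
def evalAt (γ : DR σ) : Steinberg σ →ₗ[ℂ] ℂ where
  toFun f := f γ
  map_add' _ _ := rfl
  map_smul' _ _ := rfl

/-- In normal form the images are characteristic functions of pairwise disjoint sets. The nonempty
ones are therefore linearly independent, and the terms with empty sets already vanish in the
colimit. -/
theorem infSteinberg_injective : Function.Injective (infSteinberg S) := by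
  classical
  rw [injective_iff_map_eq_zero]
  intro x hx
  obtain ⟨K, N, h⟩ := S.infRep.exists_mem_span_basicE (x := x) (by rw [S.spanE_infRep]; trivial)
  obtain ⟨a, rfl⟩ := Finsupp.mem_span_range_iff_exists_finsupp.mp h
  refine Finset.sum_eq_zero fun i hi => ?_
  by_cases hne : (cyl σ (i.2.1 : Set X) (K + i.1.toNat) (K + (-i.1).toNat) i.2.2).Nonempty
  · obtain ⟨γ, hγ⟩ := hne
    have h0 := congrArg (evalAt γ) hx
    rw [Finsupp.sum, map_sum, map_sum, map_zero, Finset.sum_eq_single_of_mem i hi] at h0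
    · have h1 : evalAt γ (infSteinberg S (S.infRep.basicE K N i)) = 1 :=
        (infSteinberg_basicE S K N i γ).trans (Set.indicator_of_mem hγ _)
      rw [map_smul, map_smul, h1, smul_eq_mul, mul_one] at h0
      show a i • S.infRep.basicE K N i = 0
      rw [h0, zero_smul]
    · intro j _ hj
      have h1 : evalAt γ (infSteinberg S (S.infRep.basicE K N j)) = 0 := by
        refine (infSteinberg_basicE S K N j γ).trans (Set.indicator_of_notMem (fun hγ' => hj ?_) _)
        -- The point γ determines its degree and the parts containing its range and its source, so
        -- it lies in at most one of the cylinders.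
        refine Prod.ext ?_ (Prod.ext (Subtype.ext ?_) (Subtype.ext ?_))
        · have h2 := hγ.2.2.1
          have h3 := hγ'.2.2.1
          push_cast at h2 h3
          omega
        · exact S.eq_of_mem j.2.1.2 i.2.1.2 hγ'.1 hγ.1
        · exact S.eq_of_mem j.2.2.2 i.2.2.2 hγ'.2.1 hγ.2.1
      rw [map_smul, map_smul, h1, smul_zero]
  · have : S.infRep.basicE K N i = 0 := by
      -- A pair x, y with equal images under the two powers of σ would be a point of the empty
      -- cylinder.
      refine S.infRep.E_eq_zero (S.isClopen i.2.1.2) (S.isClopen i.2.2.2) _ _ fun x hx y hy hxy => ?_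
      have hd : i.1 = ((K + i.1.toNat : ℕ) : ℤ) - (K + (-i.1).toNat : ℕ) := by
        push_cast
        omega
      exact hne ⟨⟨(x, i.1, y), _, _, hd, hxy⟩, hx, hy, hd, hxy⟩
    show a i • S.infRep.basicE K N i = 0
    rw [this, smul_zero]

/-- The isomorphism of the colimit of the corners with the Steinberg algebra. -/
def infEquiv : S.AInf ≃⋆ₐ[ℂ] Steinberg σ :=
  StarAlgEquiv.ofBijective (infSteinberg S) ⟨infSteinberg_injective S, infSteinberg_surjective S⟩

theorem infEquiv_apply (x : S.AInf) : infEquiv S x = infSteinberg S x := rfl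

theorem hasStandardValues_infEquiv : S.HasStandardValues (infEquiv S) where
  vertex n U := by
    rw [infEquiv_apply, ← steinbergRep_E_apply S (S.isClopen U.2) (S.isClopen U.2),
      ← CovRep.M_eq_E _ (S.isClopen U.2)]
    exact congrArg (fun f : Steinberg σ => f.1) ((steinbergRep S).infHom_vertexElt n U)
  edge n e f h := by
    rw [infEquiv_apply, ← steinbergRep_E_apply S (CovRep.isClopen_edgeSet e) (CovRep.isClopen_edgeSet f),
      ← CovRep.chi_mul_star_chi _ (even_two_mul n) e f (Sum.inr_injective h)]
    exact congrArg (fun f : Steinberg σ => f.1) ((steinbergRep S).infHom_edgeElt n e f)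

theorem RefinedSeq.HasStandardValues.eq_infEquiv {S : RefinedSeq σ} {φ : S.AInf ≃⋆ₐ[ℂ] Steinberg σ}
    (h : S.HasStandardValues φ) : φ = infEquiv S := by
  refine StarAlgEquiv.ext fun x => ?_
  refine hom_ext_of_values (steinbergRep S) (φ : S.AInf →⋆ₙₐ[ℂ] Steinberg σ) ?_ ?_
    (G := infSteinberg S) (steinbergRep S).infHom_vertexElt
    (fun e f _ => (steinbergRep S).infHom_edgeElt 0 e f) x
  · intro n Z
    refine Eq.trans (Subtype.ext ?_) ((steinbergRep S).infHom_vertexElt n Z)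
    exact (h.vertex n Z).trans ((hasStandardValues_infEquiv S).vertex n Z).symm
  · intro e f hef
    refine Eq.trans (Subtype.ext ?_) ((steinbergRep S).infHom_edgeElt 0 e f)
    exact (h.edge 0 e f (congrArg Sum.inr hef)).trans
      ((hasStandardValues_infEquiv S).edge 0 e f (congrArg Sum.inr hef)).symm

theorem existsUnique_hasStandardValues : ∃! φ : S.AInf ≃⋆ₐ[ℂ] Steinberg σ, S.HasStandardValues φ :=
  ⟨infEquiv S, hasStandardValues_infEquiv S, fun _ h => h.eq_infEquiv⟩

end Isomorphism


/-! ### The universal property of enveloping C*-algebras. -/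

namespace Env

section Lift

variable {A : Type u} [NonUnitalRing A] [StarRing A] [Module ℂ A] [IsScalarTower ℂ A A]
  [SMulCommClass ℂ A A] [StarModule ℂ A] [CStarBounded A]
variable {C : Type v} [NonUnitalCStarAlgebra C]

theorem isCStarSeminorm_norm : IsCStarSeminorm (normSeminorm ℂ C) where
  mul_le a b := norm_mul_le a b
  star_mul_self a := by
    show ‖star a * a‖ = ‖a‖ ^ 2
    rw [CStarRing.norm_star_mul_self, pow_two]

/-- *-homomorphisms between C*-algebras are contractive, which gives one inequality; the norm is
itself a C*-seminorm, which gives the other. -/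
theorem norm_ι_eq (a : C) : ‖(ι a : Env C)‖ = ‖a‖ := by
  refine le_antisymm (NonUnitalStarAlgHom.norm_apply_le (ι : C →⋆ₙₐ[ℂ] Env C) a) ?_
  rw [norm_ι]
  exact le_univSeminorm (isCStarSeminorm_norm (C := C)) a

/-- An isometry from a complete space has closed range, and here the range is dense. -/
theorem ι_bijective : Function.Bijective (ι : C →⋆ₙₐ[ℂ] Env C) := by
  have hi : Isometry (ι : C →⋆ₙₐ[ℂ] Env C) := AddMonoidHomClass.isometry_of_norm _ norm_ι_eq
  refine ⟨hi.injective, ?_⟩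
  have hc : IsClosed (Set.range (ι : C →⋆ₙₐ[ℂ] Env C)) := hi.isClosedEmbedding.isClosed_range
  exact Set.range_eq_univ.mp (hc.closure_eq.symm.trans (denseRange_ι (A := C)).closure_range)

/-- The enveloping `C*`-algebra of a `C*`-algebra is the algebra itself. -/
def equivSelf : C ≃⋆ₐ[ℂ] Env C := StarAlgEquiv.ofBijective (ι : C →⋆ₙₐ[ℂ] Env C) ι_bijective

/-- The universal property of the enveloping `C*`-algebra. -/
def lift (f : A →⋆ₙₐ[ℂ] C) : Env A →⋆ₙₐ[ℂ] C :=
  ((equivSelf (C := C)).symm : Env C →⋆ₙₐ[ℂ] C).comp (map f)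

theorem lift_ι (f : A →⋆ₙₐ[ℂ] C) (a : A) : lift f (ι a) = f a := by
  show (equivSelf (C := C)).symm (map f (ι a)) = f a
  rw [map_ι]
  exact (equivSelf (C := C)).symm_apply_apply (f a)

theorem continuous_hom {D : Type w} [NonUnitalCStarAlgebra D] (f : D →⋆ₙₐ[ℂ] C) : Continuous f :=
  AddMonoidHomClass.continuous_of_bound f 1 fun a => by
    rw [one_mul]
    exact NonUnitalStarAlgHom.norm_apply_le f a

theorem apply_apply_eq_self {D : Type w} [NonUnitalCStarAlgebra D] (f : C →⋆ₙₐ[ℂ] D)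
    (g : D →⋆ₙₐ[ℂ] C) {T : Type*} {k : T → C} (hk : DenseRange k) (h : ∀ t, g (f (k t)) = k t) (x : C) :
    g (f x) = x :=
  congrFun (hk.equalizer ((continuous_hom g).comp (continuous_hom f)) continuous_id (funext h)) x

theorem apply_eq_apply {D : Type w} [NonUnitalCStarAlgebra D] (f g : C →⋆ₙₐ[ℂ] D) {T : Type*} {k : T → C}
    (hk : DenseRange k) (h : ∀ t, f (k t) = g (k t)) (x : C) : f x = g x :=
  congrFun (hk.equalizer (continuous_hom f) (continuous_hom g) (funext h)) x

/-- The image of a dense subset is dense in the closure of the image. -/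
theorem apply_mem_closure {D : Type w} [NonUnitalCStarAlgebra D] (f : C →⋆ₙₐ[ℂ] D) {T : Type*} {k : T → C}
    (hk : DenseRange k) {s : Set D} (h : ∀ t, f (k t) ∈ s) (x : C) : f x ∈ closure s :=
  map_mem_closure (continuous_hom f) (hk x) (by rintro _ ⟨t, rfl⟩; exact h t)

theorem denseRange_of_ι_mem {T : Type*} {k : T → Env A} (h : ∀ a, ι a ∈ closure (Set.range k)) :
    DenseRange k := fun x =>
  closure_minimal (by rintro _ ⟨a, rfl⟩; exact h a) isClosed_closure (denseRange_ι (A := A) x)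

theorem hom_ext {f g : Env A →⋆ₙₐ[ℂ] C} (h : ∀ a, f (ι a) = g (ι a)) (x : Env A) : f x = g x :=
  apply_eq_apply f g denseRange_ι h x

end Lift

end Env

/-! ### The universal property of the C*-colimit. -/

namespace CStarSeqLim

variable {B : ℕ → Type u} [∀ n, NonUnitalCStarAlgebra (B n)] {φ : ∀ n, B n →⋆ₙₐ[ℂ] B (n + 1)}
variable {C : Type v} [NonUnitalCStarAlgebra C]

variable (φ) in
/-- The canonical map of a stage into the `C*`-colimit. -/
def of (n : ℕ) : B n →⋆ₙₐ[ℂ] CStarSeqLim φ := Env.ι.comp (SeqLim.of φ n)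

/-- The universal property of the `C*`-colimit. -/
def lift (g : ∀ n, B n →⋆ₙₐ[ℂ] C) (hg : ∀ n x, g (n + 1) (φ n x) = g n x) :
    CStarSeqLim φ →⋆ₙₐ[ℂ] C := Env.lift (SeqLim.lift g hg)

theorem lift_of (g : ∀ n, B n →⋆ₙₐ[ℂ] C) (hg : ∀ n x, g (n + 1) (φ n x) = g n x) (n : ℕ) (x : B n) :
    lift g hg (of φ n x) = g n x :=
  (Env.lift_ι (SeqLim.lift g hg) (SeqLim.of φ n x)).trans (SeqLim.lift_of g hg n x)

/-- The maps of the stages are continuous, so it suffices to reach a dense subset of each stage; the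
algebraic union of the stages is dense in the colimit. -/
theorem denseRange_of_stages {T : ℕ → Type*} {k : ∀ n, T n → B n} (hk : ∀ n, DenseRange (k n))
    {T' : Type*} {K : T' → CStarSeqLim φ} (h : ∀ n t, of φ n (k n t) ∈ Set.range K) : DenseRange K := by
  refine Env.denseRange_of_ι_mem fun b => ?_
  obtain ⟨n, y, rfl⟩ := SeqLim.exists_of b
  exact Env.apply_mem_closure (of φ n) (hk n) (h n) y

end CStarSeqLim

/-! ### Images of covariant representations under *-homomorphisms. -/

section MapRep

variable {X : Type u} [MetricSpace X] [CompactSpace X] {σ : LHomeo X} {S : RefinedSeq σ}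
variable {A : Type v} [NonUnitalRing A] [StarRing A] [Module ℂ A] {B : Type w} [NonUnitalRing B]
  [StarRing B] [Module ℂ B]

/-- The image of a covariant representation under a `*`-homomorphism. -/
def CovRep.map (c : CovRep S A) (f : A →⋆ₙₐ[ℂ] B) : CovRep S B where
  M U := f (c.M U)
  M_mul hU hV := by rw [← map_mul, c.M_mul hU hV]
  star_M hU := by rw [← map_star, c.star_M hU]
  M_union hU hV h := by rw [c.M_union hU hV h, map_add]
  t := f c.t
  M_univ_mul_t := by rw [← map_mul, c.M_univ_mul_t]
  t_mul hU := by rw [← map_mul, c.t_mul hU, map_mul]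
  range_part Z hZ := by rw [← map_star, ← map_mul, ← map_mul, ← map_mul, c.range_part Z hZ]
  transfer_part Z hZ := by rw [← map_star, ← map_mul, ← map_mul, c.transfer_part Z hZ]

theorem CovRep.map_chi (c : CovRep S A) (f : A →⋆ₙₐ[ℂ] B) {n : ℕ} (e : S.Edge n) :
    (c.map f).chi e = f (c.chi e) := by
  rcases e with e | e
  · rfl
  · unfold CovRep.chi
    split_ifs
    · rw [map_mul, map_mul]
      rfl
    · rw [map_mul, map_mul, map_star]
      rfl

variable [IsScalarTower ℂ A A] [SMulCommClass ℂ A A] [StarModule ℂ A] [IsScalarTower ℂ B B]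
  [SMulCommClass ℂ B B] [StarModule ℂ B]

/-- Both sides are homomorphisms with the same values on vertices and on layer 0 edges, and these
determine a homomorphism on the colimit. -/
theorem CovRep.map_infHom (c : CovRep S A) (f : A →⋆ₙₐ[ℂ] B) (x : S.AInf) :
    (c.map f).infHom x = f (c.infHom x) :=
  hom_ext_of_values (c.map f) (c.map f).infHom (G := f.comp c.infHom) (c.map f).infHom_vertexElt
    (fun e f' _ => (c.map f).infHom_edgeElt 0 e f') (fun n Z => congrArg f (c.infHom_vertexElt n Z))
    (fun e f' _ => by
      have h := congrArg f (c.infHom_edgeElt 0 e f')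
      rw [map_mul f, map_star f] at h
      exact h.trans (congrArg₂ (fun a b => a * star b) (c.map_chi f e).symm (c.map_chi f f').symm)) x

end MapRep

theorem RefinedSeq.canonical_of {X : Type u} [MetricSpace X] [CompactSpace X] {σ : LHomeo X}
    (S : RefinedSeq σ) (n : ℕ) (x : S.A n) :
    S.canonical (SeqLim.of S.φA n x) = CStarSeqLim.of S.φB n (S.cornerι n x) := rfl

/-! ### Extension of the matrix representations to graph C*-algebras. -/

section Completed

variable {X : Type u} [MetricSpace X] [CompactSpace X] {σ : LHomeo X} {S : RefinedSeq σ}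
variable {C : Type v} [NonUnitalCStarAlgebra C] [PartialOrder C] [StarOrderedRing C] (c : CovRep S C)

namespace CovRep

/-- The extension of `layerHom` to the graph `C*`-algebra of a layer. -/
def layerHomC (n : ℕ) : S.CS n →⋆ₙₐ[ℂ] CStarMatrix Bool Bool C := Env.lift (c.layerHom n)

theorem layerHomC_connectC (n : ℕ) (x : S.CS n) :
    c.layerHomC (n + 1) (S.connectC n x) = c.layerHomC n x :=
  Env.hom_ext (f := (c.layerHomC (n + 1)).comp (S.connectC n)) (g := c.layerHomC n) (fun a => by
    show c.layerHomC (n + 1) (S.connectC n (Env.ι a)) = _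
    rw [RefinedSeq.connectC, Env.map_ι, layerHomC, Env.lift_ι, layerHomC, Env.lift_ι,
      layerHom_connect]) x

/-- The homomorphism of the corner of a graph `C*`-algebra. -/
def cornerHomC (n : ℕ) : S.B n →⋆ₙₐ[ℂ] C :=
  cornerEntry (c.layerHomC (2 * n)) (S.isStarProjection_pC _) (u := c.M Set.univ) <| by
    rw [layerHomC, Env.lift_ι, layerHom_p_even]

theorem cornerHomC_φB (n : ℕ) (x : S.B n) : c.cornerHomC (n + 1) (S.φB n x) = c.cornerHomC n x := by
  show c.layerHomC (2 * n + 1 + 1) (S.connectC (2 * n + 1) (S.connectC (2 * n) (x : S.CS (2 * n))))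
    false false = c.layerHomC (2 * n) x false false
  rw [layerHomC_connectC, layerHomC_connectC]

theorem cornerHomC_cornerι (n : ℕ) (x : S.A n) :
    c.cornerHomC n (S.cornerι n x) = c.layerHom (2 * n) x false false := by
  show c.layerHomC (2 * n) (Env.ι (x : S.L (2 * n))) false false = _
  rw [layerHomC, Env.lift_ι]

/-- The homomorphism of the `C*`-colimit given by a covariant representation in a `C*`-algebra. -/
def infHomC : S.BInf →⋆ₙₐ[ℂ] C := CStarSeqLim.lift c.cornerHomC c.cornerHomC_φB

theorem infHomC_canonical_of (n : ℕ) (x : S.A n) :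
    c.infHomC (S.canonical (SeqLim.of S.φA n x)) = c.infHom (SeqLim.of S.φA n x) :=
  (congrArg c.infHomC (S.canonical_of n x)).trans
    ((CStarSeqLim.lift_of c.cornerHomC c.cornerHomC_φB n (S.cornerι n x)).trans
      ((c.cornerHomC_cornerι n x).trans (c.infHom_of n x).symm))

/-- The homomorphisms of the corners are extensions of the algebraic ones, so the homomorphism on
the C*-colimit restricts to the algebraic one along the canonical map. -/
theorem infHomC_canonical (a : S.AInf) : c.infHomC (S.canonical a) = c.infHom a :=
  (SeqLim.exists_of a).elim fun n h => h.elim fun x hx =>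
    (congrArg (fun b => c.infHomC (S.canonical b)) hx).symm.trans
      ((c.infHomC_canonical_of n x).trans (congrArg c.infHom hx))

end CovRep

end Completed

/-! ### Density of the algebraic colimit in the C*-colimit. -/

section Density

variable {X : Type u} [MetricSpace X] [CompactSpace X] {σ : LHomeo X} {S : RefinedSeq σ}
variable {C : Type v} [NonUnitalCStarAlgebra C]

namespace RefinedSeq

/-- The compression of an element of the graph `C*`-algebra of an even layer. -/
def comprC (n : ℕ) (z : S.CS (2 * n)) : S.B n :=
  ⟨Env.ι (S.p (2 * n)) * z * Env.ι (S.p (2 * n)), z, rfl⟩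

theorem comprC_ι (n : ℕ) (a : S.L (2 * n)) :
    comprC n (Env.ι a) = S.cornerι n ⟨S.p (2 * n) * a * S.p (2 * n), a, rfl⟩ := by
  refine Subtype.ext ?_
  show Env.ι (S.p (2 * n)) * Env.ι a * Env.ι (S.p (2 * n)) = Env.ι (S.p (2 * n) * a * S.p (2 * n))
  rw [map_mul, map_mul]

theorem comprC_self (n : ℕ) (y : S.B n) : comprC n (y : S.CS (2 * n)) = y :=
  Subtype.ext (mem_corner_iff.mp y.2)

/-- Compression by p is continuous, is the identity on the corner and carries the dense image of
L_{2n} into the image of the algebraic corner. -/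
theorem denseRange_cornerι (n : ℕ) : DenseRange (S.cornerι n) := by
  have hc : Continuous (comprC (S := S) n) :=
    ((continuous_const.mul continuous_id).mul continuous_const).subtype_mk _
  intro y
  rw [← comprC_self n y]
  refine map_mem_closure hc (Env.denseRange_ι (A := S.L (2 * n)) y) ?_
  rintro _ ⟨a, rfl⟩
  rw [comprC_ι]
  exact Set.mem_range_self _

theorem denseRange_canonical : DenseRange S.canonical :=
  CStarSeqLim.denseRange_of_stages (φ := S.φB) (k := fun n => S.cornerι n) denseRange_cornerι
    fun n x => ⟨SeqLim.of S.φA n x, S.canonical_of n x⟩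

/-- A `*`-homomorphism on the `C*`-colimit is determined by its values on the algebraic colimit. -/
theorem hom_ext_canonical {f g : S.BInf →⋆ₙₐ[ℂ] C}
    (h : ∀ a, f (S.canonical a) = g (S.canonical a)) (x : S.BInf) : f x = g x :=
  Env.apply_eq_apply f g denseRange_canonical h x

end RefinedSeq

end Density

/-! ### The isomorphism of C*-algebras and the theorem. -/

section Main

variable {X : Type u} [MetricSpace X] [CompactSpace X] [TotallyDisconnectedSpace X] {σ : LHomeo X}
variable (S : RefinedSeq σ)

/-- The homomorphism from the `C*`-colimit to the groupoid `C*`-algebra. -/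
def toGroupoidCStar : S.BInf →⋆ₙₐ[ℂ] GroupoidCStar σ :=
  -- The order serves only to give the 2 × 2 matrices over C*(G) their C*-algebra structure.
  letI := CStarAlgebra.spectralOrder (GroupoidCStar σ)
  letI := CStarAlgebra.spectralOrderedRing (GroupoidCStar σ)
  ((steinbergRep S).map Env.ι).infHomC

theorem toGroupoidCStar_canonical (a : S.AInf) :
    toGroupoidCStar S (S.canonical a) = Env.ι (infEquiv S a) := by
  let _ := CStarAlgebra.spectralOrder (GroupoidCStar σ)
  have _ := CStarAlgebra.spectralOrderedRing (GroupoidCStar σ)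
  exact (CovRep.infHomC_canonical _ a).trans (CovRep.map_infHom _ _ a)

/-- The homomorphism from the groupoid `C*`-algebra to the `C*`-colimit. -/
def ofGroupoidCStar : GroupoidCStar σ →⋆ₙₐ[ℂ] S.BInf :=
  Env.lift (S.canonical.comp ((infEquiv S).symm : Steinberg σ →⋆ₙₐ[ℂ] S.AInf))

theorem ofGroupoidCStar_ι (f : Steinberg σ) :
    ofGroupoidCStar S (Env.ι f) = S.canonical ((infEquiv S).symm f) := Env.lift_ι _ f

theorem ofGroupoidCStar_toGroupoidCStar (x : S.BInf) :
    ofGroupoidCStar S (toGroupoidCStar S x) = x :=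
  Env.apply_apply_eq_self (toGroupoidCStar S) (ofGroupoidCStar S) RefinedSeq.denseRange_canonical
    (fun a => (congrArg (ofGroupoidCStar S) (toGroupoidCStar_canonical S a)).trans
      ((ofGroupoidCStar_ι S (infEquiv S a)).trans
        (congrArg S.canonical ((infEquiv S).symm_apply_apply a)))) x

theorem toGroupoidCStar_ofGroupoidCStar (y : GroupoidCStar σ) :
    toGroupoidCStar S (ofGroupoidCStar S y) = y :=
  Env.apply_apply_eq_self (ofGroupoidCStar S) (toGroupoidCStar S) (Env.denseRange_ι (A := Steinberg σ))
    (fun f => (congrArg (toGroupoidCStar S) (ofGroupoidCStar_ι S f)).trans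
      ((toGroupoidCStar_canonical S ((infEquiv S).symm f)).trans
        (congrArg Env.ι ((infEquiv S).apply_symm_apply f)))) y

/-- The isomorphism of the `C*`-colimit with the groupoid `C*`-algebra. -/
def groupoidCStarEquiv : S.BInf ≃⋆ₐ[ℂ] GroupoidCStar σ :=
  StarAlgEquiv.ofBijective (toGroupoidCStar S)
    (Function.bijective_iff_has_inverse.mpr ⟨ofGroupoidCStar S, ofGroupoidCStar_toGroupoidCStar S,
      toGroupoidCStar_ofGroupoidCStar S⟩)

/-- Uniqueness needs only that the image of the algebraic colimit is dense and that *-homomorphisms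
of C*-algebras are continuous. -/
theorem existsUnique_groupoidCStarEquiv :
    ∃! ψ : S.BInf ≃⋆ₐ[ℂ] GroupoidCStar σ, ∀ a, ψ (S.canonical a) = Env.ι (infEquiv S a) := by
  refine ⟨groupoidCStarEquiv S, toGroupoidCStar_canonical S, fun ψ h => StarAlgEquiv.ext fun x => ?_⟩
  exact RefinedSeq.hom_ext_canonical (f := (ψ : S.BInf →⋆ₙₐ[ℂ] GroupoidCStar σ)) (g := toGroupoidCStar S)
    (fun a => (h a).trans (toGroupoidCStar_canonical S a).symm) x

end Main

end DRAlg

end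

open DRAlg in
theorem theorem6p15 {X : Type*} [MetricSpace X] [CompactSpace X] [TotallyDisconnectedSpace X]
    (σ : LHomeo X) (S : RefinedSeq σ) :
    (∃! φ : S.AInf ≃⋆ₐ[ℂ] Steinberg σ, S.HasStandardValues φ) ∧
      ∀ φ : S.AInf ≃⋆ₐ[ℂ] Steinberg σ, S.HasStandardValues φ →
        ∃! ψ : S.BInf ≃⋆ₐ[ℂ] GroupoidCStar σ,
          ∀ a : S.AInf, ψ (S.canonical a) = Env.ι (φ a) := by
  refine ⟨existsUnique_hasStandardValues S, fun φ hφ => ?_⟩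
  -- The standard values force φ to be the isomorphism constructed above, for which the second
  -- assertion has been shown.
  rw [hφ.eq_infEquiv]
  exact existsUnique_groupoidCStarEquiv S
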